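/- Let $k$ be an algebraically closed field of characteristic $0$, let $\ell>1$ be an odd integer, let $q\in k$ be a primitive $\ell$-th root of unity, put $i_0=(\ell+1)/2$ and write $q^{1/2}:=q^{i_0}$, a square root of $q$ (so $q^{m/2}:=(q^{1/2})^m$ for $m\in\mathbb Z$). Let $H=\bar{\mathscr A}_q(2)$ be the $2$-rank Taft algebra: the Hopf algebra over $k$ generated by $K_1^{\pm1},K_2^{\pm1},x_1,x_2$ (with $K_i=K(\epsilon_i)$) subject to $K_iK_i^{-1}=K_i^{-1}K_i=1$, $K_iK_j=K_jK_i$, $K_i^\ell=1$, $K_ix_jK_i^{-1}=\theta_{ij}q^{\delta_{ij}}x_j$, $x_ix_j=\theta_{ij}x_jx_i$, $x_i^\ell=0$, where $\theta_{ij}=q,1,q^{-1}$ according as $i>j$, $i=j$, $i<j$; with $\Delta(K_i)=K_i\otimes K_i$, $\Delta(x_i)=x_i\otimes1+K_i\otimes x_i$, $\varepsilon(K_i)=1$, $\varepsilon(x_i)=0$, $s(K_i)=K_i^{-1}$, $s(x_i)=-K_i^{-1}x_i$. Let $D(H)$ be its Drinfel'd double: the space $H^*\otimes H$ with unit $\varepsilon\otimes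 1$, product $(p\otimes h)(p'\otimes h')=\sum p\,(h_{(1)}\rightharpoonup p'\leftharpoonup s^{-1}(h_{(3)}))\otimes h_{(2)}h'$, where $(a\rightharpoonup p'\leftharpoonup c)(y)=p'(cya)$ and $H^*$ has the convolution product, and with coproduct $\Delta(p\otimes h)=\sum(p_{(2)}\otimes h_{(1)})\otimes(p_{(1)}\otimes h_{(2)})$, where $p(yz)=\sum p_{(1)}(y)p_{(2)}(z)$, and universal $R$-matrix $\sum_i(\varepsilon\otimes h_i)\otimes(h^i\otimes1)$, with $(h_i)$, $(h^i)$ dual bases of $H$ and $H^*$. For a $D(H)$-module $V$ let $R_V=\tau\circ(\text{action of the universal }R\text{-matrix})$ on $V\otimes V$, where $\tau$ is the flip. Let $M=\bar{\mathscr A}_{(\ell-1)\epsilon_2,\,i_0(\epsilon_1+\epsilon_2)}$ be the following $D(H)$-module (it is the $4$-dimensional self-dual simple module). Let $\chi:H\to k$ be the character with $\chi(K_1)=1$, $\chi(K_2)=q^{\ell-1}$, $\chi(x_i)=0$. Then $H$ acts on itself by $h\bullet a=\sum\chi(h_{(2)})\,h_{(3)}\,a\,s^{-1}(h_{(1)})$,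 the dual $H^*$ acts on $H$ by $p\cdot a=\sum p(a_{(2)})a_{(1)}$, and $(p\otimes h)\cdot a=p\cdot(h\bullet a)$ makes $H$ a $D(H)$-module; $M$ is its submodule $H\bullet(K_1^{i_0}K_2^{i_0})$. For $r\ge2$ and $s,t\in k^\times$ with $s\neq s^{-1}$, the Birman–Murakami–Wenzl algebra $\mathscr B_r(s,t)$ is the unital associative $k$-algebra generated by invertible elements $T_i$ $(1\le i\le r-1)$ subject to the following relations, where $E_i=1-\omega^{-1}(T_i-T_i^{-1})$ and $\omega=s-s^{-1}$: (a) $(T_i-s)(T_i+s^{-1})(T_i-t^{-1})=0$ for $1\le i\le r-1$; (b) $T_iT_{i+1}T_i=T_{i+1}T_iT_{i+1}$ for $1\le i\le r-2$; (c) $T_iT_j=T_jT_i$ for $|i-j|>1$; (d) $E_iT_j^{\pm1}E_i=t^{\pm1}E_i$ for $1\le i,j\le r-1$ with $|i-j|=1$; (e) $E_iT_i=T_iE_i=t^{-1}E_i$ for $1\le i\le r-1$. **Theorem.** Let $r\ge2$, and for $1\le i\le r-1$ let $R_i=\mathrm{Id}_M^{\otimes(i-1)}\otimes R_M\otimes\mathrm{Id}_M^{\otimes(r-i-1)}$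 on $M^{\otimes r}$. There exists a homomorphism of unital $k$-algebras $$\Phi:\mathscr B_r(q^{-1/2},q^{-3/2})\longrightarrow\operatorname{End}_{D(H)}(M^{\otimes r}),\qquad T_i\longmapsto R_i\quad(1\le i\le r-1).$$ In particular each $R_i$ is an invertible $D(H)$-linear map, and $$\Phi(E_i)=\mathrm{Id}_M^{\otimes r}-(q^{-1/2}-q^{1/2})^{-1}(R_i-R_i^{-1}).$$ -/

import Mathlib

open scoped TensorProduct

namespace Taft

/-- Generators of the `n`-rank Taft algebra: `K(ε_i)`, `K(ε_i)⁻¹` and `x_i`. -/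
inductive Gen (n : ℕ) : Type
  | K (i : Fin n)
  | Kinv (i : Fin n)
  | x (i : Fin n)

/-- The value `θ(ε_i, ε_j)` of the skew bicharacter `θ` on basis vectors. -/
def theta {k : Type*} [Field k] {n : ℕ} (q : k) (i j : Fin n) : k :=
  if j < i then q else if i = j then 1 else q⁻¹

open FreeAlgebra in
/-- Defining relations of the `n`-rank Taft algebra. -/
inductive Rel (k : Type*) [Field k] (n ℓ : ℕ) (q : k) :
    FreeAlgebra k (Gen n) → FreeAlgebra k (Gen n) → Prop
  | K_comm (i j : Fin n) :
      Rel k n ℓ q (ι k (.K i) * ι k (.K j)) (ι k (.K j) * ι k (.K i))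
  | K_Kinv (i : Fin n) : Rel k n ℓ q (ι k (.K i) * ι k (.Kinv i)) 1
  | Kinv_K (i : Fin n) : Rel k n ℓ q (ι k (.Kinv i) * ι k (.K i)) 1
  | K_pow (i : Fin n) : Rel k n ℓ q (ι k (.K i) ^ ℓ) 1
  | K_x (i j : Fin n) :
      Rel k n ℓ q (ι k (.K i) * ι k (.x j) * ι k (.Kinv i))
        ((theta q i j * if i = j then q else 1) • ι k (.x j))
  | x_x (i j : Fin n) :
      Rel k n ℓ q (ι k (.x i) * ι k (.x j)) (theta q i j • (ι k (.x j) * ι k (.x i)))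
  | x_pow (i : Fin n) : Rel k n ℓ q (ι k (.x i) ^ ℓ) 0

end Taft

/-- The `n`-rank Taft algebra over `k` at the parameter `q`; the Hopf structure is available when
`q` is a primitive `ℓ`-th root of unity. -/
def TaftAlgebra (k : Type*) [Field k] (n ℓ : ℕ) (q : k) : Type _ := RingQuot (Taft.Rel k n ℓ q)

namespace TaftAlgebra

section Basic

variable {k : Type*} [Field k] {n ℓ : ℕ} {q : k}

noncomputable instance : Ring (TaftAlgebra k n ℓ q) :=
  inferInstanceAs (Ring (RingQuot (Taft.Rel k n ℓ q)))

noncomputable instance : Algebra k (TaftAlgebra k n ℓ q) :=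
  inferInstanceAs (Algebra k (RingQuot (Taft.Rel k n ℓ q)))

/-- The quotient map from the free algebra. -/
noncomputable def mk : FreeAlgebra k (Taft.Gen n) →ₐ[k] TaftAlgebra k n ℓ q :=
  RingQuot.mkAlgHom k (Taft.Rel k n ℓ q)

theorem mk_rel {a b : FreeAlgebra k (Taft.Gen n)} (h : Taft.Rel k n ℓ q a b) :
    (mk a : TaftAlgebra k n ℓ q) = mk b :=
  RingQuot.mkAlgHom_rel k h

/-- The class of a free generator. -/
noncomputable def gen (g : Taft.Gen n) : TaftAlgebra k n ℓ q := mk (FreeAlgebra.ι k g)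

/-- The group-like element `K(ε_i)`. -/
noncomputable def K (i : Fin n) : TaftAlgebra k n ℓ q := gen (.K i)

/-- The group-like element `K(ε_i)⁻¹`. -/
noncomputable def Kinv (i : Fin n) : TaftAlgebra k n ℓ q := gen (.Kinv i)

/-- The skew-primitive element `x_i`. -/
noncomputable def x (i : Fin n) : TaftAlgebra k n ℓ q := gen (.x i)

theorem K_comm (i j : Fin n) : (K i * K j : TaftAlgebra k n ℓ q) = K j * K i := by
  have h := mk_rel (Taft.Rel.K_comm (k := k) (ℓ := ℓ) (q := q) i j)
  simpa only [map_mul] using! h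

@[simp] theorem K_mul_Kinv (i : Fin n) : (K i * Kinv i : TaftAlgebra k n ℓ q) = 1 := by
  have h := mk_rel (Taft.Rel.K_Kinv (k := k) (ℓ := ℓ) (q := q) i)
  simpa only [map_mul, map_one] using! h

@[simp] theorem Kinv_mul_K (i : Fin n) : (Kinv i * K i : TaftAlgebra k n ℓ q) = 1 := by
  have h := mk_rel (Taft.Rel.Kinv_K (k := k) (ℓ := ℓ) (q := q) i)
  simpa only [map_mul, map_one] using! h

theorem K_pow (i : Fin n) : (K i : TaftAlgebra k n ℓ q) ^ ℓ = 1 := by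
  have h := mk_rel (Taft.Rel.K_pow (k := k) (ℓ := ℓ) (q := q) i)
  simpa only [map_pow, map_one] using! h

theorem K_x_Kinv (i j : Fin n) : (K i * x j * Kinv i : TaftAlgebra k n ℓ q) =
    (Taft.theta q i j * if i = j then q else 1) • x j := by
  have h := mk_rel (Taft.Rel.K_x (k := k) (ℓ := ℓ) (q := q) i j)
  simpa only [map_mul, map_smul] using! h

theorem x_mul_x (i j : Fin n) : (x i * x j : TaftAlgebra k n ℓ q) =
    Taft.theta q i j • (x j * x i) := by
  have h := mk_rel (Taft.Rel.x_x (k := k) (ℓ := ℓ) (q := q) i j)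
  simpa only [map_mul, map_smul] using! h

theorem x_pow (i : Fin n) : (x i : TaftAlgebra k n ℓ q) ^ ℓ = 0 := by
  have h := mk_rel (Taft.Rel.x_pow (k := k) (ℓ := ℓ) (q := q) i)
  simpa only [map_pow, map_zero] using! h

/-- Elements of an algebra satisfying the defining relations. -/
structure IsRealization {B : Type*} [Semiring B] [Algebra k B] (ℓ : ℕ) (q : k)
    (fK fKinv fx : Fin n → B) : Prop where
  K_comm (i j : Fin n) : fK i * fK j = fK j * fK i
  K_Kinv (i : Fin n) : fK i * fKinv i = 1
  Kinv_K (i : Fin n) : fKinv i * fK i = 1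
  K_pow (i : Fin n) : fK i ^ ℓ = 1
  K_x (i j : Fin n) : fK i * fx j * fKinv i = (Taft.theta q i j * if i = j then q else 1) • fx j
  x_x (i j : Fin n) : fx i * fx j = Taft.theta q i j • (fx j * fx i)
  x_pow (i : Fin n) : fx i ^ ℓ = 0

/-- Universal property of the `n`-rank Taft algebra. -/
noncomputable def lift {B : Type*} [Semiring B] [Algebra k B] {fK fKinv fx : Fin n → B}
    (h : IsRealization ℓ q fK fKinv fx) : TaftAlgebra k n ℓ q →ₐ[k] B :=
  RingQuot.liftAlgHom k ⟨FreeAlgebra.lift k (fun g => match g with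
    | .K i => fK i
    | .Kinv i => fKinv i
    | .x i => fx i), by
      intro a b hab
      induction hab with
      | K_comm i j => simpa using h.K_comm i j
      | K_Kinv i => simpa using h.K_Kinv i
      | Kinv_K i => simpa using h.Kinv_K i
      | K_pow i => simpa using h.K_pow i
      | K_x i j =>
        rw [map_smul, map_mul, map_mul]
        simpa only [FreeAlgebra.lift_ι_apply] using h.K_x i j
      | x_x i j => simpa using h.x_x i j
      | x_pow i => simpa using h.x_pow i⟩

section lift

variable {B : Type*} [Semiring B] [Algebra k B] {fK fKinv fx : Fin n → B}
    (h : IsRealization ℓ q fK fKinv fx)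

@[simp] theorem lift_K (i : Fin n) : lift h (K i) = fK i :=
  (RingQuot.liftAlgHom_mkAlgHom_apply k _ _ _).trans (FreeAlgebra.lift_ι_apply _ _)

@[simp] theorem lift_Kinv (i : Fin n) : lift h (Kinv i) = fKinv i :=
  (RingQuot.liftAlgHom_mkAlgHom_apply k _ _ _).trans (FreeAlgebra.lift_ι_apply _ _)

@[simp] theorem lift_x (i : Fin n) : lift h (x i) = fx i :=
  (RingQuot.liftAlgHom_mkAlgHom_apply k _ _ _).trans (FreeAlgebra.lift_ι_apply _ _)

end lift

theorem adjoin_gen : Algebra.adjoin k (Set.range (gen : Taft.Gen n → TaftAlgebra k n ℓ q)) = ⊤ := by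
  have h : Set.range (gen : Taft.Gen n → TaftAlgebra k n ℓ q) =
      (mk : _ →ₐ[k] TaftAlgebra k n ℓ q) '' Set.range (FreeAlgebra.ι k) := by
    rw [← Set.range_comp]; rfl
  rw [h, ← AlgHom.map_adjoin, FreeAlgebra.adjoin_range_ι, Algebra.map_top]
  exact (AlgHom.range_eq_top _).2 (RingQuot.mkAlgHom_surjective k _)

theorem algHom_ext {B : Type*} [Semiring B] [Algebra k B] {f g : TaftAlgebra k n ℓ q →ₐ[k] B}
    (hK : ∀ i, f (K i) = g (K i)) (hKinv : ∀ i, f (Kinv i) = g (Kinv i))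
    (hx : ∀ i, f (x i) = g (x i)) : f = g := by
  apply AlgHom.ext_of_adjoin_eq_top adjoin_gen
  rintro _ ⟨g, rfl⟩
  cases g
  · exact hK _
  · exact hKinv _
  · exact hx _


theorem K_mul_x (i j : Fin n) : (K i * x j : TaftAlgebra k n ℓ q) =
    (Taft.theta q i j * if i = j then q else 1) • (x j * K i) := by
  rw [← smul_mul_assoc, ← K_x_Kinv, mul_assoc, Kinv_mul_K, mul_one]

end Basic

end TaftAlgebra

namespace Taft

/-- Gaussian binomial coefficients. -/
def gauss {k : Type*} [Field k] (q : k) : ℕ → ℕ → k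
  | _, 0 => 1
  | 0, _ + 1 => 0
  | m + 1, j + 1 => gauss q m j + q ^ (j + 1) * gauss q m (j + 1)

theorem gauss_eq_zero {k : Type*} [Field k] (q : k) (m j : ℕ) (h : m < j) : gauss q m j = 0 := by
  induction m generalizing j with
  | zero => cases j with
    | zero => omega
    | succ j => rfl
  | succ m ih => cases j with
    | zero => omega
    | succ j => simp [gauss, ih j (by omega), ih (j + 1) (by omega)]

theorem gauss_self {k : Type*} [Field k] (q : k) (m : ℕ) : gauss q m m = 1 := by
  induction m with
  | zero => rfl
  | succ m ih => simp [gauss, ih, gauss_eq_zero q m (m + 1) (by omega)]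

theorem gauss_mul_prod {k : Type*} [Field k] (q : k) (m j : ℕ) :
    gauss q m j * ∏ i ∈ Finset.range j, (q ^ (i + 1) - 1) =
      ∏ i ∈ Finset.range j, (q ^ (m - i) - 1) := by
  induction m generalizing j with
  | zero => cases j with
    | zero => simp [gauss]
    | succ j => simp [gauss, Finset.prod_range_succ']
  | succ m ih => cases j with
    | zero => simp [gauss]
    | succ j =>
      have e1 := ih j
      have e2 := ih (j + 1)
      rw [Finset.prod_range_succ (fun i => q ^ (m - i) - 1)] at e2
      rw [Finset.prod_range_succ' (fun i => q ^ (m + 1 - i) - 1)]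
      simp only [Nat.add_sub_add_right, Nat.sub_zero]
      have e3 : gauss q (m + 1) (j + 1) = gauss q m j + q ^ (j + 1) * gauss q m (j + 1) := rfl
      rw [e3, add_mul, mul_assoc (q ^ (j + 1)), e2, Finset.prod_range_succ, ← mul_assoc, e1]
      by_cases hj : j ≤ m
      · have e4 : q ^ (m + 1) = q ^ (j + 1) * q ^ (m - j) := by
          rw [← pow_add]; congr 1; omega
        rw [e4]; ring
      · have e5 : ∏ i ∈ Finset.range j, (q ^ (m - i) - 1) = 0 :=
          Finset.prod_eq_zero (i := m) (by simp; omega) (by simp)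
        rw [e5]; ring

theorem gauss_primitive {k : Type*} [Field k] {q : k} {ℓ : ℕ} (hq : IsPrimitiveRoot q ℓ) {j : ℕ}
    (h0 : 0 < j) (hj : j < ℓ) : gauss q ℓ j = 0 := by
  have h := gauss_mul_prod q ℓ j
  have h1 : ∏ i ∈ Finset.range j, (q ^ (ℓ - i) - 1) = 0 :=
    Finset.prod_eq_zero (i := 0) (by simpa using h0) (by simp [hq.pow_eq_one])
  rw [h1] at h
  refine (mul_eq_zero.1 h).resolve_right (Finset.prod_ne_zero_iff.2 fun i hi => ?_)
  rw [Finset.mem_range] at hi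
  exact sub_ne_zero.2 (hq.pow_ne_one_of_pos_of_lt (by omega) (by omega))

theorem add_pow_gauss {k B : Type*} [Field k] [Ring B] [Algebra k B] {q : k} {a b : B}
    (h : b * a = q • (a * b)) (m : ℕ) :
    (a + b) ^ m = ∑ j ∈ Finset.range (m + 1), gauss q m j • (a ^ j * b ^ (m - j)) := by
  have hb : ∀ j : ℕ, b * a ^ j = q ^ j • (a ^ j * b) := by
    intro j
    induction j with
    | zero => simp
    | succ j ih =>
      rw [pow_succ, ← mul_assoc, ih, smul_mul_assoc, mul_assoc, h, mul_smul_comm, smul_smul,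
        pow_succ, mul_assoc]
  induction m with
  | zero => simp [gauss]
  | succ m ih =>
    rw [pow_succ', ih, add_mul, Finset.mul_sum, Finset.mul_sum, Finset.sum_range_succ' _ (m + 1)]
    have e1 : ∀ j ∈ Finset.range (m + 1), b * gauss q m j • (a ^ j * b ^ (m - j)) =
        (q ^ j * gauss q m j) • (a ^ j * b ^ (m + 1 - j)) := by
      intro j hj
      rw [Finset.mem_range] at hj
      rw [mul_smul_comm, ← mul_assoc, hb, smul_mul_assoc, smul_smul, mul_comm (q ^ j), mul_assoc,
        ← pow_succ', show m - j + 1 = m + 1 - j by omega]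
    rw [Finset.sum_congr rfl e1]
    have e2 : ∑ j ∈ Finset.range (m + 1), (q ^ j * gauss q m j) • (a ^ j * b ^ (m + 1 - j)) =
        ∑ j ∈ Finset.range (m + 2), (q ^ j * gauss q m j) • (a ^ j * b ^ (m + 1 - j)) := by
      rw [Finset.sum_range_succ _ (m + 1), gauss_eq_zero q m (m + 1) (by omega)]
      simp
    rw [e2, Finset.sum_range_succ' _ (m + 1), ← add_assoc, ← Finset.sum_add_distrib]
    congr 1
    · refine Finset.sum_congr rfl fun j _ => ?_
      rw [mul_smul_comm, ← mul_assoc, ← pow_succ', Nat.add_sub_add_right, ← add_smul]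
      rfl
    · cases m <;> simp [gauss]

theorem add_pow_primitive {k B : Type*} [Field k] [Ring B] [Algebra k B] {q : k} {ℓ : ℕ}
    (hℓ : ℓ ≠ 0) (hq : IsPrimitiveRoot q ℓ) {a b : B} (h : b * a = q • (a * b)) :
    (a + b) ^ ℓ = a ^ ℓ + b ^ ℓ := by
  obtain ⟨m, rfl⟩ := Nat.exists_eq_succ_of_ne_zero hℓ
  rw [add_pow_gauss h, Finset.sum_range_succ, Finset.sum_range_succ', Finset.sum_eq_zero]
  · rw [gauss_self]; simp [gauss, add_comm]
  · intro j hj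
    rw [Finset.mem_range] at hj
    rw [gauss_primitive hq (by omega) (by omega), zero_smul]

end Taft

namespace TaftAlgebra

theorem q_ne_zero {k : Type*} [Field k] {ℓ : ℕ} [NeZero ℓ] {q : k}
    (hq : IsPrimitiveRoot q ℓ) : q ≠ 0 := hq.ne_zero (NeZero.ne ℓ)

theorem theta_mul_theta {k : Type*} [Field k] {n : ℕ} {q : k} (hq : q ≠ 0) (i j : Fin n) :
    Taft.theta q i j * Taft.theta q j i = 1 := by
  rcases lt_trichotomy i j with h | h | h
  · have h1 : ¬ j < i := by omega
    have h2 : i ≠ j := by omega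
    simp [Taft.theta, h, h1, h2, hq]
  · subst h
    simp [Taft.theta]
  · have h1 : ¬ i < j := by omega
    have h2 : i ≠ j := by omega
    simp [Taft.theta, h, h1, h2.symm, hq]

section Inverse

variable {k : Type*} [Field k] {n ℓ : ℕ} {q : k}

theorem Kinv_mul_K_comm (i j : Fin n) :
    (Kinv i * K j : TaftAlgebra k n ℓ q) = K j * Kinv i := by
  have h : (Kinv i * (K j * K i) * Kinv i : TaftAlgebra k n ℓ q) = Kinv i * (K i * K j) * Kinv i := by
    rw [K_comm]
  rw [← mul_assoc, mul_assoc _ (K i), K_mul_Kinv, ← mul_assoc, Kinv_mul_K] at h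
  simpa using h

theorem Kinv_comm (i j : Fin n) : (Kinv i * Kinv j : TaftAlgebra k n ℓ q) = Kinv j * Kinv i := by
  have h : (Kinv i * (Kinv j * K i) * Kinv i : TaftAlgebra k n ℓ q) =
      Kinv i * (K i * Kinv j) * Kinv i := by
    rw [Kinv_mul_K_comm]
  rw [← mul_assoc, mul_assoc _ (K i), K_mul_Kinv, ← mul_assoc, Kinv_mul_K] at h
  simpa using h

theorem Kinv_pow (i : Fin n) : (Kinv i : TaftAlgebra k n ℓ q) ^ ℓ = 1 := by
  have h : (Kinv i * K i : TaftAlgebra k n ℓ q) ^ ℓ = 1 := by rw [Kinv_mul_K, one_pow]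
  have hc : Commute (Kinv i : TaftAlgebra k n ℓ q) (K i) := Kinv_mul_K_comm i i
  rwa [hc.mul_pow, K_pow, mul_one] at h

theorem x_mul_Kinv (i j : Fin n) : (x j * Kinv i : TaftAlgebra k n ℓ q) =
    (Taft.theta q i j * if i = j then q else 1) • (Kinv i * x j) := by
  have h : (Kinv i * (K i * x j * Kinv i) : TaftAlgebra k n ℓ q) = x j * Kinv i := by
    rw [mul_assoc (K i), ← mul_assoc, Kinv_mul_K, one_mul]
  rw [← h, K_x_Kinv, mul_smul_comm]

theorem pow_eq_zero_aux {B : Type*} [Ring B] [Algebra k B] {a b : B} {c : k}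
    (h : b * a = c • (a * b)) (hb : b ^ ℓ = 0) : (a * b) ^ ℓ = 0 := by
  have h1 : ∀ m : ℕ, b ^ m * a = c ^ m • (a * b ^ m) := by
    intro m
    induction m with
    | zero => simp
    | succ m ih =>
      rw [pow_succ b, mul_assoc, h, mul_smul_comm, ← mul_assoc, ih, smul_mul_assoc, smul_smul,
        mul_assoc, pow_succ' c]
  have h2 : ∀ m : ℕ, ∃ d : k, (a * b) ^ m = d • (a ^ m * b ^ m) := by
    intro m
    induction m with
    | zero => exact ⟨1, by simp⟩
    | succ m ih =>
      obtain ⟨d, hd⟩ := ih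
      refine ⟨d * c ^ m, ?_⟩
      rw [pow_succ, hd, smul_mul_assoc, mul_assoc (a ^ m), ← mul_assoc (b ^ m), h1,
        smul_mul_assoc, mul_smul_comm, smul_smul, pow_succ a, pow_succ b]
      simp only [mul_assoc]
  obtain ⟨d, hd⟩ := h2 ℓ
  rw [hd, hb, mul_zero, smul_zero]

end Inverse

section Hopf

variable {k : Type*} [Field k] {n ℓ : ℕ} [NeZero ℓ] {q : k} [hq : Fact (IsPrimitiveRoot q ℓ)]

variable (k n ℓ q)

theorem counit_realization :
    IsRealization ℓ q (fun _ : Fin n => (1 : k)) (fun _ => 1) (fun _ => 0) := by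
  constructor <;> simp [NeZero.ne ℓ]

theorem comul_realization :
    IsRealization ℓ q (fun i : Fin n => (K i ⊗ₜ K i : TaftAlgebra k n ℓ q ⊗[k] TaftAlgebra k n ℓ q))
      (fun i => Kinv i ⊗ₜ Kinv i) (fun i => x i ⊗ₜ 1 + K i ⊗ₜ x i) where
  K_comm := by intro i j; simp [K_comm i j]
  K_Kinv := by intro i; simp [Algebra.TensorProduct.one_def]
  Kinv_K := by intro i; simp [Algebra.TensorProduct.one_def]
  K_pow := by intro i; simp [K_pow, Algebra.TensorProduct.one_def]
  K_x := by
      intro i j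
      simp only [mul_add, add_mul, Algebra.TensorProduct.tmul_mul_tmul, mul_one, K_mul_Kinv,
        K_x_Kinv, K_comm i j, smul_add]
      rw [mul_assoc (K j), K_mul_Kinv, mul_one, TensorProduct.smul_tmul', TensorProduct.tmul_smul]
  x_x := by
      intro i j
      have hq0 : q ≠ 0 := q_ne_zero hq.out
      simp only [mul_add, add_mul, Algebra.TensorProduct.tmul_mul_tmul, mul_one, one_mul,
        K_mul_x, x_mul_x i j, K_comm i j, smul_add, TensorProduct.smul_tmul',
        TensorProduct.tmul_smul, smul_smul]
      rcases lt_trichotomy i j with h | h | h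
      · have h1 : ¬ j < i := by omega
        have h2 : i ≠ j := by omega
        simp [Taft.theta, h, h1, h2, h2.symm, hq0]
        abel
      · subst h
        simp [Taft.theta]
      · have h1 : ¬ i < j := by omega
        have h2 : i ≠ j := by omega
        simp [Taft.theta, h, h1, h2, h2.symm, hq0]
        abel
  x_pow := by
      intro i
      rw [Taft.add_pow_primitive (NeZero.ne ℓ) hq.out]
      · simp [x_pow]
      · simp only [Algebra.TensorProduct.tmul_mul_tmul, mul_one, one_mul, K_mul_x,
          TensorProduct.smul_tmul']
        simp [Taft.theta]

/-- The counit: `ε(K(ε_i)) = 1`, `ε(x_i) = 0`. -/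
noncomputable def counitHom : TaftAlgebra k n ℓ q →ₐ[k] k :=
  lift (counit_realization k n ℓ q)

/-- The comultiplication: `Δ(K(ε_i)) = K(ε_i) ⊗ K(ε_i)`, `Δ(x_i) = x_i ⊗ 1 + K(ε_i) ⊗ x_i`. -/
noncomputable def comulHom :
    TaftAlgebra k n ℓ q →ₐ[k] TaftAlgebra k n ℓ q ⊗[k] TaftAlgebra k n ℓ q :=
  lift (comul_realization k n ℓ q)

variable {k n ℓ q}

theorem antipode_rel_aux (i j : Fin n) :
    (Kinv j * x j * (Kinv i * x i) : TaftAlgebra k n ℓ q) =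
      Taft.theta q i j • (Kinv i * x i * (Kinv j * x j)) := by
  by_cases hij : i = j
  · subst hij
    simp [Taft.theta]
  · have h1 : (Kinv j * x j * (Kinv i * x i) : TaftAlgebra k n ℓ q) =
        Taft.theta q i j • (Kinv j * Kinv i * (x j * x i)) := by
      rw [mul_assoc, ← mul_assoc (x j), x_mul_Kinv, smul_mul_assoc, mul_smul_comm]
      simp [hij, mul_assoc]
    have h2 : (Kinv i * x i * (Kinv j * x j) : TaftAlgebra k n ℓ q) =
        Taft.theta q j i • (Kinv j * Kinv i * (x i * x j)) := by
      rw [mul_assoc, ← mul_assoc (x i), x_mul_Kinv, smul_mul_assoc, mul_smul_comm, Kinv_comm j i]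
      simp [Ne.symm hij, mul_assoc]
    rw [h1, h2, x_mul_x i j, mul_smul_comm, smul_smul, smul_smul]
    rw [theta_mul_theta (q_ne_zero hq.out), one_mul]

variable (k n ℓ q)

theorem antiHom_realization (c : k) :
    IsRealization ℓ q (fun i : Fin n => MulOpposite.op (Kinv i : TaftAlgebra k n ℓ q))
      (fun i => .op (K i)) (fun i => .op (c • (Kinv i * x i))) where
  K_comm := by intro i j; rw [← MulOpposite.op_mul, ← MulOpposite.op_mul, Kinv_comm]
  K_Kinv := by intro i; rw [← MulOpposite.op_mul, K_mul_Kinv, MulOpposite.op_one]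
  Kinv_K := by intro i; rw [← MulOpposite.op_mul, Kinv_mul_K, MulOpposite.op_one]
  K_pow := by intro i; rw [← MulOpposite.op_pow, Kinv_pow, MulOpposite.op_one]
  K_x := by
      intro i j
      rw [← MulOpposite.op_mul, ← MulOpposite.op_mul, ← MulOpposite.op_smul, smul_mul_assoc,
        mul_smul_comm, ← mul_assoc, ← mul_assoc, ← Kinv_mul_K_comm j i, mul_assoc, mul_assoc,
        ← mul_assoc (K i), K_x_Kinv, mul_smul_comm, smul_comm]
  x_x := by
      intro i j
      rw [← MulOpposite.op_mul, ← MulOpposite.op_mul, ← MulOpposite.op_smul]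
      simp only [smul_mul_assoc, mul_smul_comm]
      rw [antipode_rel_aux i j, smul_comm (Taft.theta q i j), smul_comm (Taft.theta q i j)]
  x_pow := by
      intro i
      rw [← MulOpposite.op_pow, smul_pow, pow_eq_zero_aux (x_mul_Kinv i i) (x_pow i), smul_zero,
        MulOpposite.op_zero]

/-- The anti-homomorphism inverting all `K(ε_i)` and sending `x_i` to `c • K(ε_i)⁻¹ x_i`. -/
noncomputable def antiHom (c : k) : TaftAlgebra k n ℓ q →ₐ[k] (TaftAlgebra k n ℓ q)ᵐᵒᵖ :=
  lift (antiHom_realization k n ℓ q c)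

@[simp] theorem comulHom_K (i : Fin n) :
    comulHom k n ℓ q (K i) = K i ⊗ₜ K i :=
  lift_K _ i

@[simp] theorem comulHom_Kinv (i : Fin n) :
    comulHom k n ℓ q (Kinv i) = Kinv i ⊗ₜ Kinv i :=
  lift_Kinv _ i

@[simp] theorem comulHom_x (i : Fin n) :
    comulHom k n ℓ q (x i) = x i ⊗ₜ 1 + K i ⊗ₜ x i :=
  lift_x _ i

@[simp] theorem counitHom_K (i : Fin n) :
    counitHom k n ℓ q (K i) = 1 :=
  lift_K _ i

@[simp] theorem counitHom_Kinv (i : Fin n) :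
    counitHom k n ℓ q (Kinv i) = 1 :=
  lift_Kinv _ i

@[simp] theorem counitHom_x (i : Fin n) :
    counitHom k n ℓ q (x i) = 0 :=
  lift_x _ i

@[simp] theorem antiHom_K (c : k) (i : Fin n) :
    antiHom k n ℓ q c (K i) = .op (Kinv i) :=
  lift_K _ i

@[simp] theorem antiHom_Kinv (c : k) (i : Fin n) :
    antiHom k n ℓ q c (Kinv i) = .op (K i) :=
  lift_Kinv _ i

@[simp] theorem antiHom_x (c : k) (i : Fin n) :
    antiHom k n ℓ q c (x i) = .op (c • (Kinv i * x i)) :=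
  lift_x _ i

noncomputable instance : Bialgebra k (TaftAlgebra k n ℓ q) :=
  Bialgebra.ofAlgHom (comulHom k n ℓ q) (counitHom k n ℓ q)
    (by
      apply algHom_ext <;> intro i <;>
        simp [TensorProduct.add_tmul, TensorProduct.tmul_add,
          Algebra.TensorProduct.one_def, add_assoc])
    (by apply algHom_ext <;> intro i <;> simp)
    (by apply algHom_ext <;> intro i <;> simp)

variable {k n ℓ q}

@[simp] theorem comul_K (i : Fin n) :
    Coalgebra.comul (R := k) (K i : TaftAlgebra k n ℓ q) = K i ⊗ₜ K i :=
  comulHom_K ..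


@[simp] theorem comul_Kinv (i : Fin n) :
    Coalgebra.comul (R := k) (Kinv i : TaftAlgebra k n ℓ q) = Kinv i ⊗ₜ Kinv i :=
  comulHom_Kinv ..


@[simp] theorem comul_x (i : Fin n) :
    Coalgebra.comul (R := k) (x i : TaftAlgebra k n ℓ q) = x i ⊗ₜ 1 + K i ⊗ₜ x i :=
  comulHom_x ..


@[simp] theorem counit_K (i : Fin n) :
    Coalgebra.counit (R := k) (K i : TaftAlgebra k n ℓ q) = 1 :=
  counitHom_K ..


@[simp] theorem counit_Kinv (i : Fin n) :
    Coalgebra.counit (R := k) (Kinv i : TaftAlgebra k n ℓ q) = 1 :=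
  counitHom_Kinv ..


@[simp] theorem counit_x (i : Fin n) :
    Coalgebra.counit (R := k) (x i : TaftAlgebra k n ℓ q) = 0 :=
  counitHom_x ..


theorem antipode_left_aux {H : Type*} [Ring H] [Algebra k H] (S : H →ₗ[k] H)
    (hS : ∀ a b, S (a * b) = S b * S a) (t u : H ⊗[k] H) (c : k)
    (ht : LinearMap.mul' k H (S.rTensor H t) = algebraMap k H c) :
    LinearMap.mul' k H (S.rTensor H (t * u)) = c • LinearMap.mul' k H (S.rTensor H u) := by
  induction u using TensorProduct.induction_on with
  | zero => simp
  | tmul d e =>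
    have h : LinearMap.mul' k H (S.rTensor H (t * d ⊗ₜ e)) =
        S d * LinearMap.mul' k H (S.rTensor H t) * e := by
      clear ht
      induction t using TensorProduct.induction_on with
      | zero => simp
      | tmul a b => simp [hS, mul_assoc]
      | add t t' h h' => simp only [add_mul, mul_add, map_add, h, h']
    rw [h, ht, ← Algebra.commutes, Algebra.algebraMap_eq_smul_one]
    simp
  | add u u' h h' => simp only [mul_add, map_add, h, h', smul_add]

theorem antipode_right_aux {H : Type*} [Ring H] [Algebra k H] (S : H →ₗ[k] H)
    (hS : ∀ a b, S (a * b) = S b * S a) (t u : H ⊗[k] H) (c : k)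
    (hu : LinearMap.mul' k H (S.lTensor H u) = algebraMap k H c) :
    LinearMap.mul' k H (S.lTensor H (t * u)) = c • LinearMap.mul' k H (S.lTensor H t) := by
  induction t using TensorProduct.induction_on with
  | zero => simp
  | tmul d e =>
    have h : LinearMap.mul' k H (S.lTensor H (d ⊗ₜ e * u)) =
        d * LinearMap.mul' k H (S.lTensor H u) * S e := by
      clear hu
      induction u using TensorProduct.induction_on with
      | zero => simp
      | tmul a b => simp [hS, mul_assoc]
      | add t t' h h' => simp only [add_mul, mul_add, map_add, h, h']
    rw [h, hu, ← Algebra.commutes, Algebra.algebraMap_eq_smul_one]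
    simp
  | add u u' h h' => simp only [add_mul, map_add, h, h', smul_add]

theorem gen_induction {P : TaftAlgebra k n ℓ q → Prop} (hK : ∀ i, P (K i))
    (hKinv : ∀ i, P (Kinv i)) (hx : ∀ i, P (x i)) (hc : ∀ c : k, P (algebraMap k _ c))
    (hadd : ∀ a b, P a → P b → P (a + b)) (hmul : ∀ a b, P a → P b → P (a * b))
    (a : TaftAlgebra k n ℓ q) : P a := by
  have ha : a ∈ Algebra.adjoin k (Set.range (gen : Taft.Gen n → TaftAlgebra k n ℓ q)) := by
    rw [adjoin_gen]; trivial
  induction ha using Algebra.adjoin_induction with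
  | mem y hy =>
    obtain ⟨g, rfl⟩ := hy
    cases g
    · exact hK _
    · exact hKinv _
    · exact hx _
  | algebraMap r => exact hc r
  | add a b _ _ ha hb => exact hadd a b ha hb
  | mul a b _ _ ha hb => exact hmul a b ha hb

/-- The antipode: `s(K(ε_i)) = K(ε_i)⁻¹`, `s(x_i) = -K(ε_i)⁻¹ x_i`. -/
noncomputable instance : HopfAlgebra k (TaftAlgebra k n ℓ q) where
  antipode := (MulOpposite.opLinearEquiv k).symm.toLinearMap ∘ₗ
    (antiHom k n ℓ q (-1)).toLinearMap
  mul_antipode_rTensor_comul := by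
    ext a
    induction a using gen_induction with
    | hK i => simp
    | hKinv i => simp
    | hx i => simp
    | hc c => simp [Algebra.TensorProduct.one_def, Algebra.algebraMap_eq_smul_one]
    | hadd a b ha hb => simp only [map_add, ha, hb]
    | hmul a b ha hb =>
      simp only [LinearMap.comp_apply] at ha hb ⊢
      rw [Bialgebra.comul_mul, antipode_left_aux _ (fun a b => by simp) _ _ _ ha, hb]
      simp [Algebra.algebraMap_eq_smul_one, smul_smul]
  mul_antipode_lTensor_comul := by
    ext a
    induction a using gen_induction with
    | hK i => simp
    | hKinv i => simp
    | hx i => simp [← mul_assoc]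
    | hc c => simp [Algebra.TensorProduct.one_def, Algebra.algebraMap_eq_smul_one]
    | hadd a b ha hb => simp only [map_add, ha, hb]
    | hmul a b ha hb =>
      simp only [LinearMap.comp_apply] at ha hb ⊢
      rw [Bialgebra.comul_mul, antipode_right_aux _ (fun a b => by simp) _ _ _ hb, ha]
      simp [Algebra.algebraMap_eq_smul_one, smul_smul, mul_comm]

end Hopf
end TaftAlgebra

namespace TaftAlgebra

section Finite

variable {k : Type*} [Field k]

theorem adjoin_singleton_mul_le {B : Type*} [Ring B] [Algebra k B] {a b : B} {c : k}
    (h : a * b = c • (b * a)) :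
    Subalgebra.toSubmodule (Algebra.adjoin k {a}) * Subalgebra.toSubmodule (Algebra.adjoin k {b}) ≤
    Subalgebra.toSubmodule (Algebra.adjoin k {b}) *
      Subalgebra.toSubmodule (Algebra.adjoin k {a}) := by
  have h1 : ∀ m : ℕ, a ^ m * b = c ^ m • (b * a ^ m) := by
    intro m
    induction m with
    | zero => simp
    | succ m ih =>
      rw [pow_succ a, mul_assoc, h, mul_smul_comm, ← mul_assoc, ih, smul_mul_assoc, smul_smul,
        mul_assoc, pow_succ' c]
  have h2 : ∀ m n : ℕ, ∃ d : k, a ^ m * b ^ n = d • (b ^ n * a ^ m) := by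
    intro m n
    induction n with
    | zero => exact ⟨1, by simp⟩
    | succ n ih =>
      obtain ⟨d, hd⟩ := ih
      exact ⟨d * c ^ m, by
        rw [pow_succ b, ← mul_assoc, hd, smul_mul_assoc, mul_assoc, h1, mul_smul_comm, smul_smul,
          mul_assoc]⟩
  conv_lhs => rw [Algebra.adjoin_eq_span, Algebra.adjoin_eq_span, Submodule.span_mul_span]
  rw [Submodule.span_le]
  rintro _ ⟨u, hu, v, hv, rfl⟩
  obtain ⟨m, rfl⟩ := Submonoid.mem_closure_singleton.1 hu
  obtain ⟨n, rfl⟩ := Submonoid.mem_closure_singleton.1 hv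
  obtain ⟨d, hd⟩ := h2 m n
  simp only [SetLike.mem_coe]
  rw [hd]
  exact Submodule.smul_mem _ _ (Submodule.mul_mem_mul
    (pow_mem (Algebra.self_mem_adjoin_singleton k b) n)
    (pow_mem (Algebra.self_mem_adjoin_singleton k a) m))

theorem adjoin_singleton_commute {B : Type*} [Ring B] [Algebra k B] {a b : B} {c : k}
    (hc : c ≠ 0) (h : a * b = c • (b * a)) :
    Commute (Subalgebra.toSubmodule (Algebra.adjoin k {a}))
      (Subalgebra.toSubmodule (Algebra.adjoin k {b})) :=
  le_antisymm (adjoin_singleton_mul_le h)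
    (adjoin_singleton_mul_le (c := c⁻¹) (by rw [h, smul_smul, inv_mul_cancel₀ hc, one_smul]))

/-- An algebra generated by finitely many integral elements which commute up to scalars is
finite-dimensional. -/
theorem finite_of_skew_commute {B : Type*} [Ring B] [Algebra k B] (L : List B)
    (hint : ∀ a ∈ L, IsIntegral k a)
    (hcomm : ∀ a ∈ L, ∀ b ∈ L, ∃ c : k, c ≠ 0 ∧ a * b = c • (b * a))
    (hgen : Algebra.adjoin k {a | a ∈ L} = ⊤) : Module.Finite k B := by
  have key : ∀ L' : List B, (∀ a ∈ L', a ∈ L) → ∃ P : Submodule k B, P.FG ∧ 1 ≤ P ∧ P * P = P ∧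
      (∀ a ∈ L', a ∈ P) ∧
      ∀ a ∈ L, Commute (Subalgebra.toSubmodule (Algebra.adjoin k {a})) P := by
    intro L'
    induction L' with
    | nil =>
      intro _
      exact ⟨1, by rw [Submodule.one_eq_span]; exact Submodule.fg_span_singleton _, le_rfl,
        mul_one _, by simp, fun a _ => Commute.one_right _⟩
    | cons b L' ih =>
      intro hL
      obtain ⟨P, hP1, hP2, hP3, hP4, hP5⟩ := ih fun a ha => hL a (List.mem_cons_of_mem _ ha)
      have hb := hL b List.mem_cons_self
      have hA1 : (1 : Submodule k B) ≤ Subalgebra.toSubmodule (Algebra.adjoin k {b}) := by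
        rw [Submodule.one_le]; exact one_mem (Algebra.adjoin k {b})
      refine ⟨Subalgebra.toSubmodule (Algebra.adjoin k {b}) * P,
        (hint b hb).fg_adjoin_singleton.mul hP1, ?_, ?_, ?_, ?_⟩
      · calc (1 : Submodule k B) = 1 * 1 := (mul_one _).symm
          _ ≤ _ := mul_le_mul' hA1 hP2
      · rw [mul_assoc, ← mul_assoc P, ← (hP5 b hb).eq, mul_assoc, hP3, ← mul_assoc,
          (Subalgebra.isIdempotentElem_toSubmodule _).eq]
      · intro a ha
        rcases List.mem_cons.1 ha with rfl | ha
        · have := Submodule.mul_mem_mul ((Subalgebra.mem_toSubmodule _).2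
            (Algebra.self_mem_adjoin_singleton k a)) (Submodule.one_le.1 hP2)
          rwa [mul_one] at this
        · have := Submodule.mul_mem_mul (Submodule.one_le.1 hA1) (hP4 a ha)
          rwa [one_mul] at this
      · intro a ha
        obtain ⟨c, hc, h⟩ := hcomm a ha b hb
        exact (adjoin_singleton_commute hc h).mul_right (hP5 a ha)
  obtain ⟨P, hP1, hP2, hP3, hP4, -⟩ := key L fun _ h => h
  have htop : P = ⊤ := by
    let S : Subalgebra k B := P.toSubalgebra (Submodule.one_le.1 hP2)
      (fun a b ha hb => hP3 ▸ Submodule.mul_mem_mul ha hb)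
    have h1 : (⊤ : Subalgebra k B) ≤ S := by
      rw [← hgen]; exact Algebra.adjoin_le fun a ha => hP4 a ha
    exact eq_top_iff.2 fun a _ => h1 (Algebra.mem_top : a ∈ (⊤ : Subalgebra k B))
  exact ⟨htop ▸ hP1⟩

theorem theta_ne_zero {n : ℕ} {q : k} (hq : q ≠ 0) (i j : Fin n) : Taft.theta q i j ≠ 0 := by
  unfold Taft.theta; split_ifs <;> simp [hq]

instance instModuleFinite {n ℓ : ℕ} [NeZero ℓ] {q : k} [hq : Fact (IsPrimitiveRoot q ℓ)] :
    Module.Finite k (TaftAlgebra k n ℓ q) := by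
  classical
  have hq0 := q_ne_zero hq.out
  have hint : ∀ a : TaftAlgebra k n ℓ q, (a ^ ℓ = 1 ∨ a ^ ℓ = 0) → IsIntegral k a := by
    rintro a (h | h)
    · exact IsIntegral.of_pow (NeZero.pos ℓ) (h ▸ isIntegral_one)
    · exact IsIntegral.of_pow (NeZero.pos ℓ) (h ▸ isIntegral_zero)
  refine finite_of_skew_commute
    ((List.finRange n).map (K : Fin n → TaftAlgebra k n ℓ q) ++
      (List.finRange n).map (x : Fin n → TaftAlgebra k n ℓ q)) ?_ ?_ ?_
  · intro a ha
    simp only [List.mem_append, List.mem_map, List.mem_finRange, true_and] at ha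
    rcases ha with ⟨i, rfl⟩ | ⟨i, rfl⟩
    · exact hint _ (Or.inl (K_pow i))
    · exact hint _ (Or.inr (x_pow i))
  · have hKx : ∀ i j : Fin n, ∃ c : k, c ≠ 0 ∧
        (K i * x j : TaftAlgebra k n ℓ q) = c • (x j * K i) := fun i j =>
      ⟨_, mul_ne_zero (theta_ne_zero hq0 i j) (by split_ifs <;> simp [hq0]), K_mul_x i j⟩
    intro a ha b hb
    simp only [List.mem_append, List.mem_map, List.mem_finRange, true_and] at ha hb
    rcases ha with ⟨i, rfl⟩ | ⟨i, rfl⟩ <;> rcases hb with ⟨j, rfl⟩ | ⟨j, rfl⟩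
    · exact ⟨1, one_ne_zero, by rw [K_comm, one_smul]⟩
    · exact hKx i j
    · obtain ⟨c, hc, h⟩ := hKx j i
      exact ⟨c⁻¹, inv_ne_zero hc, by rw [h, smul_smul, inv_mul_cancel₀ hc, one_smul]⟩
    · exact ⟨_, theta_ne_zero hq0 i j, x_mul_x i j⟩
  · rw [eq_top_iff, ← adjoin_gen]
    refine Algebra.adjoin_le ?_
    rintro _ ⟨g, rfl⟩
    cases g with
    | K i => exact Algebra.subset_adjoin (by simp [K])
    | x i => exact Algebra.subset_adjoin (by simp [x])
    | Kinv i =>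
      have h : (gen (.Kinv i) : TaftAlgebra k n ℓ q) = K i ^ (ℓ - 1) := by
        change Kinv i = _
        have h1 : (Kinv i * K i ^ ℓ : TaftAlgebra k n ℓ q) = Kinv i := by rw [K_pow, mul_one]
        have h2 : ∀ m : ℕ, m ≠ 0 → (Kinv i * K i ^ m : TaftAlgebra k n ℓ q) = K i ^ (m - 1) := by
          intro m hm
          obtain ⟨m, rfl⟩ := Nat.exists_eq_succ_of_ne_zero hm
          rw [pow_succ', ← mul_assoc, Kinv_mul_K, one_mul, Nat.succ_sub_one]
        rw [← h1, h2 ℓ (NeZero.ne ℓ)]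
      rw [h]
      exact pow_mem (Algebra.subset_adjoin (by simp)) _

end Finite

end TaftAlgebra

section Twisted

variable {k A B : Type*} [Field k] [Ring A] [Algebra k A] [Ring B] [Algebra k B]

/-- The multiplication `(p ⊗ h)(q ⊗ l) = (p ⊗ 1) T(h ⊗ q) (1 ⊗ l)` on `A ⊗ B` defined by a twist
`T : B ⊗ A → A ⊗ B`. -/
noncomputable def twistedMul (T : B →ₗ[k] A →ₗ[k] A ⊗[k] B) :
    A ⊗[k] B →ₗ[k] A ⊗[k] B →ₗ[k] A ⊗[k] B :=
  TensorProduct.lift (LinearMap.mk₂ k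
    (fun p h => TensorProduct.lift (LinearMap.mk₂ k
      (fun q l => (p ⊗ₜ[k] (1 : B)) * T h q * ((1 : A) ⊗ₜ[k] l))
      (by intros; simp [mul_add, add_mul]) (by intros; simp)
      (by intros; simp [mul_add, TensorProduct.tmul_add]) (by intros; simp)))
    (by intros; ext; simp [TensorProduct.add_tmul, add_mul])
    (by intros; ext; simp [← TensorProduct.smul_tmul'])
    (by intros; ext; simp [mul_add, add_mul])
    (by intros; ext; simp))

theorem twistedMul_tmul (T : B →ₗ[k] A →ₗ[k] A ⊗[k] B) (p q : A) (h l : B) :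
    twistedMul T (p ⊗ₜ h) (q ⊗ₜ l) = (p ⊗ₜ[k] (1 : B)) * T h q * ((1 : A) ⊗ₜ[k] l) := by
  simp [twistedMul]

theorem twistedMul_left (T : B →ₗ[k] A →ₗ[k] A ⊗[k] B) (p : A) (X Y : A ⊗[k] B) :
    twistedMul T ((p ⊗ₜ[k] (1 : B)) * X) Y = (p ⊗ₜ[k] (1 : B)) * twistedMul T X Y := by
  induction X using TensorProduct.induction_on with
  | zero => simp
  | add X X' h h' => simp [mul_add, h, h']
  | tmul a b =>
    induction Y using TensorProduct.induction_on with
    | zero => simp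
    | add Y Y' h h' => rw [map_add, map_add, mul_add, h, h']
    | tmul c d =>
      rw [Algebra.TensorProduct.tmul_mul_tmul, one_mul, twistedMul_tmul, twistedMul_tmul,
        ← mul_assoc, ← mul_assoc, Algebra.TensorProduct.tmul_mul_tmul, one_mul]

theorem twistedMul_right (T : B →ₗ[k] A →ₗ[k] A ⊗[k] B) (l : B) (X Y : A ⊗[k] B) :
    twistedMul T X (Y * ((1 : A) ⊗ₜ[k] l)) = twistedMul T X Y * ((1 : A) ⊗ₜ[k] l) := by
  induction X using TensorProduct.induction_on with
  | zero => simp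
  | add X X' h h' => simp [add_mul, h, h']
  | tmul a b =>
    induction Y using TensorProduct.induction_on with
    | zero => simp
    | add Y Y' h h' => rw [add_mul, map_add, map_add, add_mul, h, h']
    | tmul c d =>
      rw [Algebra.TensorProduct.tmul_mul_tmul, mul_one, twistedMul_tmul, twistedMul_tmul,
        mul_assoc, mul_assoc, Algebra.TensorProduct.tmul_mul_tmul, mul_one, mul_assoc]

theorem twistedMul_assoc (T : B →ₗ[k] A →ₗ[k] A ⊗[k] B)
    (h1 : ∀ h l q, T (h * l) q = twistedMul T ((1 : A) ⊗ₜ h) (T l q))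
    (h2 : ∀ h q v, T h (q * v) = twistedMul T (T h q) (v ⊗ₜ (1 : B)))
    (X Y Z : A ⊗[k] B) :
    twistedMul T (twistedMul T X Y) Z = twistedMul T X (twistedMul T Y Z) := by
  have key : ∀ (W : A ⊗[k] B) (u : A) (h : B),
      twistedMul T W (T h u) = twistedMul T (W * ((1 : A) ⊗ₜ h)) (u ⊗ₜ (1 : B)) := by
    intro W u h
    induction W using TensorProduct.induction_on with
    | zero => simp
    | add W W' h h' => simp [add_mul, h, h']
    | tmul a b =>
      have e : (a ⊗ₜ b : A ⊗[k] B) = (a ⊗ₜ[k] (1 : B)) * ((1 : A) ⊗ₜ[k] b) := by simp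
      rw [e, twistedMul_left, ← h1, mul_assoc, twistedMul_left, Algebra.TensorProduct.tmul_mul_tmul,
        twistedMul_tmul, ← Algebra.TensorProduct.one_def, mul_one, mul_one,
        ← Algebra.TensorProduct.one_def, one_mul]
  induction X using TensorProduct.induction_on with
  | zero => simp
  | add X X' h h' => simp [h, h']
  | tmul p h =>
    induction Y using TensorProduct.induction_on with
    | zero => simp
    | add Y Y' h h' => simp [h, h']
    | tmul q l =>
      induction Z using TensorProduct.induction_on with
      | zero => simp
      | add Z Z' h h' => simp [h, h']
      | tmul u m =>
        have ep : (p ⊗ₜ h : A ⊗[k] B) = (p ⊗ₜ[k] (1 : B)) * ((1 : A) ⊗ₜ[k] h) := by simp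
        have eu : (u ⊗ₜ m : A ⊗[k] B) = (u ⊗ₜ[k] (1 : B)) * ((1 : A) ⊗ₜ[k] m) := by simp
        have eq' : (q ⊗ₜ l : A ⊗[k] B) = (q ⊗ₜ[k] (1 : B)) * ((1 : A) ⊗ₜ[k] l) := by simp
        rw [ep, eu, twistedMul_left, twistedMul_left, twistedMul_left, twistedMul_right,
          twistedMul_right, twistedMul_right]
        congr 2
        have e1 : twistedMul T ((1 : A) ⊗ₜ h) (q ⊗ₜ l) = T h q * ((1 : A) ⊗ₜ[k] l) := by
          rw [twistedMul_tmul, ← Algebra.TensorProduct.one_def, one_mul]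
        have e2 : twistedMul T (q ⊗ₜ l) (u ⊗ₜ (1 : B)) = (q ⊗ₜ[k] (1 : B)) * T l u := by
          rw [twistedMul_tmul, ← Algebra.TensorProduct.one_def, mul_one]
        rw [e1, e2, ← key _ u l]
        generalize T l u = V
        induction V using TensorProduct.induction_on with
        | zero => simp
        | add V V' h h' => simp [mul_add, h, h']
        | tmul c d =>
          rw [Algebra.TensorProduct.tmul_mul_tmul, one_mul, twistedMul_tmul,
            ← Algebra.TensorProduct.one_def, one_mul, h2, ← twistedMul_right,
            Algebra.TensorProduct.tmul_mul_tmul, one_mul, mul_one]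

theorem one_twistedMul (T : B →ₗ[k] A →ₗ[k] A ⊗[k] B) (h : ∀ q, T 1 q = q ⊗ₜ 1)
    (X : A ⊗[k] B) : twistedMul T 1 X = X := by
  induction X using TensorProduct.induction_on with
  | zero => simp
  | add X X' h h' => simp [h, h']
  | tmul p l => rw [Algebra.TensorProduct.one_def, twistedMul_tmul, h]; simp

theorem twistedMul_one (T : B →ₗ[k] A →ₗ[k] A ⊗[k] B) (h : ∀ l, T l 1 = 1 ⊗ₜ l)
    (X : A ⊗[k] B) : twistedMul T X 1 = X := by
  induction X using TensorProduct.induction_on with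
  | zero => simp
  | add X X' h h' => simp [h, h']
  | tmul p l => rw [Algebra.TensorProduct.one_def, twistedMul_tmul, h]; simp

theorem map_twistedMul {E : Type*} [Ring E] [Algebra k E] (T : B →ₗ[k] A →ₗ[k] A ⊗[k] B)
    (α : A →ₗ[k] E) (β : B →ₐ[k] E) (Φ : A ⊗[k] B →ₗ[k] E) (hα : ∀ a a', α (a * a') = α a * α a')
    (hΦ : ∀ a b, Φ (a ⊗ₜ b) = α a * β b) (hT : ∀ h q, Φ (T h q) = β h * α q) (X Y : A ⊗[k] B) :
    Φ (twistedMul T X Y) = Φ X * Φ Y := by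
  have key : ∀ (p : A) (l : B) (Z : A ⊗[k] B),
      Φ ((p ⊗ₜ[k] (1 : B)) * Z * ((1 : A) ⊗ₜ[k] l)) = α p * Φ Z * β l := by
    intro p l Z
    induction Z using TensorProduct.induction_on with
    | zero => simp
    | add X X' h h' => simp only [mul_add, add_mul, map_add, h, h']
    | tmul a b =>
      rw [Algebra.TensorProduct.tmul_mul_tmul, Algebra.TensorProduct.tmul_mul_tmul, hΦ, hΦ,
        mul_one, one_mul, hα, map_mul]
      simp only [mul_assoc]
  induction X using TensorProduct.induction_on with
  | zero => simp
  | add X X' h h' => simp only [map_add, LinearMap.add_apply, h, h', add_mul]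
  | tmul p h =>
    induction Y using TensorProduct.induction_on with
    | zero => simp
    | add X X' h h' => simp only [map_add, h, h', mul_add]
    | tmul q l =>
      rw [twistedMul_tmul, key, hT, hΦ, hΦ]
      simp only [mul_assoc]

end Twisted

section Antipode

open Coalgebra TensorProduct

variable {k H : Type*} [Field k] [Ring H] [HopfAlgebra k H]

theorem convMul_eq_one_antipode :
    (WithConv.toConv (TensorProduct.map (HopfAlgebra.antipode k) (HopfAlgebra.antipode k) ∘ₗ
        (TensorProduct.comm k H H).toLinearMap ∘ₗ comul) : WithConv (H →ₗ[k] H ⊗[k] H)) *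
      WithConv.toConv comul = 1 := by
  -- `W (a ⊗ ((b ⊗ c) ⊗ d)) = S(b) c ⊗ S(a) d`
  let S := HopfAlgebra.antipode k (A := H)
  let m1 : H ⊗[k] H →ₗ[k] H := LinearMap.mul' k H ∘ₗ S.rTensor H
  let W : H ⊗[k] ((H ⊗[k] H) ⊗[k] H) →ₗ[k] H ⊗[k] H :=
    TensorProduct.map m1 m1 ∘ₗ (TensorProduct.leftComm k H (H ⊗[k] H) H).toLinearMap
  have hc : (LinearMap.lTensor H (comul (R := k).rTensor H)) ∘ₗ (comul (R := k)).lTensor H ∘ₗ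
      comul (R := k) (A := H) = (LinearMap.lTensor H (TensorProduct.assoc k H H H).symm.toLinearMap) ∘ₗ
      (TensorProduct.assoc k H H (H ⊗[k] H)).toLinearMap ∘ₗ TensorProduct.map comul comul ∘ₗ comul := by
    simp only [coassoc_simps]
  apply WithConv.ext
  rw [LinearMap.convMul_def]
  have e1 : LinearMap.mul' k (H ⊗[k] H) ∘ₗ TensorProduct.map (TensorProduct.map S S ∘ₗ
      (TensorProduct.comm k H H).toLinearMap ∘ₗ comul) comul = W ∘ₗ
      (LinearMap.lTensor H (TensorProduct.assoc k H H H).symm.toLinearMap) ∘ₗ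
      (TensorProduct.assoc k H H (H ⊗[k] H)).toLinearMap ∘ₗ TensorProduct.map comul comul := by
    have : LinearMap.mul' k (H ⊗[k] H) ∘ₗ TensorProduct.map (TensorProduct.map S S ∘ₗ
      (TensorProduct.comm k H H).toLinearMap) LinearMap.id = W ∘ₗ
      (LinearMap.lTensor H (TensorProduct.assoc k H H H).symm.toLinearMap) ∘ₗ
      (TensorProduct.assoc k H H (H ⊗[k] H)).toLinearMap := by
      ext a b c d
      simp [W, m1]
    have h2 := congrArg (fun f => f ∘ₗ TensorProduct.map (comul (R := k) (A := H)) (comul (R := k) (A := H))) this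
    simp only [LinearMap.comp_assoc, ← map_comp, LinearMap.id_comp] at h2
    exact h2
  have e2 : W ∘ₗ (LinearMap.lTensor H (comul (R := k).rTensor H)) =
      TensorProduct.map (Algebra.linearMap k H ∘ₗ counit) m1 ∘ₗ (TensorProduct.leftComm k H H H).toLinearMap := by
    ext a b d
    simp only [W, m1, AlgebraTensorModule.curry_apply, LinearMap.restrictScalars_self, curry_apply,
      LinearMap.comp_apply, LinearMap.lTensor_tmul, LinearMap.rTensor_tmul, LinearEquiv.coe_coe,
      leftComm_tmul, TensorProduct.map_tmul]
    rw [HopfAlgebra.mul_antipode_rTensor_comul_apply]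
    simp
  have e4 : TensorProduct.map (Algebra.linearMap k H ∘ₗ counit) m1 ∘ₗ
      (TensorProduct.leftComm k H H H).toLinearMap ∘ₗ (comul (R := k)).lTensor H =
      (TensorProduct.mk k H H 1) ∘ₗ m1 := by
    ext a b
    simp only [AlgebraTensorModule.curry_apply, LinearMap.restrictScalars_self, curry_apply,
      LinearMap.comp_apply, LinearMap.lTensor_tmul, LinearEquiv.coe_coe, mk_apply]
    have hb : (TensorProduct.lid k H) (TensorProduct.map counit LinearMap.id (comul b)) = b := by
      have := Coalgebra.rTensor_counit_comul (R := k) b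
      rw [LinearMap.rTensor] at this
      rw [this]; simp
    have : ∀ t : H ⊗[k] H, TensorProduct.map (Algebra.linearMap k H ∘ₗ counit) m1
        (TensorProduct.leftComm k H H H (a ⊗ₜ t)) =
        1 ⊗ₜ m1 (a ⊗ₜ (TensorProduct.lid k H) (TensorProduct.map counit LinearMap.id t)) := by
      intro t
      induction t using TensorProduct.induction_on with
      | zero => simp
      | tmul c d => simp [m1, Algebra.algebraMap_eq_smul_one, TensorProduct.smul_tmul']
      | add t t' h h' => simp only [map_add, tmul_add, h, h']
    rw [this, hb]
  change LinearMap.mul' k (H ⊗[k] H) ∘ₗ TensorProduct.map (TensorProduct.map S S ∘ₗ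
      (TensorProduct.comm k H H).toLinearMap ∘ₗ comul) comul ∘ₗ comul = _
  rw [← LinearMap.comp_assoc, e1]
  simp only [LinearMap.comp_assoc]
  rw [← hc, ← LinearMap.comp_assoc _ _ W, e2, LinearMap.comp_assoc, ← LinearMap.comp_assoc _ _
    (TensorProduct.leftComm k H H H).toLinearMap, ← LinearMap.comp_assoc, e4]
  ext a
  have := HopfAlgebra.mul_antipode_rTensor_comul_apply (R := k) a
  simp only [LinearMap.comp_apply, m1, S, this]
  simp [Algebra.TensorProduct.one_def, Algebra.algebraMap_eq_smul_one]

theorem comul_antipode : comul ∘ₗ HopfAlgebra.antipode k (A := H) =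
    TensorProduct.map (HopfAlgebra.antipode k) (HopfAlgebra.antipode k) ∘ₗ
      (TensorProduct.comm k H H).toLinearMap ∘ₗ comul := by
  have := left_inv_eq_right_inv (convMul_eq_one_antipode (k := k) (H := H))
    (LinearMap.comul_right_inv (R := k) (C := H))
  exact (WithConv.toConv_injective this).symm

end Antipode

/-- Hopf algebras whose antipode is bijective (for instance, all finite-dimensional ones). -/
class BijectiveAntipode (k H : Type*) [Field k] [Ring H] [HopfAlgebra k H] : Prop where
  bijective : Function.Bijective (HopfAlgebra.antipode k (A := H))

section AntipodeInv

open Coalgebra TensorProduct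

variable (k H : Type*) [Field k] [Ring H] [HopfAlgebra k H] [hS : BijectiveAntipode k H]

/-- The inverse of the antipode. -/
noncomputable def antipodeInv : H →ₗ[k] H :=
  (LinearEquiv.ofBijective (HopfAlgebra.antipode k (A := H)) hS.bijective).symm.toLinearMap

variable {k H}

@[simp] theorem antipode_antipodeInv (a : H) :
    HopfAlgebra.antipode k (antipodeInv k H a) = a :=
  (LinearEquiv.ofBijective (HopfAlgebra.antipode k (A := H)) hS.bijective).apply_symm_apply a

theorem antipodeInv_eq_iff (a b : H) : antipodeInv k H a = b ↔ a = HopfAlgebra.antipode k b :=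
  (LinearEquiv.ofBijective (HopfAlgebra.antipode k (A := H)) hS.bijective).symm_apply_eq

@[simp] theorem antipodeInv_mul (a b : H) :
    antipodeInv k H (a * b) = antipodeInv k H b * antipodeInv k H a := by
  rw [antipodeInv_eq_iff, HopfAlgebra.antipode_mul_antidistrib, antipode_antipodeInv,
    antipode_antipodeInv]

@[simp] theorem antipodeInv_one : antipodeInv k H 1 = 1 := by
  rw [antipodeInv_eq_iff, HopfAlgebra.antipode_one]

@[simp] theorem counit_antipodeInv (a : H) : counit (R := k) (antipodeInv k H a) = counit a := by
  rw [← HopfAlgebra.counit_antipode (R := k) (antipodeInv k H a), antipode_antipodeInv]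

theorem comul_antipodeInv : comul ∘ₗ antipodeInv k H =
    TensorProduct.map (antipodeInv k H) (antipodeInv k H) ∘ₗ (TensorProduct.comm k H H).toLinearMap ∘ₗ comul := by
  have e : antipodeInv k H ∘ₗ HopfAlgebra.antipode k = LinearMap.id := by
    ext a; simp [antipodeInv_eq_iff]
  have e' : HopfAlgebra.antipode k ∘ₗ antipodeInv k H = LinearMap.id := by
    ext a; simp
  have h := congrArg (fun f => TensorProduct.map (antipodeInv k H) (antipodeInv k H) ∘ₗ
    (TensorProduct.comm k H H).toLinearMap ∘ₗ f ∘ₗ antipodeInv k H) (comul_antipode (k := k) (H := H))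
  simp only [coassoc_simps, e, e'] at h
  exact h.symm

/-- `Σ S⁻¹(a₂) a₁ = ε(a)`. -/
theorem antipodeInv_left (a : H) :
    LinearMap.mul' k H (TensorProduct.map (antipodeInv k H) LinearMap.id (TensorProduct.comm k H H (comul a))) =
      algebraMap k H (counit a) := by
  have h : ∀ t : H ⊗[k] H, HopfAlgebra.antipode k (LinearMap.mul' k H
      (TensorProduct.map (antipodeInv k H) LinearMap.id (TensorProduct.comm k H H t))) =
      LinearMap.mul' k H (TensorProduct.map (HopfAlgebra.antipode k) LinearMap.id t) := by
    intro t
    induction t using TensorProduct.induction_on with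
    | zero => simp
    | tmul a b => simp [HopfAlgebra.antipode_mul_antidistrib]
    | add t t' h h' => simp only [map_add, h, h']
  have h2 := HopfAlgebra.mul_antipode_rTensor_comul_apply (R := k) a
  rw [LinearMap.rTensor, ← h] at h2
  apply hS.bijective.1
  rw [h2, Algebra.algebraMap_eq_smul_one, map_smul, HopfAlgebra.antipode_one]

/-- `Σ a₂ S⁻¹(a₁) = ε(a)`. -/
theorem antipodeInv_right (a : H) :
    LinearMap.mul' k H (TensorProduct.map LinearMap.id (antipodeInv k H) (TensorProduct.comm k H H (comul a))) =
      algebraMap k H (counit a) := by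
  have h : ∀ t : H ⊗[k] H, HopfAlgebra.antipode k (LinearMap.mul' k H
      (TensorProduct.map LinearMap.id (antipodeInv k H) (TensorProduct.comm k H H t))) =
      LinearMap.mul' k H (TensorProduct.map LinearMap.id (HopfAlgebra.antipode k) t) := by
    intro t
    induction t using TensorProduct.induction_on with
    | zero => simp
    | tmul a b => simp [HopfAlgebra.antipode_mul_antidistrib]
    | add t t' h h' => simp only [map_add, h, h']
  have h2 := HopfAlgebra.mul_antipode_lTensor_comul_apply (R := k) a
  rw [LinearMap.lTensor, ← h] at h2
  apply hS.bijective.1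
  rw [h2, Algebra.algebraMap_eq_smul_one, map_smul, HopfAlgebra.antipode_one]

end AntipodeInv

/-- The dual `H^*` of a Hopf algebra, an algebra under the convolution product. -/
def ConvDual (k H : Type*) [Field k] [Ring H] [HopfAlgebra k H] : Type _ :=
  WithConv (H →ₗ[k] k)

namespace ConvDual

variable {k H : Type*} [Field k] [Ring H] [HopfAlgebra k H]

noncomputable instance : Ring (ConvDual k H) := inferInstanceAs (Ring (WithConv (H →ₗ[k] k)))

noncomputable instance : Algebra k (ConvDual k H) :=
  inferInstanceAs (Algebra k (WithConv (H →ₗ[k] k)))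

variable (k H) in
/-- The underlying linear form of an element of `H^*`. -/
noncomputable def toLin : ConvDual k H ≃ₗ[k] (H →ₗ[k] k) where
  toFun p := p.ofConv
  invFun p := .toConv p
  map_add' _ _ := rfl
  map_smul' _ _ := rfl
  left_inv _ := rfl
  right_inv _ := rfl

noncomputable instance : CoeFun (ConvDual k H) fun _ => H → k := ⟨fun p => toLin k H p⟩

@[ext] theorem ext {p q : ConvDual k H} (h : ∀ x : H, p x = q x) : p = q :=
  (toLin k H).injective (LinearMap.ext h)

@[simp] theorem symm_apply (f : H →ₗ[k] k) (x : H) : (toLin k H).symm f x = f x := rfl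

@[simp] theorem one_apply (x : H) : (1 : ConvDual k H) x = Coalgebra.counit (R := k) x := rfl

theorem toLin_mul (p q : ConvDual k H) : toLin k H (p * q) =
    LinearMap.mul' k k ∘ₗ TensorProduct.map (toLin k H p) (toLin k H q) ∘ₗ Coalgebra.comul := rfl

theorem mul_apply (p q : ConvDual k H) (x : H) : (p * q : ConvDual k H) x =
    LinearMap.mul' k k (TensorProduct.map (toLin k H p) (toLin k H q) (Coalgebra.comul x)) := rfl

end ConvDual

namespace DrinfeldDouble

open Coalgebra

section Comul

variable (k H : Type*) [Field k] [Ring H] [HopfAlgebra k H]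

/-- The iterated coproduct `h ↦ Σ h₁ ⊗ (h₂ ⊗ h₃)`. -/
noncomputable def comul₃ : H →ₐ[k] H ⊗[k] (H ⊗[k] H) :=
  (Algebra.TensorProduct.map (AlgHom.id k H) (Bialgebra.comulAlgHom k H)).comp
    (Bialgebra.comulAlgHom k H)

theorem toLinearMap_comul₃ :
    (comul₃ k H).toLinearMap = LinearMap.lTensor H comul ∘ₗ comul := rfl

theorem counit_comul₃ (h : H) : TensorProduct.lid k H (LinearMap.rTensor H counit
    (LinearMap.lTensor H ((TensorProduct.rid k H).toLinearMap ∘ₗ LinearMap.lTensor H counit)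
      (comul₃ k H h))) = h := by
  have e2 : (TensorProduct.rid k H).toLinearMap ∘ₗ LinearMap.lTensor H counit ∘ₗ comul =
      LinearMap.id := by
    ext a; simp
  change (TensorProduct.lid k H (LinearMap.rTensor H counit
        (LinearMap.lTensor H ((TensorProduct.rid k H).toLinearMap ∘ₗ
          LinearMap.lTensor H counit) (LinearMap.lTensor H comul (comul h))))) = h
  rw [← LinearMap.comp_apply (LinearMap.lTensor H _), ← LinearMap.lTensor_comp,
    LinearMap.comp_assoc, e2]
  simp

/-- `a₁ ⊗ ((a₂ ⊗ (b ⊗ c₁)) ⊗ c₂) ↦ (a₁ ⊗ a₂) ⊗ (b ⊗ (c₁ ⊗ c₂))`. -/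
noncomputable def regroup : H ⊗[k] ((H ⊗[k] (H ⊗[k] H)) ⊗[k] H) →ₗ[k]
    (H ⊗[k] H) ⊗[k] (H ⊗[k] (H ⊗[k] H)) :=
  (TensorProduct.assoc k H H (H ⊗[k] (H ⊗[k] H))).symm.toLinearMap ∘ₗ
  LinearMap.lTensor H (LinearMap.lTensor H (TensorProduct.assoc k H H H).toLinearMap ∘ₗ
    (TensorProduct.assoc k H (H ⊗[k] H) H).toLinearMap)

theorem regroup_comul (h : H) :
    regroup k H (LinearMap.lTensor H (LinearMap.rTensor H (comul₃ k H).toLinearMap)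
      (comul₃ k H h)) =
    TensorProduct.map comul (LinearMap.lTensor H comul) (comul₃ k H h) := by
  have hco : regroup k H ∘ₗ LinearMap.lTensor H (LinearMap.rTensor H (comul₃ k H).toLinearMap) ∘ₗ
        (comul₃ k H).toLinearMap = TensorProduct.map comul (LinearMap.lTensor H comul) ∘ₗ
        (comul₃ k H).toLinearMap := by
    simp only [regroup, toLinearMap_comul₃, coassoc_simps]
  exact LinearMap.congr_fun hco h

end Comul

section Twist

variable (k H : Type*) [Field k] [Ring H] [HopfAlgebra k H] [BijectiveAntipode k H]

/-- `q ↦ a ⇀ q ↼ s⁻¹(c)`, that is `x ↦ q(s⁻¹(c) x a)`. -/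
noncomputable def coadjAux (a c : H) : ConvDual k H →ₗ[k] ConvDual k H where
  toFun q := (ConvDual.toLin k H).symm (ConvDual.toLin k H q ∘ₗ
    LinearMap.mulLeft k (antipodeInv k H c) ∘ₗ LinearMap.mulRight k a)
  map_add' _ _ := by ext; simp
  map_smul' _ _ := by ext; simp

variable {k H} in
theorem coadjAux_apply (a c x : H) (q : ConvDual k H) :
    coadjAux k H a c q x = q (antipodeInv k H c * (x * a)) := rfl

/-- `(a, c, q) ↦ a ⇀ q ↼ s⁻¹(c)`, that is `x ↦ q(s⁻¹(c) x a)`. -/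
noncomputable def coadj : H →ₗ[k] H →ₗ[k] ConvDual k H →ₗ[k] ConvDual k H :=
  LinearMap.mk₂ k (coadjAux k H)
    (by intros; ext; simp [mul_add, coadjAux_apply]) (by intros; ext; simp [coadjAux_apply])
    (by intros; ext; simp [add_mul, coadjAux_apply]) (by intros; ext; simp [coadjAux_apply])

@[simp] theorem coadj_apply (a c x : H) (q : ConvDual k H) :
    coadj k H a c q x = q (antipodeInv k H c * (x * a)) := rfl

/-- `(a ⊗ (b ⊗ c), q) ↦ (a ⇀ q ↼ s⁻¹(c)) ⊗ b`. -/
noncomputable def twist₃ :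
    H ⊗[k] (H ⊗[k] H) →ₗ[k] ConvDual k H →ₗ[k] ConvDual k H ⊗[k] H :=
  TensorProduct.lift
    { toFun := fun a => TensorProduct.lift (LinearMap.mk₂ k
        (fun b c => (TensorProduct.mk k (ConvDual k H) H).flip b ∘ₗ coadj k H a c)
        (by intros; ext; simp) (by intros; ext; simp) (by intros; ext; simp)
        (by intros; ext; simp [TensorProduct.smul_tmul']))
      map_add' := by intros; ext; simp
      map_smul' := by intros; ext; simp [TensorProduct.smul_tmul'] }

@[simp] theorem twist₃_tmul (a b c : H) (q : ConvDual k H) :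
    twist₃ k H (a ⊗ₜ (b ⊗ₜ c)) q = coadj k H a c q ⊗ₜ b := by
  simp [twist₃]

/-- The twist `h ⊗ q ↦ Σ (h₁ ⇀ q ↼ s⁻¹(h₃)) ⊗ h₂`. -/
noncomputable def twist : H →ₗ[k] ConvDual k H →ₗ[k] ConvDual k H ⊗[k] H :=
  twist₃ k H ∘ₗ (comul₃ k H).toLinearMap

theorem twist_apply (h : H) (q : ConvDual k H) :
    twist k H h q = twist₃ k H (comul₃ k H h) q := rfl

theorem twist_one (q : ConvDual k H) : twist k H 1 q = q ⊗ₜ 1 := by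
  rw [twist_apply, map_one, Algebra.TensorProduct.one_def, Algebra.TensorProduct.one_def,
    twist₃_tmul]
  congr 1
  ext x
  simp

theorem twist_counit (h : H) : twist k H h 1 = 1 ⊗ₜ h := by
  have e : ∀ t : H ⊗[k] (H ⊗[k] H), twist₃ k H t 1 = (1 : ConvDual k H) ⊗ₜ
      (TensorProduct.lid k H (LinearMap.rTensor H counit
        (LinearMap.lTensor H ((TensorProduct.rid k H).toLinearMap ∘ₗ
          LinearMap.lTensor H counit) t))) := by
    intro t
    induction t using TensorProduct.induction_on with
    | zero => simp
    | add t t' h h' => simp only [map_add, LinearMap.add_apply, h, h', TensorProduct.tmul_add]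
    | tmul a t =>
      induction t using TensorProduct.induction_on with
      | zero => simp
      | add t t' h h' =>
        simp only [TensorProduct.tmul_add, map_add, LinearMap.add_apply, h, h']
      | tmul b c =>
        have : coadj k H a c 1 = (counit (R := k) a * counit (R := k) c) • (1 : ConvDual k H) := by
          ext x
          simp; ring
        simp [this, TensorProduct.smul_tmul, smul_smul, mul_comm]
  rw [twist_apply, e, counit_comul₃]

theorem twist_mul (h l : H) (q : ConvDual k H) :
    twist k H (h * l) q = twistedMul (twist k H) (1 ⊗ₜ h) (twist k H l q) := by
  rw [twist_apply, map_mul, twist_apply k H l]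
  generalize comul₃ k H l = t
  induction t using TensorProduct.induction_on with
  | zero => simp
  | add t t' h h' => simp only [mul_add, map_add, LinearMap.add_apply, h, h']
  | tmul a' t =>
    induction t using TensorProduct.induction_on with
    | zero => simp
    | add t t' h h' =>
      simp only [TensorProduct.tmul_add, mul_add, map_add, LinearMap.add_apply, h, h']
    | tmul b' c' =>
      rw [twist₃_tmul, twistedMul_tmul, ← Algebra.TensorProduct.one_def, one_mul, twist_apply]
      generalize comul₃ k H h = s
      induction s using TensorProduct.induction_on with
      | zero => simp
      | add t t' h h' => simp only [add_mul, map_add, LinearMap.add_apply, h, h']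
      | tmul a s =>
        induction s using TensorProduct.induction_on with
        | zero => simp
        | add t t' h h' =>
          simp only [TensorProduct.tmul_add, add_mul, map_add, LinearMap.add_apply, h, h']
        | tmul b c =>
          simp only [Algebra.TensorProduct.tmul_mul_tmul, twist₃_tmul, mul_one]
          congr 1
          ext x
          simp [mul_assoc]

theorem coadj_mul (q v : ConvDual k H) (a c : H) :
    coadj k H a c (q * v) = LinearMap.mul' k (ConvDual k H) (TensorProduct.map
      (TensorProduct.lift ((coadj k H).compr₂ (LinearMap.applyₗ q)))
      (TensorProduct.lift ((coadj k H).compr₂ (LinearMap.applyₗ v)))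
      (TensorProduct.tensorTensorTensorComm k H H H H
        (comul a ⊗ₜ TensorProduct.comm k H H (comul c)))) := by
  ext x
  have hc : comul (R := k) (antipodeInv k H c) = TensorProduct.map (antipodeInv k H)
      (antipodeInv k H) (TensorProduct.comm k H H (comul c)) :=
    LinearMap.congr_fun (comul_antipodeInv (k := k) (H := H)) c
  rw [coadj_apply, ConvDual.mul_apply, Bialgebra.comul_mul, Bialgebra.comul_mul, hc]
  generalize (TensorProduct.comm k H H (comul c)) = t
  generalize comul (R := k) a = s
  induction t using TensorProduct.induction_on with
  | zero => simp
  | add t t' h h' => simp only [add_mul, map_add, h, h', TensorProduct.tmul_add, LinearMap.add_apply]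
  | tmul c1 c2 =>
    induction s using TensorProduct.induction_on with
    | zero => simp
    | add t t' h h' => simp only [mul_add, map_add, h, h', TensorProduct.add_tmul, LinearMap.add_apply]
    | tmul a1 a2 =>
      simp only [TensorProduct.tensorTensorTensorComm_tmul, TensorProduct.map_tmul,
        LinearMap.mul'_apply, TensorProduct.lift.tmul, LinearMap.compr₂_apply,
        LinearMap.applyₗ_apply_apply, ConvDual.mul_apply]
      generalize comul (R := k) x = u
      induction u using TensorProduct.induction_on with
      | zero => simp
      | add t t' h h' => simp only [add_mul, mul_add, map_add, h, h']
      | tmul x1 x2 =>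
        simp [coadj, coadjAux_apply]

theorem twist_mul_right (h : H) (q v : ConvDual k H) :
    twist k H h (q * v) = twistedMul (twist k H) (twist k H h q) (v ⊗ₜ 1) := by
  let Q := TensorProduct.lift ((coadj k H).compr₂ (LinearMap.applyₗ q))
  let V := TensorProduct.lift ((coadj k H).compr₂ (LinearMap.applyₗ v))
  -- `Ω ((a₁ ⊗ a₂) ⊗ (b ⊗ (c₁ ⊗ c₂))) = (a₁ ⇀ q ↼ s⁻¹(c₂)) (a₂ ⇀ v ↼ s⁻¹(c₁)) ⊗ b`
  let Ω : (H ⊗[k] H) ⊗[k] (H ⊗[k] (H ⊗[k] H)) →ₗ[k] ConvDual k H ⊗[k] H :=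
    (LinearMap.rTensor H (LinearMap.mul' k (ConvDual k H) ∘ₗ TensorProduct.map Q V ∘ₗ
      (TensorProduct.tensorTensorTensorComm k H H H H).toLinearMap ∘ₗ
      LinearMap.lTensor (H ⊗[k] H) (TensorProduct.comm k H H).toLinearMap)) ∘ₗ
    (TensorProduct.assoc k (H ⊗[k] H) (H ⊗[k] H) H).symm.toLinearMap ∘ₗ
    LinearMap.lTensor (H ⊗[k] H) (TensorProduct.comm k H (H ⊗[k] H)).toLinearMap
  have e1 : ∀ s, twist₃ k H s (q * v) =
      Ω (TensorProduct.map comul (LinearMap.lTensor H comul) s) := by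
    intro s
    induction s using TensorProduct.induction_on with
    | zero => simp
    | add t t' h h' => simp only [map_add, LinearMap.add_apply, h, h']
    | tmul a s =>
      induction s using TensorProduct.induction_on with
      | zero => simp
      | add t t' h h' => simp only [TensorProduct.tmul_add, map_add, LinearMap.add_apply, h, h']
      | tmul b c =>
        rw [twist₃_tmul, coadj_mul, TensorProduct.map_tmul, LinearMap.lTensor_tmul]
        generalize comul (R := k) a = t
        generalize comul (R := k) c = u
        induction t using TensorProduct.induction_on with
        | zero => simp
        | add t t' h h' => simp only [TensorProduct.add_tmul, map_add, h, h']
        | tmul a1 a2 =>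
          induction u using TensorProduct.induction_on with
          | zero => simp
          | add t t' h h' =>
            simp only [TensorProduct.tmul_add, TensorProduct.add_tmul, map_add, h, h']
          | tmul c1 c2 => simp [Ω, Q, V]
  have e2 : ∀ s, twistedMul (twist k H) (twist₃ k H s q) (v ⊗ₜ 1) =
      Ω (regroup k H
        (LinearMap.lTensor H (LinearMap.rTensor H (comul₃ k H).toLinearMap) s)) := by
    intro s
    induction s using TensorProduct.induction_on with
    | zero => simp
    | add t t' h h' => simp only [map_add, LinearMap.add_apply, h, h']
    | tmul a s =>
      induction s using TensorProduct.induction_on with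
      | zero => simp
      | add t t' h h' => simp only [TensorProduct.tmul_add, map_add, LinearMap.add_apply, h, h']
      | tmul b c =>
        rw [twist₃_tmul, twistedMul_tmul, ← Algebra.TensorProduct.one_def, mul_one, twist_apply,
          LinearMap.lTensor_tmul, LinearMap.rTensor_tmul, AlgHom.toLinearMap_apply]
        generalize comul₃ k H b = t
        induction t using TensorProduct.induction_on with
        | zero => simp
        | add t t' h h' =>
          simp only [TensorProduct.tmul_add, TensorProduct.add_tmul, map_add, LinearMap.add_apply,
            mul_add, h, h']
        | tmul a1 t =>
          induction t using TensorProduct.induction_on with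
          | zero => simp
          | add t t' h h' =>
            simp only [TensorProduct.tmul_add, TensorProduct.add_tmul, map_add,
              LinearMap.add_apply, mul_add, h, h']
          | tmul b1 c1 => simp [Ω, Q, V, regroup]
  rw [twist_apply, e1, twist_apply, e2, regroup_comul]

end Twist

end DrinfeldDouble

/-- The Drinfel'd double `D(H)` of `H`, with underlying space `H^* ⊗ H`. -/
def DrinfeldDouble (k H : Type*) [Field k] [Ring H] [HopfAlgebra k H] : Type _ :=
  ConvDual k H ⊗[k] H

namespace DrinfeldDouble

open Coalgebra

section Ring

variable {k H : Type*} [Field k] [Ring H] [HopfAlgebra k H]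

noncomputable instance : AddCommGroup (DrinfeldDouble k H) :=
  inferInstanceAs (AddCommGroup (ConvDual k H ⊗[k] H))

noncomputable instance : Module k (DrinfeldDouble k H) :=
  inferInstanceAs (Module k (ConvDual k H ⊗[k] H))

/-- The identification of the underlying space of `D(H)` with `H^* ⊗ H`. -/
noncomputable def toTensor : DrinfeldDouble k H ≃ₗ[k] ConvDual k H ⊗[k] H :=
  LinearEquiv.refl k (ConvDual k H ⊗[k] H)

/-- The element `p ⊗ h` of `D(H)`. -/
noncomputable def pure : ConvDual k H →ₗ[k] H →ₗ[k] DrinfeldDouble k H :=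
  (TensorProduct.mk k (ConvDual k H) H).compr₂ (toTensor (k := k) (H := H)).symm.toLinearMap

/-- The unit of `D(H)` is `ε ⊗ 1`. -/
noncomputable instance : One (DrinfeldDouble k H) := ⟨pure 1 1⟩

variable [BijectiveAntipode k H]

/-- The multiplication of `D(H)`:
`(p ⊗ h)(q ⊗ l) = Σ p (h₁ ⇀ q ↼ s⁻¹(h₃)) ⊗ h₂ l`. -/
noncomputable instance : Mul (DrinfeldDouble k H) := ⟨fun X Y => twistedMul (twist k H) X Y⟩

noncomputable instance : Ring (DrinfeldDouble k H) :=
  { (inferInstance : AddCommGroup (DrinfeldDouble k H)) with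
    one := 1
    mul := (· * ·)
    zero_mul := fun X => LinearMap.map_zero₂ (twistedMul (twist k H)) X
    mul_zero := fun X => LinearMap.map_zero (twistedMul (twist k H) X)
    left_distrib := fun X Y Z => LinearMap.map_add (twistedMul (twist k H) X) Y Z
    right_distrib := fun X Y Z => LinearMap.map_add₂ (twistedMul (twist k H)) X Y Z
    one_mul := one_twistedMul (twist k H) (twist_one k H)
    mul_one := twistedMul_one (twist k H) (twist_counit k H)
    mul_assoc := twistedMul_assoc (twist k H) (twist_mul k H) (twist_mul_right k H) }

noncomputable instance : Algebra k (DrinfeldDouble k H) :=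
  Algebra.ofModule (fun r X Y => LinearMap.map_smul₂ (twistedMul (twist k H)) r X Y)
    (fun r X Y => LinearMap.map_smul (twistedMul (twist k H) X) r Y)

theorem toTensor_mul (X Y : DrinfeldDouble k H) :
    toTensor (X * Y) = twistedMul (twist k H) (toTensor X) (toTensor Y) := rfl

end Ring

end DrinfeldDouble

namespace DrinfeldDouble

open Coalgebra

section YetterDrinfeld

variable {k H V : Type*} [Field k] [Ring H] [HopfAlgebra k H] [BijectiveAntipode k H]
  [AddCommGroup V] [Module k V]

/-- `(a ⊗ (b ⊗ c), v ⊗ w) ↦ b · v ⊗ c w a`. -/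
noncomputable def sandwich (ρ : H →ₐ[k] Module.End k V) :
    H ⊗[k] (H ⊗[k] H) →ₗ[k] V ⊗[k] H →ₗ[k] V ⊗[k] H :=
  TensorProduct.lift
    { toFun := fun a => TensorProduct.lift (LinearMap.mk₂ k
        (fun b c => TensorProduct.map (ρ b) (LinearMap.mulLeft k c ∘ₗ LinearMap.mulRight k a))
        (by intros; ext; simp [TensorProduct.add_tmul])
        (by intros; ext; simp [TensorProduct.smul_tmul'])
        (by intros; ext; simp [add_mul, TensorProduct.tmul_add]) (by intros; ext; simp))
      map_add' := by intros; ext; simp [mul_add, TensorProduct.tmul_add]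
      map_smul' := by intros; ext; simp }

@[simp] theorem sandwich_tmul (ρ : H →ₐ[k] Module.End k V) (a b c w : H) (v : V) :
    sandwich ρ (a ⊗ₜ (b ⊗ₜ c)) (v ⊗ₜ w) = ρ b v ⊗ₜ (c * (w * a)) := by
  simp [sandwich]

/-- `(a ⊗ (b ⊗ c), v ⊗ w) ↦ b · v ⊗ c w s⁻¹(a)`. -/
noncomputable def ydMap (ρ : H →ₐ[k] Module.End k V) :
    H ⊗[k] (H ⊗[k] H) →ₗ[k] V ⊗[k] H →ₗ[k] V ⊗[k] H :=
  sandwich ρ ∘ₗ LinearMap.rTensor (H ⊗[k] H) (antipodeInv k H)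

@[simp] theorem ydMap_tmul (ρ : H →ₐ[k] Module.End k V) (a b c w : H) (v : V) :
    ydMap ρ (a ⊗ₜ (b ⊗ₜ c)) (v ⊗ₜ w) = ρ b v ⊗ₜ (c * (w * antipodeInv k H a)) := by
  simp [ydMap]

/-- A left action `ρ` and a right coaction `δ` of `H` on `V` form a Yetter–Drinfel'd module:
`δ(h · v) = Σ h₂ · v₀ ⊗ h₃ v₁ s⁻¹(h₁)`. -/
structure IsYetterDrinfeld (ρ : H →ₐ[k] Module.End k V) (δ : V →ₗ[k] V ⊗[k] H) : Prop where
  coassoc : (TensorProduct.assoc k V H H).toLinearMap ∘ₗ LinearMap.rTensor H δ ∘ₗ δ =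
    LinearMap.lTensor V comul ∘ₗ δ
  counit : (TensorProduct.rid k V).toLinearMap ∘ₗ LinearMap.lTensor V counit ∘ₗ δ = LinearMap.id
  compat : ∀ (h : H) (v : V), δ (ρ h v) = ydMap ρ (comul₃ k H h) (δ v)

/-- The action `p · v = Σ p(v₁) v₀` of the dual of `H` on a right `H`-comodule. -/
noncomputable def dualAct (δ : V →ₗ[k] V ⊗[k] H) : ConvDual k H →ₗ[k] Module.End k V where
  toFun p := (TensorProduct.rid k V).toLinearMap ∘ₗ LinearMap.lTensor V (ConvDual.toLin k H p) ∘ₗ δ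
  map_add' p q := by ext v; simp [LinearMap.lTensor_add]
  map_smul' r p := by ext v; simp [LinearMap.lTensor_smul]

theorem dualAct_apply (δ : V →ₗ[k] V ⊗[k] H) (p : ConvDual k H) (v : V) :
    dualAct δ p v = TensorProduct.rid k V (LinearMap.lTensor V (ConvDual.toLin k H p) (δ v)) := rfl

/-- The linear map `(p ⊗ h, v) ↦ p · (h · v)`. -/
noncomputable def actLin (ρ : H →ₐ[k] Module.End k V) (δ : V →ₗ[k] V ⊗[k] H) :
    ConvDual k H ⊗[k] H →ₗ[k] Module.End k V :=
  TensorProduct.lift ((LinearMap.mul k (Module.End k V)).compl₁₂ (dualAct δ) ρ.toLinearMap)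

theorem actLin_tmul (ρ : H →ₐ[k] Module.End k V) (δ : V →ₗ[k] V ⊗[k] H) (p : ConvDual k H)
    (h : H) : actLin ρ δ (p ⊗ₜ h) = dualAct δ p * ρ h := by
  simp [actLin]

theorem IsYetterDrinfeld.dualAct_mul {ρ : H →ₐ[k] Module.End k V} {δ : V →ₗ[k] V ⊗[k] H}
    (hyd : IsYetterDrinfeld ρ δ) (p q : ConvDual k H) :
    dualAct δ (p * q) = dualAct δ p * dualAct δ q := by
  ext v
  have h1 := LinearMap.congr_fun hyd.coassoc v
  have e1 : ∀ t : V ⊗[k] H, TensorProduct.rid k V (LinearMap.lTensor V (ConvDual.toLin k H (p * q)) t) =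
      TensorProduct.rid k V (LinearMap.lTensor V (LinearMap.mul' k k ∘ₗ
        TensorProduct.map (ConvDual.toLin k H p) (ConvDual.toLin k H q)) (LinearMap.lTensor V comul t)) := by
    intro t
    induction t using TensorProduct.induction_on with
    | zero => simp
    | add t t' h h' => simp only [map_add, h, h']
    | tmul v w => simp [ConvDual.mul_apply]
  have e2 : ∀ t : V ⊗[k] H, dualAct δ p (TensorProduct.rid k V (LinearMap.lTensor V (ConvDual.toLin k H q) t)) =
      TensorProduct.rid k V (LinearMap.lTensor V (LinearMap.mul' k k ∘ₗ
        TensorProduct.map (ConvDual.toLin k H p) (ConvDual.toLin k H q))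
          (TensorProduct.assoc k V H H (LinearMap.rTensor H δ t))) := by
    intro t
    induction t using TensorProduct.induction_on with
    | zero => simp
    | add t t' h h' => simp only [map_add, h, h']
    | tmul v w =>
      simp only [LinearMap.lTensor_tmul, LinearMap.rTensor_tmul, TensorProduct.rid_tmul, map_smul,
        dualAct_apply]
      generalize δ v = u
      induction u using TensorProduct.induction_on with
      | zero => simp
      | add t t' h h' => simp only [map_add, h, h', TensorProduct.add_tmul, smul_add]
      | tmul a b => simp [smul_smul, mul_comm]
  rw [Module.End.mul_apply, dualAct_apply, dualAct_apply δ q, e1, e2]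
  exact congrArg (fun t => TensorProduct.rid k V (LinearMap.lTensor V (LinearMap.mul' k k ∘ₗ
        TensorProduct.map (ConvDual.toLin k H p) (ConvDual.toLin k H q)) t)) h1.symm

theorem IsYetterDrinfeld.dualAct_one {ρ : H →ₐ[k] Module.End k V} {δ : V →ₗ[k] V ⊗[k] H}
    (hyd : IsYetterDrinfeld ρ δ) : dualAct δ (1 : ConvDual k H) = 1 :=
  hyd.counit

theorem IsYetterDrinfeld.actLin_twist {ρ : H →ₐ[k] Module.End k V} {δ : V →ₗ[k] V ⊗[k] H}
    (hyd : IsYetterDrinfeld ρ δ) (h : H) (q : ConvDual k H) :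
    actLin ρ δ (twist k H h q) = ρ h * dualAct δ q := by
  ext v
  rw [Module.End.mul_apply, dualAct_apply δ q v]
  let m : H ⊗[k] H →ₗ[k] H := LinearMap.mul' k H ∘ₗ
    TensorProduct.map (antipodeInv k H) LinearMap.id ∘ₗ (TensorProduct.comm k H H).toLinearMap
  have hm : ∀ a : H, m (comul a) = algebraMap k H (Coalgebra.counit a) := antipodeInv_left
  -- `Θ (v ⊗ w) ((a₁ ⊗ a₂) ⊗ (b ⊗ (c₁ ⊗ c₂))) = q(s⁻¹(c₂) c₁ w s⁻¹(a₂) a₁) b · v`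
  let Θ : V ⊗[k] H →ₗ[k] (H ⊗[k] H) ⊗[k] (H ⊗[k] (H ⊗[k] H)) →ₗ[k] V :=
    ((sandwich ρ ∘ₗ TensorProduct.map m (LinearMap.lTensor H m)).flip).compr₂
      ((TensorProduct.rid k V).toLinearMap ∘ₗ LinearMap.lTensor V (ConvDual.toLin k H q))
  have hΘ : ∀ (v : V) (w b : H) (t u : H ⊗[k] H), Θ (v ⊗ₜ w) (t ⊗ₜ (b ⊗ₜ u)) =
      q (m u * (w * m t)) • ρ b v := by
    intros; simp [Θ]
  have e1 : ∀ s, actLin ρ δ (twist₃ k H s q) v = Θ (δ v) (regroup k H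
      (LinearMap.lTensor H (LinearMap.rTensor H (comul₃ k H).toLinearMap) s)) := by
    intro s
    induction s using TensorProduct.induction_on with
    | zero => simp
    | add t t' h h' => simp only [map_add, LinearMap.add_apply, h, h']
    | tmul a s =>
      induction s using TensorProduct.induction_on with
      | zero => simp
      | add t t' h h' => simp only [TensorProduct.tmul_add, map_add, LinearMap.add_apply, h, h']
      | tmul b c =>
        rw [twist₃_tmul, actLin_tmul, Module.End.mul_apply, dualAct_apply, hyd.compat,
          LinearMap.lTensor_tmul, LinearMap.rTensor_tmul, AlgHom.toLinearMap_apply]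
        generalize comul₃ k H b = t
        generalize δ v = u
        induction u using TensorProduct.induction_on with
        | zero => simp
        | add t t' h h' => simp only [map_add, LinearMap.add_apply, h, h']
        | tmul v w =>
          induction t using TensorProduct.induction_on with
          | zero => simp
          | add t t' h h' =>
            simp only [TensorProduct.tmul_add, TensorProduct.add_tmul, map_add,
              LinearMap.add_apply, h, h']
          | tmul a1 t =>
            induction t using TensorProduct.induction_on with
            | zero => simp
            | add t t' h h' =>
              simp only [TensorProduct.tmul_add, TensorProduct.add_tmul, map_add,
                LinearMap.add_apply, h, h']
            | tmul b1 c1 =>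
              have : regroup k H (a ⊗ₜ[k] ((a1 ⊗ₜ[k] (b1 ⊗ₜ[k] c1)) ⊗ₜ[k] c)) =
                (a ⊗ₜ a1) ⊗ₜ (b1 ⊗ₜ (c1 ⊗ₜ c)) := by simp [regroup]
              rw [this, hΘ]
              simp [m, mul_assoc]
  have e2 : ∀ (s : H ⊗[k] (H ⊗[k] H)) (u : V ⊗[k] H),
      Θ u (TensorProduct.map comul (LinearMap.lTensor H comul) s) =
      ρ (TensorProduct.lid k H (LinearMap.rTensor H Coalgebra.counit
        (LinearMap.lTensor H ((TensorProduct.rid k H).toLinearMap ∘ₗ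
          LinearMap.lTensor H Coalgebra.counit) s))) (TensorProduct.rid k V
          (LinearMap.lTensor V (ConvDual.toLin k H q) u)) := by
    intro s u
    induction u using TensorProduct.induction_on with
    | zero => simp
    | add t t' h h' => simp only [map_add, LinearMap.add_apply, h, h']
    | tmul v w =>
      induction s using TensorProduct.induction_on with
      | zero => simp
      | add t t' h h' => simp only [map_add, LinearMap.add_apply, h, h']
      | tmul a s =>
        induction s using TensorProduct.induction_on with
        | zero => simp
        | add t t' h h' => simp only [TensorProduct.tmul_add, map_add, LinearMap.add_apply, h, h']
        | tmul b c =>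
          rw [TensorProduct.map_tmul, LinearMap.lTensor_tmul, hΘ, hm, hm]
          simp [Algebra.algebraMap_eq_smul_one, smul_smul]
          congr 1
          ring
  rw [twist_apply, e1, regroup_comul, e2, counit_comul₃]

/-- A Yetter–Drinfel'd module as a module over `D(H)`, with `(p ⊗ h) · v = p · (h · v)`. -/
noncomputable def act (ρ : H →ₐ[k] Module.End k V) (δ : V →ₗ[k] V ⊗[k] H)
    (hyd : IsYetterDrinfeld ρ δ) : DrinfeldDouble k H →ₐ[k] Module.End k V :=
  AlgHom.ofLinearMap (actLin ρ δ ∘ₗ (toTensor (k := k) (H := H)).toLinearMap)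
    (by
      change actLin ρ δ (1 ⊗ₜ 1) = 1
      rw [actLin_tmul, hyd.dualAct_one, map_one, one_mul])
    (fun X Y => map_twistedMul (twist k H) (dualAct δ) ρ (actLin ρ δ) hyd.dualAct_mul
      (actLin_tmul ρ δ) hyd.actLin_twist X Y)

theorem act_pure (ρ : H →ₐ[k] Module.End k V) (δ : V →ₗ[k] V ⊗[k] H)
    (hyd : IsYetterDrinfeld ρ δ) (p : ConvDual k H) (h : H) :
    act ρ δ hyd (pure p h) = dualAct δ p * ρ h :=
  actLin_tmul ρ δ p h

end YetterDrinfeld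

end DrinfeldDouble

namespace DrinfeldDouble

open Coalgebra

section Radford

variable {k H : Type*} [Field k] [Ring H] [HopfAlgebra k H] [BijectiveAntipode k H]

/-- `(a ⊗ (b ⊗ c), v) ↦ χ(b) c v s⁻¹(a)`. -/
noncomputable def radfordAux (χ : H →ₐ[k] k) : H ⊗[k] (H ⊗[k] H) →ₗ[k] Module.End k H :=
  TensorProduct.lift
    { toFun := fun a => TensorProduct.lift (LinearMap.mk₂ k
        (fun b c => χ b • (LinearMap.mulLeft k c ∘ₗ LinearMap.mulRight k (antipodeInv k H a)))
        (by intros; ext; simp [add_smul]) (by intros; ext; simp [mul_smul])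
        (by intros; ext; simp [add_mul]) (by intros; ext; simp [smul_smul, mul_comm]))
      map_add' := by intros; ext; simp [mul_add]
      map_smul' := by intros; ext; simp [smul_smul, mul_comm] }

@[simp] theorem radfordAux_tmul (χ : H →ₐ[k] k) (a b c v : H) :
    radfordAux χ (a ⊗ₜ (b ⊗ₜ c)) v = χ b • (c * (v * antipodeInv k H a)) := by
  simp [radfordAux]

theorem radfordAux_mul (χ : H →ₐ[k] k) (s t : H ⊗[k] (H ⊗[k] H)) :
    radfordAux χ (s * t) = radfordAux χ s * radfordAux χ t := by
  induction s using TensorProduct.induction_on with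
  | zero => simp
  | add s s' h h' => simp only [add_mul, map_add, h, h']
  | tmul a s =>
    induction s using TensorProduct.induction_on with
    | zero => simp
    | add s s' h h' => simp only [TensorProduct.tmul_add, add_mul, map_add, h, h']
    | tmul b c =>
      induction t using TensorProduct.induction_on with
      | zero => simp
      | add s s' h h' => simp only [mul_add, map_add, h, h']
      | tmul a' t =>
        induction t using TensorProduct.induction_on with
        | zero => simp
        | add s s' h h' => simp only [TensorProduct.tmul_add, mul_add, map_add, h, h']
        | tmul b' c' =>
          ext v
          simp [mul_assoc, smul_smul, mul_comm]

/-- The action `h • v = Σ (h₂ ↼ χ) v s⁻¹(h₁) = Σ χ(h₂) h₃ v s⁻¹(h₁)` of `H` on itself, where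
`h ↼ χ = Σ χ(h₁) h₂`. -/
noncomputable def radfordAct (χ : H →ₐ[k] k) : H →ₐ[k] Module.End k H :=
  AlgHom.ofLinearMap (radfordAux χ ∘ₗ (comul₃ k H).toLinearMap)
    (by
      ext v
      rw [LinearMap.comp_apply, AlgHom.toLinearMap_apply, map_one, Algebra.TensorProduct.one_def,
        Algebra.TensorProduct.one_def]
      simp)
    (fun h l => by simp [radfordAux_mul])

theorem radfordAct_apply (χ : H →ₐ[k] k) (h : H) :
    radfordAct χ h = radfordAux χ (comul₃ k H h) := rfl

/-- The action `•_χ` and the coaction `Δ` make `H` a Yetter–Drinfel'd module. -/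
theorem isYetterDrinfeld_radfordAct (χ : H →ₐ[k] k) :
    IsYetterDrinfeld (radfordAct χ) (comul : H →ₗ[k] H ⊗[k] H) where
  coassoc := Coalgebra.coassoc
  counit := by ext a; simp
  compat h v := by
    let P : H ⊗[k] H →ₗ[k] H ⊗[k] H := TensorProduct.map (antipodeInv k H) (antipodeInv k H) ∘ₗ
      (TensorProduct.comm k H H).toLinearMap
    -- `Ξ u (S ⊗ (b ⊗ U)) = χ(b) U u P(S)`
    let Ξ : H ⊗[k] H → (H ⊗[k] H) ⊗[k] (H ⊗[k] (H ⊗[k] H)) →ₗ[k] H ⊗[k] H := fun u =>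
      LinearMap.mul' k (H ⊗[k] H) ∘ₗ (TensorProduct.comm k (H ⊗[k] H) (H ⊗[k] H)).toLinearMap ∘ₗ
      TensorProduct.map (LinearMap.mulLeft k u ∘ₗ P)
        ((TensorProduct.lid k (H ⊗[k] H)).toLinearMap ∘ₗ
          LinearMap.rTensor (H ⊗[k] H) χ.toLinearMap)
    have hΞ : ∀ (u S U : H ⊗[k] H) (b : H), Ξ u (S ⊗ₜ (b ⊗ₜ U)) = χ b • (U * (u * P S)) := by
      intros; simp [Ξ]
    have hc : ∀ a : H, comul (R := k) (antipodeInv k H a) = P (comul a) :=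
      LinearMap.congr_fun (comul_antipodeInv (k := k) (H := H))
    have e1 : ∀ s, comul (radfordAux χ s v) =
        Ξ (comul v) (TensorProduct.map comul (LinearMap.lTensor H comul) s) := by
      intro s
      induction s using TensorProduct.induction_on with
      | zero => simp
      | add t t' h h' => simp only [map_add, LinearMap.add_apply, h, h']
      | tmul a s =>
        induction s using TensorProduct.induction_on with
        | zero => simp
        | add t t' h h' => simp only [TensorProduct.tmul_add, map_add, LinearMap.add_apply, h, h']
        | tmul b c =>
          rw [radfordAux_tmul, TensorProduct.map_tmul, LinearMap.lTensor_tmul, hΞ, map_smul,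
            Bialgebra.comul_mul, Bialgebra.comul_mul, hc]
    have e2 : ∀ s u, ydMap (radfordAct χ) s u = Ξ u (regroup k H
        (LinearMap.lTensor H (LinearMap.rTensor H (comul₃ k H).toLinearMap) s)) := by
      intro s u
      induction s using TensorProduct.induction_on with
      | zero => simp
      | add t t' h h' => simp only [map_add, LinearMap.add_apply, h, h']
      | tmul a s =>
        induction s using TensorProduct.induction_on with
        | zero => simp
        | add t t' h h' => simp only [TensorProduct.tmul_add, map_add, LinearMap.add_apply, h, h']
        | tmul b c =>
          have e3 : ∀ t : H ⊗[k] (H ⊗[k] H), TensorProduct.map (radfordAux χ t)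
              (LinearMap.mulLeft k c ∘ₗ LinearMap.mulRight k (antipodeInv k H a)) u =
              Ξ u (regroup k H (a ⊗ₜ (t ⊗ₜ c))) := by
            intro t
            induction t using TensorProduct.induction_on with
            | zero => simp
            | add t t' h h' =>
              simp only [map_add, TensorProduct.map_add_left, LinearMap.add_apply,
                TensorProduct.add_tmul, TensorProduct.tmul_add, h, h']
            | tmul a1 t =>
              induction t using TensorProduct.induction_on with
              | zero => simp
              | add t t' h h' =>
                simp only [map_add, TensorProduct.map_add_left, LinearMap.add_apply,
                  TensorProduct.add_tmul, TensorProduct.tmul_add, h, h']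
              | tmul b1 c1 =>
                have : regroup k H (a ⊗ₜ[k] ((a1 ⊗ₜ[k] (b1 ⊗ₜ[k] c1)) ⊗ₜ[k] c)) =
                  (a ⊗ₜ a1) ⊗ₜ (b1 ⊗ₜ (c1 ⊗ₜ c)) := by simp [regroup]
                rw [this, hΞ]
                induction u using TensorProduct.induction_on with
                | zero => simp
                | add t t' h h' => simp only [map_add, add_mul, mul_add, smul_add, h, h']
                | tmul v w => simp [P, TensorProduct.smul_tmul']
          rw [LinearMap.lTensor_tmul, LinearMap.rTensor_tmul, AlgHom.toLinearMap_apply, ← e3]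
          simp [ydMap, sandwich, radfordAct_apply]
    rw [radfordAct_apply, e1, e2, regroup_comul]

/-- The subspace `H •_χ g`. -/
noncomputable def radfordSubmodule (χ : H →ₐ[k] k) (g : H) : Submodule k H :=
  LinearMap.range (LinearMap.applyₗ g ∘ₗ (radfordAct χ).toLinearMap)

theorem radfordAct_mem (χ : H →ₐ[k] k) (g h : H) : radfordAct χ h g ∈ radfordSubmodule χ g :=
  ⟨h, rfl⟩

theorem act_radford_mem (χ : H →ₐ[k] k) {g : H} (hg : IsGroupLikeElem k g)
    (X : DrinfeldDouble k H) {v : H} (hv : v ∈ radfordSubmodule χ g) :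
    act (radfordAct χ) comul (isYetterDrinfeld_radfordAct χ) X v ∈ radfordSubmodule χ g := by
  obtain ⟨l, rfl⟩ := hv
  change actLin (radfordAct χ) comul (toTensor X) (radfordAct χ l g) ∈ _
  generalize toTensor X = Y
  induction Y using TensorProduct.induction_on with
  | zero => simp
  | add Y Y' h h' =>
    rw [map_add, LinearMap.add_apply]
    exact add_mem h h'
  | tmul p h =>
    rw [actLin_tmul, Module.End.mul_apply, ← Module.End.mul_apply (radfordAct χ h), ← map_mul,
      dualAct_apply, (isYetterDrinfeld_radfordAct χ).compat, hg.comul_eq_tmul_self]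
    generalize comul₃ k H (h * l) = s
    induction s using TensorProduct.induction_on with
    | zero => simp
    | add t t' h h' =>
      rw [map_add, LinearMap.add_apply, map_add, map_add]
      exact add_mem h h'
    | tmul a s =>
      induction s using TensorProduct.induction_on with
      | zero => simp
      | add t t' h h' =>
        rw [TensorProduct.tmul_add, map_add, LinearMap.add_apply, map_add, map_add]
        exact add_mem h h'
      | tmul b c =>
        rw [ydMap_tmul, LinearMap.lTensor_tmul, TensorProduct.rid_tmul]
        exact Submodule.smul_mem _ _ (radfordAct_mem χ g b)

end Radford

end DrinfeldDouble

namespace DrinfeldDouble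

open Coalgebra

section Inclusions

variable {k H : Type*} [Field k] [Ring H] [HopfAlgebra k H] [BijectiveAntipode k H]

theorem pure_mul_pure_one (p q : ConvDual k H) (h : H) :
    (pure p 1 * pure q h : DrinfeldDouble k H) = pure (p * q) h := by
  apply toTensor.injective
  rw [toTensor_mul]
  change twistedMul (twist k H) (p ⊗ₜ 1) (q ⊗ₜ h) = (p * q) ⊗ₜ h
  rw [twistedMul_tmul, twist_one, Algebra.TensorProduct.tmul_mul_tmul,
    Algebra.TensorProduct.tmul_mul_tmul, mul_one, mul_one, one_mul]

theorem pure_mul_one_pure (p : ConvDual k H) (h l : H) :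
    (pure p h * pure 1 l : DrinfeldDouble k H) = pure p (h * l) := by
  apply toTensor.injective
  rw [toTensor_mul]
  change twistedMul (twist k H) (p ⊗ₜ h) (1 ⊗ₜ l) = p ⊗ₜ (h * l)
  rw [twistedMul_tmul, twist_counit, Algebra.TensorProduct.tmul_mul_tmul,
    Algebra.TensorProduct.tmul_mul_tmul, mul_one, mul_one, one_mul]

theorem one_pure_mul_pure (h : H) (q : ConvDual k H) :
    toTensor (pure 1 h * pure q 1 : DrinfeldDouble k H) = twist k H h q := by
  rw [toTensor_mul]
  change twistedMul (twist k H) (1 ⊗ₜ h) (q ⊗ₜ 1) = _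
  rw [twistedMul_tmul, ← Algebra.TensorProduct.one_def, one_mul, mul_one]

variable (k H)

/-- The algebra embedding `h ↦ ε ⊗ h` of `H` into `D(H)`. -/
noncomputable def ofHopf : H →ₐ[k] DrinfeldDouble k H :=
  AlgHom.ofLinearMap (pure 1) rfl fun h l => (pure_mul_one_pure 1 h l).symm

/-- The algebra embedding `p ↦ p ⊗ 1` of the dual of `H` into `D(H)`. -/
noncomputable def ofDual : ConvDual k H →ₐ[k] DrinfeldDouble k H :=
  AlgHom.ofLinearMap ((pure (k := k) (H := H)).flip 1) rfl fun p q =>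
    (pure_mul_pure_one p q 1).symm

variable {k H}

theorem ofDual_mul_ofHopf (p : ConvDual k H) (h : H) :
    ofDual k H p * ofHopf k H h = pure p h := by
  change (pure p 1 * pure 1 h : DrinfeldDouble k H) = _
  rw [pure_mul_pure_one, mul_one]

theorem toTensor_ofHopf_mul_ofDual (h : H) (q : ConvDual k H) :
    toTensor (ofHopf k H h * ofDual k H q) = twist k H h q :=
  one_pure_mul_pure h q

end Inclusions

section Comul

variable {k H : Type*} [Field k] [Ring H] [HopfAlgebra k H]

/-- The pairing `(p ⊗ q)(x ⊗ y) = p(x) q(y)`. -/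
noncomputable def pairing :
    ConvDual k H ⊗[k] ConvDual k H →ₗ[k] (H ⊗[k] H →ₗ[k] k) :=
  TensorProduct.dualDistrib k H H ∘ₗ TensorProduct.map (ConvDual.toLin k H).toLinearMap
    (ConvDual.toLin k H).toLinearMap

@[simp] theorem pairing_tmul (p q : ConvDual k H) (x y : H) :
    pairing (p ⊗ₜ[k] q) (x ⊗ₜ y) = p x * q y := rfl

variable [Module.Finite k H]

variable (k H) in
/-- The comultiplication of the dual of `H`, adjoint to the multiplication of `H`. -/
noncomputable def dualComul : ConvDual k H →ₗ[k] ConvDual k H ⊗[k] ConvDual k H :=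
  TensorProduct.map (ConvDual.toLin k H).symm.toLinearMap
      (ConvDual.toLin k H).symm.toLinearMap ∘ₗ
    (TensorProduct.dualDistribEquiv k H H).symm.toLinearMap ∘ₗ
    (LinearMap.mul' k H).dualMap ∘ₗ (ConvDual.toLin k H).toLinearMap

theorem pairing_injective : Function.Injective (pairing (k := k) (H := H)) := by
  have h : pairing (k := k) (H := H) = ((TensorProduct.congr (ConvDual.toLin k H)
      (ConvDual.toLin k H)).trans
        (TensorProduct.dualDistribEquiv k H H)).toLinearMap := by
    ext p q x y
    rfl
  rw [h]
  exact LinearEquiv.injective _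

theorem pairing_ext {s t : ConvDual k H ⊗[k] ConvDual k H}
    (h : ∀ x y : H, pairing s (x ⊗ₜ y) = pairing t (x ⊗ₜ y)) : s = t :=
  pairing_injective (TensorProduct.ext' h)

@[simp] theorem pairing_dualComul (p : ConvDual k H) (x y : H) :
    pairing (dualComul k H p) (x ⊗ₜ y) = p (x * y) := by
  have e : ∀ z, pairing (k := k) (H := H) (TensorProduct.map
      (ConvDual.toLin k H).symm.toLinearMap
      (ConvDual.toLin k H).symm.toLinearMap z) = TensorProduct.dualDistrib k H H z := by
    intro z
    induction z using TensorProduct.induction_on with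
    | zero => simp
    | add t t' h h' => simp only [map_add, h, h']
    | tmul a b => rfl
  change pairing (TensorProduct.map _ _ ((TensorProduct.dualDistribEquiv k H H).symm _)) _ = _
  rw [e]
  have := (TensorProduct.dualDistribEquiv k H H).apply_symm_apply
    ((LinearMap.mul' k H).dualMap (ConvDual.toLin k H p))
  exact LinearMap.congr_fun this (x ⊗ₜ y)

theorem pairing_mul (s t : ConvDual k H ⊗[k] ConvDual k H) (x y : H) :
    pairing (s * t) (x ⊗ₜ y) = LinearMap.mul' k k (TensorProduct.map (pairing s) (pairing t)
      (TensorProduct.tensorTensorTensorComm k H H H H (comul x ⊗ₜ comul y))) := by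
  induction s using TensorProduct.induction_on with
  | zero => simp
  | add t t' h h' => simp only [add_mul, map_add, LinearMap.add_apply, h, h',
      TensorProduct.map_add_left]
  | tmul p r =>
    induction t using TensorProduct.induction_on with
    | zero => simp
    | add t t' h h' => simp only [mul_add, map_add, LinearMap.add_apply, h, h',
        TensorProduct.map_add_right]
    | tmul p' r' =>
      rw [Algebra.TensorProduct.tmul_mul_tmul, pairing_tmul, ConvDual.mul_apply,
        ConvDual.mul_apply]
      generalize comul (R := k) x = u
      generalize comul (R := k) y = v
      induction u using TensorProduct.induction_on with
      | zero => simp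
      | add t t' h h' => simp only [map_add, h, h', TensorProduct.add_tmul, add_mul]
      | tmul x1 x2 =>
        induction v using TensorProduct.induction_on with
        | zero => simp
        | add t t' h h' => simp only [map_add, h, h', TensorProduct.tmul_add, mul_add]
        | tmul y1 y2 => simp; ring

theorem dualComul_mul (p q : ConvDual k H) :
    dualComul k H (p * q) = dualComul k H p * dualComul k H q := by
  apply pairing_ext
  intro x y
  rw [pairing_dualComul, pairing_mul, ConvDual.mul_apply, Bialgebra.comul_mul]
  generalize comul (R := k) x = u
  generalize comul (R := k) y = v
  induction u using TensorProduct.induction_on with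
  | zero => simp
  | add t t' h h' => simp only [map_add, h, h', TensorProduct.add_tmul, add_mul]
  | tmul x1 x2 =>
    induction v using TensorProduct.induction_on with
    | zero => simp
    | add t t' h h' => simp only [map_add, h, h', TensorProduct.tmul_add, mul_add]
    | tmul y1 y2 => simp

theorem dualComul_one : dualComul k H 1 = 1 := by
  apply pairing_ext
  intro x y
  rw [pairing_dualComul, Algebra.TensorProduct.one_def, pairing_tmul]
  simp

end Comul

end DrinfeldDouble

namespace DrinfeldDouble

open Coalgebra

section ComulHom

variable (k H : Type*) [Field k] [Ring H] [HopfAlgebra k H] [Module.Finite k H]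

/-- The comultiplication of the dual of `H` as an algebra homomorphism. -/
noncomputable def dualComulHom : ConvDual k H →ₐ[k] ConvDual k H ⊗[k] ConvDual k H :=
  AlgHom.ofLinearMap (dualComul k H) dualComul_one dualComul_mul

variable [BijectiveAntipode k H]

/-- `p ↦ Σ (p₂ ⊗ 1) ⊗ (p₁ ⊗ 1)`. -/
noncomputable def comulDual : ConvDual k H →ₐ[k] DrinfeldDouble k H ⊗[k] DrinfeldDouble k H :=
  ((Algebra.TensorProduct.map (ofDual k H) (ofDual k H)).comp
    (Algebra.TensorProduct.comm k (ConvDual k H) (ConvDual k H)).toAlgHom).comp (dualComulHom k H)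

/-- `h ↦ Σ (ε ⊗ h₁) ⊗ (ε ⊗ h₂)`. -/
noncomputable def comulHopf : H →ₐ[k] DrinfeldDouble k H ⊗[k] DrinfeldDouble k H :=
  (Algebra.TensorProduct.map (ofHopf k H) (ofHopf k H)).comp (Bialgebra.comulAlgHom k H)

/-- `p ⊗ h ↦ Σ (p₂ ⊗ h₁) ⊗ (p₁ ⊗ h₂)`. -/
noncomputable def comulLin :
    ConvDual k H ⊗[k] H →ₗ[k] DrinfeldDouble k H ⊗[k] DrinfeldDouble k H :=
  TensorProduct.map toTensor.symm.toLinearMap toTensor.symm.toLinearMap ∘ₗ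
  (TensorProduct.tensorTensorTensorComm k (ConvDual k H) (ConvDual k H) H H).toLinearMap ∘ₗ
  TensorProduct.map ((TensorProduct.comm k (ConvDual k H) (ConvDual k H)).toLinearMap ∘ₗ
    dualComul k H) comul

variable {k H}

theorem comulLin_tmul (p : ConvDual k H) (h : H) :
    comulLin k H (p ⊗ₜ h) = comulDual k H p * comulHopf k H h := by
  change TensorProduct.map toTensor.symm.toLinearMap toTensor.symm.toLinearMap
    (TensorProduct.tensorTensorTensorComm k (ConvDual k H) (ConvDual k H) H H
      (TensorProduct.comm k (ConvDual k H) (ConvDual k H) (dualComul k H p) ⊗ₜ comul h)) =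
    Algebra.TensorProduct.map (ofDual k H) (ofDual k H)
      (TensorProduct.comm k (ConvDual k H) (ConvDual k H) (dualComul k H p)) *
    Algebra.TensorProduct.map (ofHopf k H) (ofHopf k H) (comul h)
  generalize TensorProduct.comm k (ConvDual k H) (ConvDual k H) (dualComul k H p) = s
  generalize comul (R := k) h = t
  induction s using TensorProduct.induction_on with
  | zero => simp
  | add t t' h h' => simp only [map_add, TensorProduct.add_tmul, add_mul, h, h']
  | tmul p p' =>
    induction t using TensorProduct.induction_on with
    | zero => simp
    | add t t' h h' => simp only [map_add, TensorProduct.tmul_add, mul_add, h, h']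
    | tmul h h' =>
      simp [ofDual_mul_ofHopf]
      rfl

/-- `(m, q) ↦ (x ↦ q(m x))`. -/
noncomputable def leftShift : H →ₗ[k] ConvDual k H →ₗ[k] ConvDual k H :=
  LinearMap.mk₂ k (fun m q => (ConvDual.toLin k H).symm
    (ConvDual.toLin k H q ∘ₗ LinearMap.mulLeft k m))
    (by intros; ext; simp [add_mul]) (by intros; ext; simp) (by intros; ext; simp)
    (by intros; ext; simp)

theorem leftShift_apply (m x : H) (q : ConvDual k H) : leftShift m q x = q (m * x) := rfl

theorem pairing_map (f g : ConvDual k H →ₗ[k] ConvDual k H) (F G : H →ₗ[k] H)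
    (hf : ∀ p x, f p x = p (F x)) (hg : ∀ p x, g p x = p (G x)) (u : ConvDual k H ⊗[k] ConvDual k H)
    (x y : H) : pairing (TensorProduct.map f g u) (x ⊗ₜ y) = pairing u (F x ⊗ₜ G y) := by
  induction u using TensorProduct.induction_on with
  | zero => simp
  | add t t' h h' => simp only [map_add, LinearMap.add_apply, h, h']
  | tmul p q => simp [hf, hg]

theorem dualComul_coadj (a c : H) (q : ConvDual k H) : dualComul k H (coadj k H a c q) =
    TensorProduct.map (coadj k H 1 c) (coadj k H a 1) (dualComul k H q) := by
  apply pairing_ext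
  intro x y
  rw [pairing_map _ _ (LinearMap.mulLeft k (antipodeInv k H c)) (LinearMap.mulRight k a)
    (by simp) (by simp)]
  simp [mul_assoc]

theorem map_coadj_dualComul (a c a' c' : H) (q : ConvDual k H) :
    TensorProduct.map (coadj k H a' c') (coadj k H a c) (dualComul k H q) =
    TensorProduct.map (coadj k H 1 c') (coadj k H a 1 ∘ₗ leftShift (a' * antipodeInv k H c))
      (dualComul k H q) := by
  apply pairing_ext
  intro x y
  rw [pairing_map _ _ (LinearMap.mulLeft k (antipodeInv k H c') ∘ₗ LinearMap.mulRight k a')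
    (LinearMap.mulLeft k (antipodeInv k H c) ∘ₗ LinearMap.mulRight k a) (by simp) (by simp),
    pairing_map _ _ (LinearMap.mulLeft k (antipodeInv k H c'))
      (LinearMap.mulLeft k (a' * antipodeInv k H c) ∘ₗ LinearMap.mulRight k a) (by simp)
      (by simp [leftShift_apply, mul_assoc])]
  simp [mul_assoc]

theorem leftShift_one : leftShift (1 : H) = (LinearMap.id : ConvDual k H →ₗ[k] ConvDual k H) := by
  ext; simp [leftShift_apply]

theorem comulLin_twist (h : H) (q : ConvDual k H) :
    comulLin k H (twist k H h q) = comulHopf k H h * comulDual k H q := by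
  let u := dualComul k H q
  let E : H ⊗[k] (H ⊗[k] H) →ₗ[k] ConvDual k H ⊗[k] ConvDual k H :=
    TensorProduct.lift
    { toFun := fun a => TensorProduct.lift (LinearMap.mk₂ k (fun m c =>
          TensorProduct.map (coadj k H 1 c) (coadj k H a 1 ∘ₗ leftShift m) u)
        (by intros; simp [LinearMap.comp_add, TensorProduct.map_add_right])
        (by intros; simp [LinearMap.comp_smul, TensorProduct.map_smul_right])
        (by intros; simp [TensorProduct.map_add_left])
        (by intros; simp [TensorProduct.map_smul_left]))
      map_add' := by
        intros; apply TensorProduct.ext'; intros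
        simp [LinearMap.add_comp, TensorProduct.map_add_right]
      map_smul' := by
        intros; apply TensorProduct.ext'; intros
        simp [LinearMap.smul_comp, TensorProduct.map_smul_right] }
  let Ψ : (ConvDual k H ⊗[k] ConvDual k H) ⊗[k] (H ⊗[k] H) →ₗ[k]
      DrinfeldDouble k H ⊗[k] DrinfeldDouble k H :=
    LinearMap.mul' k _ ∘ₗ TensorProduct.map
      ((Algebra.TensorProduct.map (ofDual k H) (ofDual k H)).toLinearMap ∘ₗ
        (TensorProduct.comm k (ConvDual k H) (ConvDual k H)).toLinearMap)
      (Algebra.TensorProduct.map (ofHopf k H) (ofHopf k H)).toLinearMap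
  let Ω : H ⊗[k] (H ⊗[k] (H ⊗[k] (H ⊗[k] H))) →ₗ[k]
      DrinfeldDouble k H ⊗[k] DrinfeldDouble k H :=
    Ψ ∘ₗ LinearMap.rTensor (H ⊗[k] H) E ∘ₗ
      (TensorProduct.assoc k H (H ⊗[k] H) (H ⊗[k] H)).symm.toLinearMap ∘ₗ
      LinearMap.lTensor H ((TensorProduct.leftComm k H (H ⊗[k] H) H).toLinearMap ∘ₗ
        LinearMap.lTensor H ((TensorProduct.assoc k H H H).symm.toLinearMap ∘ₗ
          LinearMap.lTensor H (TensorProduct.comm k H H).toLinearMap))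
  have hΩ : ∀ a b m b' c' : H, Ω (a ⊗ₜ (b ⊗ₜ (m ⊗ₜ (b' ⊗ₜ c')))) =
      Ψ (TensorProduct.map (coadj k H 1 c') (coadj k H a 1 ∘ₗ leftShift m) u ⊗ₜ (b ⊗ₜ b')) := by
    intros; simp [Ω, E]
  let mm : H ⊗[k] H →ₗ[k] H := LinearMap.mul' k H ∘ₗ
    TensorProduct.map LinearMap.id (antipodeInv k H) ∘ₗ (TensorProduct.comm k H H).toLinearMap
  have hmm : mm ∘ₗ comul = Algebra.linearMap k H ∘ₗ counit := by
    ext a; exact antipodeInv_right a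
  -- the left-hand side
  have e1 : ∀ s, comulLin k H (twist₃ k H s q) = Ω (LinearMap.lTensor H (LinearMap.lTensor H
      (TensorProduct.mk k H (H ⊗[k] H) 1)) (LinearMap.lTensor H
        ((TensorProduct.assoc k H H H).toLinearMap ∘ₗ LinearMap.rTensor H comul) s)) := by
    intro s
    induction s using TensorProduct.induction_on with
    | zero => simp
    | add t t' h h' => simp only [map_add, LinearMap.add_apply, h, h']
    | tmul a s =>
      induction s using TensorProduct.induction_on with
      | zero => simp
      | add t t' h h' => simp only [TensorProduct.tmul_add, map_add, LinearMap.add_apply, h, h']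
      | tmul b c =>
        have e : comulLin k H (twist₃ k H (a ⊗ₜ[k] (b ⊗ₜ[k] c)) q) =
            Ψ (dualComul k H (coadj k H a c q) ⊗ₜ comul b) := by
          rw [twist₃_tmul, comulLin_tmul]
          rfl
        rw [e]
        change Ψ (_ ⊗ₜ comul b) = Ω (LinearMap.lTensor H (LinearMap.lTensor H
          (TensorProduct.mk k H (H ⊗[k] H) 1))
            (a ⊗ₜ TensorProduct.assoc k H H H (comul b ⊗ₜ c)))
        generalize comul (R := k) b = t
        induction t using TensorProduct.induction_on with
        | zero => simp
        | add t t' h h' =>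
          simp only [TensorProduct.tmul_add, TensorProduct.add_tmul, map_add, h, h']
        | tmul b1 b2 =>
          simp only [LinearEquiv.coe_coe, TensorProduct.assoc_tmul, LinearMap.lTensor_tmul,
            TensorProduct.mk_apply]
          rw [hΩ, leftShift_one, LinearMap.comp_id, dualComul_coadj]
  -- the right-hand side
  let K : ConvDual k H ⊗[k] ConvDual k H →ₗ[k] (H ⊗[k] (H ⊗[k] H)) ⊗[k] (H ⊗[k] (H ⊗[k] H)) →ₗ[k]
      DrinfeldDouble k H ⊗[k] DrinfeldDouble k H :=
    TensorProduct.lift (LinearMap.mk₂ k (fun q1 q2 => TensorProduct.map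
        (toTensor.symm.toLinearMap ∘ₗ (twist₃ k H).flip q2)
        (toTensor.symm.toLinearMap ∘ₗ (twist₃ k H).flip q1))
      (by intros; simp [LinearMap.comp_add, TensorProduct.map_add_right])
      (by intros; simp [LinearMap.comp_smul, TensorProduct.map_smul_right])
      (by intros; simp [LinearMap.comp_add, TensorProduct.map_add_left])
      (by intros; simp [LinearMap.comp_smul, TensorProduct.map_smul_left]))
  have hK1 : ∀ (w : ConvDual k H ⊗[k] ConvDual k H) (t : H ⊗[k] H),
      Algebra.TensorProduct.map (ofHopf k H) (ofHopf k H) t *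
      Algebra.TensorProduct.map (ofDual k H) (ofDual k H)
        (TensorProduct.comm k (ConvDual k H) (ConvDual k H) w) =
      K w (TensorProduct.map (comul₃ k H).toLinearMap (comul₃ k H).toLinearMap t) := by
    intro w t
    induction w using TensorProduct.induction_on with
    | zero => simp
    | add t t' h h' => simp only [map_add, LinearMap.add_apply, mul_add, h, h']
    | tmul q1 q2 =>
      induction t using TensorProduct.induction_on with
      | zero => simp
      | add t t' h h' => simp only [map_add, add_mul, h, h']
      | tmul h1 h2 =>
        have e3 : ∀ (h : H) (q : ConvDual k H), ofHopf k H h * ofDual k H q =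
            toTensor.symm (twist₃ k H (comul₃ k H h) q) := by
          intro h q
          rw [LinearEquiv.eq_symm_apply, toTensor_ofHopf_mul_ofDual, twist_apply]
        simp [K, e3]
  have hK2 : ∀ (w : ConvDual k H ⊗[k] ConvDual k H) (a b c a' b' c' : H),
      K w ((a ⊗ₜ (b ⊗ₜ c)) ⊗ₜ (a' ⊗ₜ (b' ⊗ₜ c'))) =
      Ψ (TensorProduct.map (coadj k H a' c') (coadj k H a c) w ⊗ₜ (b ⊗ₜ b')) := by
    intro w a b c a' b' c'
    induction w using TensorProduct.induction_on with
    | zero => simp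
    | add t t' h h' => simp only [map_add, LinearMap.add_apply, TensorProduct.add_tmul, h, h']
    | tmul q1 q2 =>
      simp [K, Ψ, ofDual_mul_ofHopf]
      rfl
  let P : (H ⊗[k] (H ⊗[k] H)) ⊗[k] (H ⊗[k] (H ⊗[k] H)) →ₗ[k]
      H ⊗[k] (H ⊗[k] ((H ⊗[k] H) ⊗[k] (H ⊗[k] H))) :=
    LinearMap.lTensor H (LinearMap.lTensor H (TensorProduct.assoc k H H (H ⊗[k] H)).symm.toLinearMap
      ∘ₗ (TensorProduct.assoc k H H (H ⊗[k] (H ⊗[k] H))).toLinearMap) ∘ₗ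
      (TensorProduct.assoc k H (H ⊗[k] H) (H ⊗[k] (H ⊗[k] H))).toLinearMap
  have e2 : ∀ z, K u z = Ω (LinearMap.lTensor H (LinearMap.lTensor H
      (LinearMap.rTensor (H ⊗[k] H) mm)) (P z)) := by
    intro z
    have : K u = Ω ∘ₗ LinearMap.lTensor H (LinearMap.lTensor H
      (LinearMap.rTensor (H ⊗[k] H) mm)) ∘ₗ P := by
      apply TensorProduct.ext'
      intro s s'
      induction s using TensorProduct.induction_on with
      | zero => simp
      | add t t' h h' => simp only [map_add, TensorProduct.add_tmul, h, h']
      | tmul a s =>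
        induction s using TensorProduct.induction_on with
        | zero => simp
        | add t t' h h' => simp only [map_add, TensorProduct.add_tmul, TensorProduct.tmul_add, h, h']
        | tmul b c =>
          induction s' using TensorProduct.induction_on with
          | zero => simp
          | add t t' h h' => simp only [map_add, TensorProduct.tmul_add, h, h']
          | tmul a' s' =>
            induction s' using TensorProduct.induction_on with
            | zero => simp
            | add t t' h h' => simp only [map_add, TensorProduct.tmul_add, h, h']
            | tmul b' c' =>
              rw [hK2, map_coadj_dualComul]
              simp only [LinearMap.comp_apply, P, LinearMap.lTensor_tmul, LinearEquiv.coe_coe,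
                TensorProduct.assoc_tmul, TensorProduct.assoc_symm_tmul, LinearMap.rTensor_tmul]
              rw [hΩ]
              simp [mm, u]
    rw [this]; rfl
  have c1 : LinearMap.lTensor H ((TensorProduct.assoc k H H H).toLinearMap ∘ₗ
      LinearMap.rTensor H comul) ∘ₗ (comul₃ k H).toLinearMap =
      LinearMap.lTensor H (LinearMap.lTensor H comul) ∘ₗ (comul₃ k H).toLinearMap := by
    simp only [toLinearMap_comul₃, coassoc_simps]
  have c2 : P ∘ₗ TensorProduct.map (comul₃ k H).toLinearMap (comul₃ k H).toLinearMap ∘ₗ comul =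
      LinearMap.lTensor H (LinearMap.lTensor H (TensorProduct.map comul comul ∘ₗ comul)) ∘ₗ
        (comul₃ k H).toLinearMap := by
    simp only [P, toLinearMap_comul₃, coassoc_simps]
  have c3 : LinearMap.rTensor (H ⊗[k] H) mm ∘ₗ TensorProduct.map comul comul ∘ₗ
      comul (R := k) (A := H) = TensorProduct.mk k H (H ⊗[k] H) 1 ∘ₗ comul := by
    have : LinearMap.rTensor (H ⊗[k] H) mm ∘ₗ TensorProduct.map comul comul =
        TensorProduct.map (Algebra.linearMap k H) comul ∘ₗ LinearMap.rTensor H counit := by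
      rw [LinearMap.rTensor, ← TensorProduct.map_comp, hmm, LinearMap.rTensor,
        ← TensorProduct.map_comp, LinearMap.id_comp, LinearMap.comp_id]
    rw [← LinearMap.comp_assoc, this]
    ext a
    change TensorProduct.map (Algebra.linearMap k H) comul (LinearMap.rTensor H counit (comul a)) =
      1 ⊗ₜ comul a
    rw [Coalgebra.rTensor_counit_comul]
    simp
  have c4 : LinearMap.lTensor H (LinearMap.lTensor H (LinearMap.rTensor (H ⊗[k] H) mm)) ∘ₗ P ∘ₗ
      TensorProduct.map (comul₃ k H).toLinearMap (comul₃ k H).toLinearMap ∘ₗ comul =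
      LinearMap.lTensor H (LinearMap.lTensor H (TensorProduct.mk k H (H ⊗[k] H) 1)) ∘ₗ
      LinearMap.lTensor H ((TensorProduct.assoc k H H H).toLinearMap ∘ₗ
        LinearMap.rTensor H comul) ∘ₗ (comul₃ k H).toLinearMap := by
    rw [c2, c1, ← LinearMap.comp_assoc, ← LinearMap.comp_assoc, ← LinearMap.lTensor_comp,
      ← LinearMap.lTensor_comp, c3, ← LinearMap.lTensor_comp, ← LinearMap.lTensor_comp]
  rw [twist_apply, e1]
  refine Eq.trans ?_ (hK1 u (comul h)).symm
  rw [e2]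
  exact congrArg Ω (LinearMap.congr_fun c4 h).symm

variable (k H) in
/-- The comultiplication of `D(H)`: `Δ(p ⊗ h) = Σ (p₂ ⊗ h₁) ⊗ (p₁ ⊗ h₂)`, where
`Σ p₁(x) p₂(y) = p(x y)`. -/
noncomputable def comul : DrinfeldDouble k H →ₐ[k] DrinfeldDouble k H ⊗[k] DrinfeldDouble k H :=
  AlgHom.ofLinearMap (comulLin k H ∘ₗ (toTensor (k := k) (H := H)).toLinearMap)
    (by
      change comulLin k H (1 ⊗ₜ 1) = 1
      rw [comulLin_tmul, map_one, map_one, mul_one])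
    (fun X Y => map_twistedMul (twist k H) (comulDual k H).toLinearMap (comulHopf k H)
      (comulLin k H) (fun p q => map_mul (comulDual k H) p q) comulLin_tmul comulLin_twist X Y)

end ComulHom

end DrinfeldDouble

namespace DrinfeldDouble

section Counit

variable (k H : Type*) [Field k] [Ring H] [HopfAlgebra k H]

/-- Evaluation of linear forms at `1`. -/
noncomputable def evalOne : ConvDual k H →ₗ[k] k :=
  LinearMap.applyₗ 1 ∘ₗ (ConvDual.toLin k H).toLinearMap

variable {k H} in
theorem evalOne_apply (p : ConvDual k H) : evalOne k H p = p 1 := rfl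

/-- The linear map `p ⊗ h ↦ p(1) ε(h)`. -/
noncomputable def counitLin : ConvDual k H ⊗[k] H →ₗ[k] k :=
  LinearMap.mul' k k ∘ₗ TensorProduct.map (evalOne k H) Coalgebra.counit

variable {k H}

theorem evalOne_mul (p q : ConvDual k H) :
    evalOne k H (p * q) = evalOne k H p * evalOne k H q := by
  rw [evalOne_apply, ConvDual.mul_apply, Bialgebra.comul_one, Algebra.TensorProduct.one_def]
  simp [evalOne_apply]

variable [BijectiveAntipode k H]

theorem counitLin_twist (h : H) (q : ConvDual k H) :
    counitLin k H (twist k H h q) = Coalgebra.counit (R := k) h * evalOne k H q := by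
  have e : ∀ s, counitLin k H (twist₃ k H s q) = q (LinearMap.mul' k H (TensorProduct.map
      (antipodeInv k H) LinearMap.id (TensorProduct.comm k H H (LinearMap.lTensor H
        ((TensorProduct.lid k H).toLinearMap ∘ₗ LinearMap.rTensor H Coalgebra.counit) s)))) := by
    intro s
    induction s using TensorProduct.induction_on with
    | zero => simp
    | add t t' h h' => simp only [map_add, LinearMap.add_apply, h, h']
    | tmul a s =>
      induction s using TensorProduct.induction_on with
      | zero => simp
      | add t t' h h' => simp only [TensorProduct.tmul_add, map_add, LinearMap.add_apply, h, h']
      | tmul b c => simp [counitLin, evalOne_apply, mul_comm]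
  have e2 : (LinearMap.lTensor H ((TensorProduct.lid k H).toLinearMap ∘ₗ
      LinearMap.rTensor H Coalgebra.counit)) (comul₃ k H h) = Coalgebra.comul h := by
    have : ((TensorProduct.lid k H).toLinearMap ∘ₗ LinearMap.rTensor H Coalgebra.counit) ∘ₗ
        Coalgebra.comul = LinearMap.id (R := k) (M := H) := by
      ext a; simp
    change (LinearMap.lTensor H _) (LinearMap.lTensor H Coalgebra.comul (Coalgebra.comul h)) = _
    rw [← LinearMap.comp_apply, ← LinearMap.lTensor_comp, this]
    simp
  rw [twist_apply, e, e2, antipodeInv_left, evalOne_apply, Algebra.algebraMap_eq_smul_one]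
  simp

variable (k H) in
/-- The counit of `D(H)`: `ε(p ⊗ h) = p(1) ε(h)`. -/
noncomputable def counit : DrinfeldDouble k H →ₐ[k] k :=
  AlgHom.ofLinearMap (counitLin k H ∘ₗ (toTensor (k := k) (H := H)).toLinearMap)
    (by
      change counitLin k H (1 ⊗ₜ 1) = 1
      simp [counitLin, evalOne_apply])
    (fun X Y => map_twistedMul (twist k H) (evalOne k H) (Bialgebra.counitAlgHom k H)
      (counitLin k H) evalOne_mul (fun p h => by simp [counitLin]) counitLin_twist X Y)

end Counit

section RMatrix

variable (k H : Type*) [Field k] [Ring H] [HopfAlgebra k H] [BijectiveAntipode k H]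
  [Module.Finite k H]

/-- The universal `R`-matrix `Σ (ε ⊗ h_i) ⊗ (h^i ⊗ 1)` of `D(H)`, where `(h_i)`, `(h^i)` are dual
bases of `H` and `H^*`. -/
noncomputable def universalR : DrinfeldDouble k H ⊗[k] DrinfeldDouble k H :=
  TensorProduct.map (ofHopf k H).toLinearMap
    ((ofDual k H).toLinearMap ∘ₗ (ConvDual.toLin k H).symm.toLinearMap) (coevaluation k H 1)

end RMatrix

universe u

/-- Left modules over the Drinfel'd double `D(H)`. -/
structure Mod (k H : Type u) [Field k] [Ring H] [HopfAlgebra k H] [BijectiveAntipode k H] where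
  /-- The underlying vector space. -/
  carrier : Type u
  [addCommGroup : AddCommGroup carrier]
  [module : Module k carrier]
  /-- The action of `D(H)`. -/
  ρ : DrinfeldDouble k H →ₐ[k] Module.End k carrier

namespace Mod

attribute [instance] addCommGroup module

variable {k H : Type u} [Field k] [Ring H] [HopfAlgebra k H] [BijectiveAntipode k H]

/-- The trivial module. -/
noncomputable def triv : Mod k H where
  carrier := k
  ρ := (Algebra.ofId k (Module.End k k)).comp (counit k H)

/-- The algebra of `D(H)`-linear endomorphisms of `V`. -/
noncomputable def endAlg (V : Mod k H) : Subalgebra k (Module.End k V.carrier) :=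
  Subalgebra.centralizer k (Set.range V.ρ)

variable [Module.Finite k H]

/-- The tensor product, with `D(H)` acting through its comultiplication. -/
noncomputable def tensor (V W : Mod k H) : Mod k H where
  carrier := V.carrier ⊗[k] W.carrier
  ρ := (Module.endTensorEndAlgHom.comp (Algebra.TensorProduct.map V.ρ W.ρ)).comp (comul k H)

/-- The tensor power `V^{⊗ r}`, nested to the right and ending in the trivial module. -/
noncomputable def tpow (V : Mod k H) : ℕ → Mod k H
  | 0 => triv
  | r + 1 => tensor V (tpow V r)

/-- The braiding `R_V = τ ∘ (π ⊗ π)(R)` on `V ⊗ V`. -/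
noncomputable def braiding (V : Mod k H) :
    V.carrier ⊗[k] V.carrier →ₗ[k] V.carrier ⊗[k] V.carrier :=
  (TensorProduct.comm k V.carrier V.carrier).toLinearMap ∘ₗ
    Module.endTensorEndAlgHom (R := k) (S := k) (A := k)
      (TensorProduct.map V.ρ.toLinearMap V.ρ.toLinearMap (universalR k H))

/-- The operator `id^{⊗ i} ⊗ R_V ⊗ id^{⊗ (r - i - 2)}` on `V^{⊗ r}`, for `i + 2 ≤ r`. -/
noncomputable def braidAt (V : Mod k H) : (r i : ℕ) → Module.End k (tpow V r).carrier
  | 0, _ => 1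
  | 1, _ => 1
  | r + 2, 0 =>
      (TensorProduct.assoc k V.carrier V.carrier (tpow V r).carrier).toLinearMap ∘ₗ
        LinearMap.rTensor (tpow V r).carrier V.braiding ∘ₗ
        (TensorProduct.assoc k V.carrier V.carrier (tpow V r).carrier).symm.toLinearMap
  | r + 2, i + 1 => LinearMap.lTensor V.carrier (braidAt V (r + 1) i)

end Mod

end DrinfeldDouble

namespace DrinfeldDouble

namespace Mod

universe u

variable {k H : Type u} [Field k] [Ring H] [HopfAlgebra k H] [BijectiveAntipode k H]

/-- A submodule, with the restricted action. -/
noncomputable def sub (V : Mod k H) (N : Submodule k V.carrier)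
    (hN : ∀ X, ∀ v ∈ N, V.ρ X v ∈ N) : Mod k H where
  carrier := N
  ρ := AlgHom.ofLinearMap
    { toFun := fun X => (V.ρ X).restrict (hN X)
      map_add' := fun X Y => by ext; simp
      map_smul' := fun r X => by ext; simp }
    (by ext; simp) (fun X Y => by ext; simp)

/-- `H` as a module over `D(H)`: `H` acts by `•_χ` and `H^*` through the coaction `Δ`. -/
noncomputable def radford (χ : H →ₐ[k] k) : Mod k H where
  carrier := H
  ρ := DrinfeldDouble.act (radfordAct χ) Coalgebra.comul (isYetterDrinfeld_radfordAct χ)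

/-- The submodule `H •_χ g` of `(H, •_χ, Δ)`, for a group-like element `g`. -/
noncomputable def radfordSub (χ : H →ₐ[k] k) (g : H) (hg : IsGroupLikeElem k g) : Mod k H :=
  (radford χ).sub (radfordSubmodule (k := k) (H := H) χ g) fun X _ hv => act_radford_mem χ hg X hv

end Mod

end DrinfeldDouble

namespace TaftAlgebra

section Characters

variable {k : Type*} [Field k] {n ℓ : ℕ} [NeZero ℓ] {q : k} [hq : Fact (IsPrimitiveRoot q ℓ)]

theorem antipode_eq (a : TaftAlgebra k n ℓ q) :
    HopfAlgebra.antipode k a = (antiHom k n ℓ q (-1) a).unop := rfl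

theorem Kinv_x_K (i : Fin n) : (Kinv i * x i * K i : TaftAlgebra k n ℓ q) = q⁻¹ • x i := by
  have h := K_mul_x (k := k) (ℓ := ℓ) (q := q) i i
  rw [show Taft.theta q i i = 1 by simp [Taft.theta], if_pos rfl, one_mul] at h
  have h2 : (x i * K i : TaftAlgebra k n ℓ q) = q⁻¹ • (K i * x i) := by
    rw [h, smul_smul, inv_mul_cancel₀ (q_ne_zero hq.out), one_smul]
  rw [mul_assoc, h2, mul_smul_comm, ← mul_assoc, Kinv_mul_K, one_mul]

instance : BijectiveAntipode k (TaftAlgebra k n ℓ q) where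
  bijective := by
    have hq0 := q_ne_zero hq.out
    rw [Function.bijective_iff_has_inverse]
    refine ⟨fun a => (antiHom k n ℓ q (-q) a).unop, fun a => ?_, fun a => ?_⟩ <;>
      simp only [antipode_eq]
    · induction a using gen_induction with
      | hK i => simp
      | hKinv i => simp
      | hx i => simp [Kinv_x_K, smul_smul, hq0]
      | hc c => simp
      | hadd a b ha hb => simp [ha, hb]
      | hmul a b ha hb => simp [ha, hb]
    · induction a using gen_induction with
      | hK i => simp
      | hKinv i => simp
      | hx i => simp [Kinv_x_K, smul_smul, hq0]
      | hc c => simp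
      | hadd a b ha hb => simp [ha, hb]
      | hmul a b ha hb => simp [ha, hb]

theorem char_realization (α : Fin n → ℕ) :
    IsRealization ℓ q (fun i => q ^ α i) (fun i => (q ^ α i)⁻¹) (fun _ => 0) where
  K_comm i j := mul_comm _ _
  K_Kinv i := mul_inv_cancel₀ (pow_ne_zero _ (q_ne_zero hq.out))
  Kinv_K i := inv_mul_cancel₀ (pow_ne_zero _ (q_ne_zero hq.out))
  K_pow i := by rw [← pow_mul, mul_comm, pow_mul, hq.out.pow_eq_one, one_pow]
  K_x i j := by simp
  x_x i j := by simp
  x_pow i := zero_pow (NeZero.ne ℓ)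

/-- The character `𝗄(α)`: `K(ε_i) ↦ q ^ α_i`, `x_i ↦ 0`. -/
noncomputable def char (α : Fin n → ℕ) : TaftAlgebra k n ℓ q →ₐ[k] k :=
  lift (char_realization α)

/-- The group-like element `K(β) = K(ε_1) ^ β_1 ⋯ K(ε_n) ^ β_n`. -/
noncomputable def Kmon (β : Fin n → ℕ) : TaftAlgebra k n ℓ q :=
  (List.ofFn fun i => K i ^ β i).prod

theorem isGroupLikeElem_Kmon (β : Fin n → ℕ) :
    IsGroupLikeElem k (Kmon β : TaftAlgebra k n ℓ q) := by
  have h : ∀ L : List (TaftAlgebra k n ℓ q), (∀ a ∈ L, IsGroupLikeElem k a) →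
      IsGroupLikeElem k L.prod := by
    intro L
    induction L with
    | nil => exact fun _ => IsGroupLikeElem.one
    | cons a L ih =>
      intro hL
      rw [List.prod_cons]
      exact (hL a List.mem_cons_self).mul (ih fun b hb => hL b (List.mem_cons_of_mem _ hb))
  refine h _ fun a ha => ?_
  obtain ⟨i, rfl⟩ := List.mem_ofFn.1 ha
  exact IsGroupLikeElem.pow ⟨counit_K i, comul_K i⟩

end Characters

universe u

variable {k : Type u} [Field k] {ℓ : ℕ} [NeZero ℓ] {q : k} [Fact (IsPrimitiveRoot q ℓ)]

/-- The `D(H)`-module `H_{α, β} = H •_{𝗄(α)} K(β)`, for `H` the `n`-rank Taft algebra. -/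
noncomputable def doubleModule {n : ℕ} (α β : Fin n → ℕ) :
    DrinfeldDouble.Mod k (TaftAlgebra k n ℓ q) :=
  .radfordSub (char α) (Kmon β) (isGroupLikeElem_Kmon β)

variable (k ℓ q) in
/-- The module `H_{α, β}` with `n = 2`, `α = (ℓ - 1) ε_2` and `β = i₀ (ε_1 + ε_2)`, where
`i₀ = (ℓ + 1) / 2` (for odd `ℓ`). -/
noncomputable def selfDualModule : DrinfeldDouble.Mod k (TaftAlgebra k 2 ℓ q) :=
  doubleModule ![0, ℓ - 1] ![(ℓ + 1) / 2, (ℓ + 1) / 2]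

end TaftAlgebra

namespace BMW

/-- Generators `T_i` and `T_i⁻¹`, `i < r - 1`. -/
inductive Gen (r : ℕ) : Type
  | T (i : Fin (r - 1))
  | Tinv (i : Fin (r - 1))

section Free

variable (k : Type*) [Field k] {r : ℕ}

/-- The free generator `T_i`. -/
noncomputable def fT (i : Fin (r - 1)) : FreeAlgebra k (Gen r) := FreeAlgebra.ι k (.T i)

/-- The free generator `T_i⁻¹`. -/
noncomputable def fTinv (i : Fin (r - 1)) : FreeAlgebra k (Gen r) := FreeAlgebra.ι k (.Tinv i)

/-- `E_i = 1 - ω⁻¹ (T_i - T_i⁻¹)` with `ω = s - s⁻¹`, in the free algebra. -/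
noncomputable def fE (s : k) (i : Fin (r - 1)) : FreeAlgebra k (Gen r) :=
  1 - (s - s⁻¹)⁻¹ • (fT k i - fTinv k i)

end Free

/-- Defining relations of the Birman–Murakami–Wenzl algebra; the first two say that `T_i⁻¹` is the
inverse of `T_i`. -/
inductive Rel (k : Type*) [Field k] (r : ℕ) (s t : k) :
    FreeAlgebra k (Gen r) → FreeAlgebra k (Gen r) → Prop
  | T_Tinv (i : Fin (r - 1)) : Rel k r s t (fT k i * fTinv k i) 1
  | Tinv_T (i : Fin (r - 1)) : Rel k r s t (fTinv k i * fT k i) 1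
  | cubic (i : Fin (r - 1)) : Rel k r s t
      ((fT k i - algebraMap k _ s) * (fT k i + algebraMap k _ s⁻¹) *
        (fT k i - algebraMap k _ t⁻¹)) 0
  | braid (i j : Fin (r - 1)) (h : i.val + 1 = j.val) :
      Rel k r s t (fT k i * fT k j * fT k i) (fT k j * fT k i * fT k j)
  | comm (i j : Fin (r - 1)) (h : i.val + 1 < j.val ∨ j.val + 1 < i.val) :
      Rel k r s t (fT k i * fT k j) (fT k j * fT k i)
  | E_T_E (i j : Fin (r - 1)) (h : i.val + 1 = j.val ∨ j.val + 1 = i.val) :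
      Rel k r s t (fE k s i * fT k j * fE k s i) (t • fE k s i)
  | E_Tinv_E (i j : Fin (r - 1)) (h : i.val + 1 = j.val ∨ j.val + 1 = i.val) :
      Rel k r s t (fE k s i * fTinv k j * fE k s i) (t⁻¹ • fE k s i)
  | E_T (i : Fin (r - 1)) : Rel k r s t (fE k s i * fT k i) (t⁻¹ • fE k s i)
  | T_E (i : Fin (r - 1)) : Rel k r s t (fT k i * fE k s i) (t⁻¹ • fE k s i)

end BMW

/-- The Birman–Murakami–Wenzl algebra `B_r(s, t)`. -/
def BMW (k : Type*) [Field k] (r : ℕ) (s t : k) : Type _ := RingQuot (BMW.Rel k r s t)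

namespace BMW

variable {k : Type*} [Field k] {r : ℕ} {s t : k}

noncomputable instance : Ring (BMW k r s t) := inferInstanceAs (Ring (RingQuot (Rel k r s t)))

noncomputable instance : Algebra k (BMW k r s t) :=
  inferInstanceAs (Algebra k (RingQuot (Rel k r s t)))

/-- The quotient map from the free algebra. -/
noncomputable def mk : FreeAlgebra k (Gen r) →ₐ[k] BMW k r s t :=
  RingQuot.mkAlgHom k (Rel k r s t)

/-- The generator `T_i`. -/
noncomputable def T (i : Fin (r - 1)) : BMW k r s t := mk (fT k i)

/-- The element `E_i`. -/
noncomputable def E (i : Fin (r - 1)) : BMW k r s t := mk (fE k s i)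

end BMW

/-! The proof has a general half about Yetter–Drinfel'd modules and a computational half about one
operator on M ⊗ M.

General half. The space H with the action •_χ and the coaction Δ is a Yetter–Drinfel'd module, and M
sits inside it as a D(H)-submodule. On a Yetter–Drinfel'd module the universal R-matrix followed by
the flip is the map c(v ⊗ w) = Σ w₀ ⊗ w₁·v (`braidOf_act`). Coassociativity, the compatibility of
action and coaction, and Σ s⁻¹(h₂)h₁ = ε(h) show that c is H-linear (`ydBraid_diagAct`) and
H-colinear (`diagCoact_ydBraid`), hence D(H)-linear, and that it solves the braid equation
(`ydBraid_braid`). The braiding is natural, and tensor powers of an injective map over a field are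
injective, so both properties pass to M.

Computational half. Put a = q^{1/2}, ω = s − s⁻¹ = a⁻¹ − a, u = t⁻¹ = a³ and Q = T² − ωT − 1 = (T −
s)(T + s⁻¹). The cubic relation reads TQ = uQ. It gives T⁻¹ = T − ω − u⁻¹Q and E = −(ωu)⁻¹Q, so the
inverse disappears and all relations become polynomial: TQ = uQ, the braid relation, QT'Q = −ωQ and
QQ'Q = (ωu)²Q for neighbours T, T' in either order, and commutation at a distance. The relation for
E T'⁻¹ E is a consequence of these. `BMW.exists_algHom` carries out this reduction.

On M ⊗ M the operator Q has rank at most one: Q(m_i ⊗ m_j) = b(i,j)·v for an explicit form b and an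
explicit vector v (`IsBraidTable.quad_apply`). The cubic relation then says Tv = a³v, and each
relation between neighbours comes down to an identity on the four vectors v ⊗ m_l or on the four
vectors m_l ⊗ v (`IsBraidTable.isAdjacent`).

The sixteen values of T are read off from the action of the generators on four explicit vectors of M
and from the coproducts of these vectors (`act_x0`, `act_x1`, `act_K0`, `act_K1`, `comul_basisVec`).
Only the fact that these vectors span M enters; neither their linear independence nor the simplicity
of M plays a role. -/

namespace DrinfeldDouble

/-! ### The braiding of a Yetter–Drinfel'd module: linearity, colinearity, braid equation. -/

section YetterDrinfeldBraiding

variable {k H V : Type*} [Field k] [Ring H] [HopfAlgebra k H] [BijectiveAntipode k H]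
  [AddCommGroup V] [Module k V]

/-- `a ⊗ b ↦ s⁻¹(b) a`. -/
noncomputable def invContract (k H : Type*) [Field k] [Ring H] [HopfAlgebra k H]
    [BijectiveAntipode k H] : H ⊗[k] H →ₗ[k] H :=
  LinearMap.mul' k H ∘ₗ
    TensorProduct.map (antipodeInv k H) LinearMap.id ∘ₗ (TensorProduct.comm k H H).toLinearMap

@[simp] theorem invContract_tmul (a b : H) :
    invContract k H (a ⊗ₜ b) = antipodeInv k H b * a := by
  simp [invContract]

/-- `Σ s⁻¹(h₂) h₁ ⊗ h₃ ⊗ h₄ = Σ 1 ⊗ h₁ ⊗ h₂`. -/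
theorem invContract_comul (h : H) :
    LinearMap.rTensor (H ⊗[k] H) (invContract k H) ((TensorProduct.assoc k H H (H ⊗[k] H)).symm
      (LinearMap.lTensor H (comul₃ k H).toLinearMap (Coalgebra.comul h))) =
    1 ⊗ₜ Coalgebra.comul h := by
  have hmm : invContract k H ∘ₗ Coalgebra.comul = Algebra.linearMap k H ∘ₗ Coalgebra.counit := by
    ext a; exact antipodeInv_left a
  -- Coassociativity regroups h₁ ⊗ (h₂ ⊗ h₃ ⊗ h₄) as Δ(h₁) ⊗ Δ(h₂), so that the antipode identity
  -- applies to the first tensor factor alone.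
  have e1 : (TensorProduct.assoc k H H (H ⊗[k] H)).symm.toLinearMap ∘ₗ
      LinearMap.lTensor H (comul₃ k H).toLinearMap ∘ₗ Coalgebra.comul =
      TensorProduct.map Coalgebra.comul Coalgebra.comul ∘ₗ Coalgebra.comul (R := k) (A := H) := by
    simp only [toLinearMap_comul₃, coassoc_simps]
  have e2 : LinearMap.rTensor (H ⊗[k] H) (invContract k H) ∘ₗ
      TensorProduct.map Coalgebra.comul Coalgebra.comul =
      TensorProduct.map (Algebra.linearMap k H) Coalgebra.comul ∘ₗ
        LinearMap.rTensor H Coalgebra.counit := by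
    rw [LinearMap.rTensor, ← TensorProduct.map_comp, hmm, LinearMap.rTensor,
      ← TensorProduct.map_comp, LinearMap.id_comp, LinearMap.comp_id]
  have e3 := LinearMap.congr_fun e1 h
  simp only [LinearMap.comp_apply, LinearEquiv.coe_coe] at e3
  rw [e3, ← LinearMap.comp_apply, e2, LinearMap.comp_apply, Coalgebra.rTensor_counit_comul]
  simp

/-- `v ⊗ (w ⊗ h) ↦ w ⊗ h · v`. -/
noncomputable def swapAct (ρ : H →ₐ[k] Module.End k V) : V ⊗[k] (V ⊗[k] H) →ₗ[k] V ⊗[k] V :=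
  LinearMap.lTensor V (TensorProduct.lift ρ.toLinearMap) ∘ₗ
    (TensorProduct.assoc k V H V).toLinearMap ∘ₗ (TensorProduct.comm k V (V ⊗[k] H)).toLinearMap

@[simp] theorem swapAct_tmul (ρ : H →ₐ[k] Module.End k V) (v w : V) (h : H) :
    swapAct ρ (v ⊗ₜ (w ⊗ₜ h)) = w ⊗ₜ ρ h v := by
  simp [swapAct]

/-- The braiding `v ⊗ w ↦ Σ w₀ ⊗ w₁ · v`. -/
noncomputable def ydBraid (ρ : H →ₐ[k] Module.End k V) (δ : V →ₗ[k] V ⊗[k] H) :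
    V ⊗[k] V →ₗ[k] V ⊗[k] V :=
  swapAct ρ ∘ₗ LinearMap.lTensor V δ

@[simp] theorem ydBraid_tmul (ρ : H →ₐ[k] Module.End k V) (δ : V →ₗ[k] V ⊗[k] H) (v w : V) :
    ydBraid ρ δ (v ⊗ₜ w) = swapAct ρ (v ⊗ₜ δ w) := by
  simp [ydBraid]

/-- The diagonal action of `H` on `V ⊗ V`. -/
noncomputable def diagAct (ρ : H →ₐ[k] Module.End k V) : H →ₐ[k] Module.End k (V ⊗[k] V) :=
  (Module.endTensorEndAlgHom.comp (Algebra.TensorProduct.map ρ ρ)).comp (Bialgebra.comulAlgHom k H)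

theorem diagAct_apply (ρ : H →ₐ[k] Module.End k V) (h : H) :
    diagAct ρ h = Module.endTensorEndAlgHom (R := k) (S := k) (A := k)
      (Algebra.TensorProduct.map ρ ρ (Coalgebra.comul h)) := rfl

/-- The braiding sends h₁·v ⊗ h₂·w to (h₂·w)₀ ⊗ (h₂·w)₁h₁·v. The compatibility condition expands
this to h₃·w₀ ⊗ h₄w₁s⁻¹(h₂)h₁·v, and the inner factor s⁻¹(h₂)h₁ collapses by `invContract_comul`. -/
theorem IsYetterDrinfeld.ydBraid_diagAct {ρ : H →ₐ[k] Module.End k V} {δ : V →ₗ[k] V ⊗[k] H}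
    (hyd : IsYetterDrinfeld ρ δ) (h : H) (x : V ⊗[k] V) :
    ydBraid ρ δ (diagAct ρ h x) = diagAct ρ h (ydBraid ρ δ x) := by
  induction x using TensorProduct.induction_on with
  | zero => simp
  | add x y hx hy => simp only [map_add, hx, hy]
  | tmul v w =>
    -- `N t (m ⊗ (b ⊗ c)) = b · t₀ ⊗ c t₁ m · v`
    let N : V ⊗[k] H →ₗ[k] H ⊗[k] (H ⊗[k] H) →ₗ[k] V ⊗[k] V :=
      (sandwich ρ).flip.compr₂ (swapAct ρ ∘ₗ TensorProduct.mk k V (V ⊗[k] H) v)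
    have hN : ∀ (w : V) (y m b c : H), N (w ⊗ₜ y) (m ⊗ₜ (b ⊗ₜ c)) =
        ρ b w ⊗ₜ ρ (c * (y * m)) v := by
      intros; simp [N]
    have e1 : ∀ s : H ⊗[k] H, ydBraid ρ δ (Module.endTensorEndAlgHom (R := k) (S := k) (A := k)
        (Algebra.TensorProduct.map ρ ρ s) (v ⊗ₜ w)) = N (δ w)
          (LinearMap.rTensor (H ⊗[k] H) (invContract k H)
            ((TensorProduct.assoc k H H (H ⊗[k] H)).symm
              (LinearMap.lTensor H (comul₃ k H).toLinearMap s))) := by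
      intro s
      induction s using TensorProduct.induction_on with
      | zero => simp
      | add s t hs ht => simp only [map_add, LinearMap.add_apply, hs, ht]
      | tmul a b =>
        simp only [Algebra.TensorProduct.map_tmul, AlgHom.toLinearMap_apply,
          Module.endTensorEndAlgHom_apply, TensorProduct.AlgebraTensorModule.map_tmul,
          ydBraid_tmul, hyd.compat, LinearMap.lTensor_tmul]
        generalize comul₃ k H b = t
        generalize δ w = u
        induction u using TensorProduct.induction_on with
        | zero => simp
        | add u u' h h' => simp only [map_add, TensorProduct.tmul_add, LinearMap.add_apply, h, h']
        | tmul w y =>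
          induction t using TensorProduct.induction_on with
          | zero => simp
          | add t t' h h' =>
            simp only [TensorProduct.tmul_add, map_add, LinearMap.add_apply, h, h']
          | tmul a1 t =>
            induction t using TensorProduct.induction_on with
            | zero => simp
            | add t t' h h' =>
              simp only [TensorProduct.tmul_add, map_add, LinearMap.add_apply, h, h']
            | tmul b1 c1 => simp [hN]
    rw [diagAct_apply, e1, invContract_comul, ydBraid_tmul]
    generalize Coalgebra.comul (R := k) h = s
    generalize δ w = u
    induction u using TensorProduct.induction_on with
    | zero => simp
    | add u u' h h' => simp only [map_add, TensorProduct.tmul_add, LinearMap.add_apply, h, h']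
    | tmul w y =>
      induction s using TensorProduct.induction_on with
      | zero => simp
      | add t t' h h' =>
        simp only [TensorProduct.tmul_add, map_add, LinearMap.add_apply, h, h']
      | tmul b c =>
        simp [hN]
        rfl

/-- `v ⊗ w ⊗ y ↦ v₀ ⊗ w ⊗ y v₁`, with values in `(V ⊗ V) ⊗ H`. -/
noncomputable def coactAux (δ : V →ₗ[k] V ⊗[k] H) :
    V ⊗[k] (V ⊗[k] H) →ₗ[k] (V ⊗[k] V) ⊗[k] H :=
  TensorProduct.map LinearMap.id (LinearMap.mul' k H ∘ₗ (TensorProduct.comm k H H).toLinearMap) ∘ₗ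
    (TensorProduct.tensorTensorTensorComm k V H V H).toLinearMap ∘ₗ LinearMap.rTensor (V ⊗[k] H) δ

/-- The codiagonal coaction `v ⊗ w ↦ Σ (v₀ ⊗ w₀) ⊗ w₁ v₁` of `H` on `V ⊗ V`. -/
noncomputable def diagCoact (δ : V →ₗ[k] V ⊗[k] H) : V ⊗[k] V →ₗ[k] (V ⊗[k] V) ⊗[k] H :=
  coactAux δ ∘ₗ LinearMap.lTensor V δ

/-- `((v ⊗ y), (w ⊗ z)) ↦ (v ⊗ w) ⊗ z y`. -/
noncomputable def coactMul (k H V : Type*) [Field k] [Ring H] [HopfAlgebra k H]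
    [AddCommGroup V] [Module k V] :
    V ⊗[k] H →ₗ[k] V ⊗[k] H →ₗ[k] (V ⊗[k] V) ⊗[k] H :=
  TensorProduct.curry (TensorProduct.map LinearMap.id
    (LinearMap.mul' k H ∘ₗ (TensorProduct.comm k H H).toLinearMap) ∘ₗ
    (TensorProduct.tensorTensorTensorComm k V H V H).toLinearMap)

@[simp] theorem coactMul_tmul (v w : V) (y z : H) :
    coactMul k H V (v ⊗ₜ y) (w ⊗ₜ z) = (v ⊗ₜ w) ⊗ₜ (z * y) := by
  simp [coactMul]

theorem diagCoact_tmul (δ : V →ₗ[k] V ⊗[k] H) (v w : V) :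
    diagCoact δ (v ⊗ₜ w) = coactMul k H V (δ v) (δ w) := by
  simp [diagCoact, coactAux, coactMul]

/-- The coaction of w₀ ⊗ w₁·v is w₀ ⊗ (w₂·v)₀ ⊗ (w₂·v)₁w₁ by coassociativity, and compatibility
turns it into w₀ ⊗ w₃·v₀ ⊗ w₄v₁s⁻¹(w₂)w₁. The same collapse as for H-linearity leaves w₀ ⊗ w₁·v₀ ⊗
w₂v₁, which is what the other side gives. -/
theorem IsYetterDrinfeld.diagCoact_ydBraid {ρ : H →ₐ[k] Module.End k V} {δ : V →ₗ[k] V ⊗[k] H}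
    (hyd : IsYetterDrinfeld ρ δ) (x : V ⊗[k] V) :
    diagCoact δ (ydBraid ρ δ x) = LinearMap.rTensor H (ydBraid ρ δ) (diagCoact δ x) := by
  induction x using TensorProduct.induction_on with
  | zero => simp
  | add x y hx hy => simp only [map_add, hx, hy]
  | tmul v w =>
    have hco := LinearMap.congr_fun hyd.coassoc w
    simp only [LinearMap.comp_apply, LinearEquiv.coe_coe] at hco
    -- `G (w ⊗ (a ⊗ b)) = w ⊗ (b · v)₀ ⊗ (b · v)₁ a`
    let G : V ⊗[k] (H ⊗[k] H) →ₗ[k] (V ⊗[k] V) ⊗[k] H :=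
      TensorProduct.lift (coactMul k H V) ∘ₗ
        LinearMap.lTensor (V ⊗[k] H) (δ ∘ₗ ρ.toLinearMap.flip v) ∘ₗ
        (TensorProduct.assoc k V H H).symm.toLinearMap
    have hG : ∀ (w : V) (a b : H), G (w ⊗ₜ (a ⊗ₜ b)) =
        coactMul k H V (w ⊗ₜ a) (ydMap ρ (comul₃ k H b) (δ v)) := by
      intros; simp [G, hyd.compat]
    -- `N t (w ⊗ (b ⊗ c)) = w ⊗ b · t₀ ⊗ c t₁`
    let N : V ⊗[k] H →ₗ[k] V ⊗[k] (H ⊗[k] H) →ₗ[k] (V ⊗[k] V) ⊗[k] H :=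
      LinearMap.flip (TensorProduct.lift
        { toFun := fun w => (sandwich ρ ∘ₗ TensorProduct.mk k H (H ⊗[k] H) 1).compr₂
            ((TensorProduct.assoc k V V H).symm.toLinearMap ∘ₗ TensorProduct.mk k V (V ⊗[k] H) w)
          map_add' := by
            intros; apply LinearMap.ext; intro; apply LinearMap.ext; intro
            simp
          map_smul' := by
            intros; apply LinearMap.ext; intro; apply LinearMap.ext; intro
            simp })
    have hN : ∀ (v w : V) (y b c : H), N (v ⊗ₜ y) (w ⊗ₜ (b ⊗ₜ c)) =
        (w ⊗ₜ ρ b v) ⊗ₜ (c * y) := by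
      intros; simp [N]
    have e1 : ∀ t : V ⊗[k] H, diagCoact δ (swapAct ρ (v ⊗ₜ t)) =
        G (TensorProduct.assoc k V H H (LinearMap.rTensor H δ t)) := by
      intro t
      induction t using TensorProduct.induction_on with
      | zero => simp
      | add t t' h h' => simp only [TensorProduct.tmul_add, map_add, h, h']
      | tmul w c =>
        rw [swapAct_tmul, diagCoact_tmul, LinearMap.rTensor_tmul, hyd.compat]
        generalize δ w = u
        induction u using TensorProduct.induction_on with
        | zero => simp
        | add t t' h h' =>
          simp only [TensorProduct.add_tmul, map_add, LinearMap.add_apply, h, h']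
        | tmul w a => rw [TensorProduct.assoc_tmul, hG]
    -- `G` contains the coaction of b·v and `N` that of v. They agree on the image of id ⊗ Δ, where
    -- a and b are c₁ and c₂, so that the compatibility condition produces the collapsing factor
    -- s⁻¹(c₂)c₁.
    have e2 : ∀ t : V ⊗[k] H, G (LinearMap.lTensor V Coalgebra.comul t) =
        N (δ v) (LinearMap.lTensor V Coalgebra.comul t) := by
      intro t
      induction t using TensorProduct.induction_on with
      | zero => simp
      | add t t' h h' => simp only [map_add, h, h']
      | tmul w c =>
        -- `F u (m ⊗ (b ⊗ c)) = w ⊗ b · u₀ ⊗ c u₁ m`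
        let F : V ⊗[k] H →ₗ[k] H ⊗[k] (H ⊗[k] H) →ₗ[k] (V ⊗[k] V) ⊗[k] H :=
          (sandwich ρ).flip.compr₂
            ((TensorProduct.assoc k V V H).symm.toLinearMap ∘ₗ TensorProduct.mk k V (V ⊗[k] H) w)
        have hF : ∀ (v : V) (y m b c : H), F (v ⊗ₜ y) (m ⊗ₜ (b ⊗ₜ c)) =
            (w ⊗ₜ ρ b v) ⊗ₜ (c * (y * m)) := by
          intros; simp [F]
        have e : ∀ s : H ⊗[k] H, G (w ⊗ₜ s) = F (δ v)
            (LinearMap.rTensor (H ⊗[k] H) (invContract k H)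
              ((TensorProduct.assoc k H H (H ⊗[k] H)).symm
                (LinearMap.lTensor H (comul₃ k H).toLinearMap s))) := by
          intro s
          induction s using TensorProduct.induction_on with
          | zero => simp
          | add t t' h h' => simp only [TensorProduct.tmul_add, map_add, h, h']
          | tmul a b =>
            rw [hG, LinearMap.lTensor_tmul, AlgHom.toLinearMap_apply]
            generalize comul₃ k H b = t
            generalize δ v = u
            induction u using TensorProduct.induction_on with
            | zero => simp
            | add u u' h h' => simp only [map_add, LinearMap.add_apply, h, h']
            | tmul v y =>
              induction t using TensorProduct.induction_on with
              | zero => simp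
              | add t t' h h' =>
                simp only [TensorProduct.tmul_add, map_add, LinearMap.add_apply, h, h']
              | tmul a1 t =>
                induction t using TensorProduct.induction_on with
                | zero => simp
                | add t t' h h' =>
                  simp only [TensorProduct.tmul_add, map_add, LinearMap.add_apply, h, h']
                | tmul b1 c1 => simp [hF, mul_assoc]
        rw [LinearMap.lTensor_tmul, e, invContract_comul]
        generalize Coalgebra.comul (R := k) c = s
        generalize δ v = u
        induction u using TensorProduct.induction_on with
        | zero => simp
        | add u u' h h' => simp only [map_add, LinearMap.add_apply, h, h']
        | tmul v y =>
          induction s using TensorProduct.induction_on with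
          | zero => simp
          | add t t' h h' => simp only [TensorProduct.tmul_add, map_add, h, h']
          | tmul b c => simp [hF, hN]
    have e3 : ∀ (t u : V ⊗[k] H), LinearMap.rTensor H (ydBraid ρ δ) (coactMul k H V u t) =
        N u (TensorProduct.assoc k V H H (LinearMap.rTensor H δ t)) := by
      intro t u
      induction t using TensorProduct.induction_on with
      | zero => simp
      | add t t' h h' => simp only [map_add, h, h']
      | tmul w c =>
        induction u using TensorProduct.induction_on with
        | zero => simp
        | add t t' h h' => simp only [map_add, LinearMap.add_apply, h, h']
        | tmul v y =>
          rw [coactMul_tmul, LinearMap.rTensor_tmul, LinearMap.rTensor_tmul, ydBraid_tmul]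
          generalize δ w = s
          induction s using TensorProduct.induction_on with
          | zero => simp
          | add t t' h h' => simp only [TensorProduct.tmul_add, TensorProduct.add_tmul, map_add, h, h']
          | tmul w a => simp [hN]
    rw [ydBraid_tmul, e1, hco, e2, diagCoact_tmul, e3, hco]

/-- The operator `f ⊗ id` on `V ⊗ (V ⊗ W)`. -/
noncomputable def leftOp (k V W : Type*) [Field k] [AddCommGroup V] [Module k V]
    [AddCommGroup W] [Module k W] :
    Module.End k (V ⊗[k] V) →ₐ[k] Module.End k (V ⊗[k] (V ⊗[k] W)) :=
  ((TensorProduct.assoc k V V W).conjAlgEquiv k).toAlgHom.comp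
    (Module.End.rTensorAlgHom k (V ⊗[k] V) W)

theorem leftOp_tmul {W : Type*} [AddCommGroup W] [Module k W] (f : Module.End k (V ⊗[k] V))
    (u v : V) (w : W) : leftOp k V W f (u ⊗ₜ (v ⊗ₜ w)) =
      TensorProduct.assoc k V V W (f (u ⊗ₜ v) ⊗ₜ w) := by
  rfl

theorem leftOp_assoc {W : Type*} [AddCommGroup W] [Module k W] (f : Module.End k (V ⊗[k] V))
    (x : V ⊗[k] V) (w : W) : leftOp k V W f (TensorProduct.assoc k V V W (x ⊗ₜ w)) =
      TensorProduct.assoc k V V W (f x ⊗ₜ w) := by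
  change TensorProduct.assoc k V V W (LinearMap.rTensor W f ((TensorProduct.assoc k V V W).symm
    (TensorProduct.assoc k V V W (x ⊗ₜ w)))) = _
  rw [LinearEquiv.symm_apply_apply, LinearMap.rTensor_tmul]

/-- Write c₁ and c₂ for the braiding on the first and the last two factors. By coassociativity c₁c₂
moves w past a whole x in V ⊗ V: x ⊗ w ↦ w₀ ⊗ w₁·x. Since c is H-linear, applying c₂ afterwards
gives w₀ ⊗ w₁·c(x), which is c₁c₂ applied to c(x) ⊗ w, that is c₁c₂c₁(x ⊗ w). -/
theorem IsYetterDrinfeld.ydBraid_braid {ρ : H →ₐ[k] Module.End k V} {δ : V →ₗ[k] V ⊗[k] H}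
    (hyd : IsYetterDrinfeld ρ δ) :
    leftOp k V V (ydBraid ρ δ) * LinearMap.lTensor V (ydBraid ρ δ) * leftOp k V V (ydBraid ρ δ) =
      LinearMap.lTensor V (ydBraid ρ δ) * leftOp k V V (ydBraid ρ δ) *
        LinearMap.lTensor V (ydBraid ρ δ) := by
  -- `B x (w ⊗ h) = w ⊗ h · x`
  let B : V ⊗[k] V → V ⊗[k] H →ₗ[k] V ⊗[k] (V ⊗[k] V) := fun x =>
    LinearMap.lTensor V ((diagAct ρ).toLinearMap.flip x)
  have hB : ∀ (x : V ⊗[k] V) (w : V) (h : H), B x (w ⊗ₜ h) = w ⊗ₜ diagAct ρ h x := by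
    intros; simp [B]
  -- The hexagon identity: two successive braidings are one braiding past V ⊗ V with its diagonal
  -- action.
  have key : ∀ (x : V ⊗[k] V) (w : V), leftOp k V V (ydBraid ρ δ)
      (LinearMap.lTensor V (ydBraid ρ δ) (TensorProduct.assoc k V V V (x ⊗ₜ w))) = B x (δ w) := by
    intro x w
    induction x using TensorProduct.induction_on with
    | zero => simp [B]
    | add x y hx hy => simp only [TensorProduct.add_tmul, map_add, hx, hy, B, LinearMap.lTensor_add,
        LinearMap.add_apply]
    | tmul u v =>
      -- `J (w ⊗ (a ⊗ b)) = w ⊗ (a · u ⊗ b · v)`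
      let J : V ⊗[k] (H ⊗[k] H) →ₗ[k] V ⊗[k] (V ⊗[k] V) :=
        LinearMap.lTensor V (TensorProduct.map (ρ.toLinearMap.flip u) (ρ.toLinearMap.flip v))
      have hJ : ∀ (w : V) (a b : H), J (w ⊗ₜ (a ⊗ₜ b)) = w ⊗ₜ (ρ a u ⊗ₜ ρ b v) := by
        intros; simp [J]
      have hco := LinearMap.congr_fun hyd.coassoc w
      simp only [LinearMap.comp_apply, LinearEquiv.coe_coe] at hco
      have e1 : ∀ t : V ⊗[k] H, leftOp k V V (ydBraid ρ δ) (u ⊗ₜ swapAct ρ (v ⊗ₜ t)) =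
          J (TensorProduct.assoc k V H H (LinearMap.rTensor H δ t)) := by
        intro t
        induction t using TensorProduct.induction_on with
        | zero => simp
        | add t t' h h' => simp only [TensorProduct.tmul_add, map_add, h, h']
        | tmul w c =>
          rw [swapAct_tmul, leftOp_tmul, ydBraid_tmul, LinearMap.rTensor_tmul]
          generalize δ w = s
          induction s using TensorProduct.induction_on with
          | zero => simp
          | add t t' h h' =>
            simp only [TensorProduct.tmul_add, TensorProduct.add_tmul, map_add, h, h']
          | tmul w a => simp [hJ]
      have e2 : ∀ t : V ⊗[k] H, J (LinearMap.lTensor V Coalgebra.comul t) = B (u ⊗ₜ v) t := by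
        intro t
        induction t using TensorProduct.induction_on with
        | zero => simp
        | add t t' h h' => simp only [map_add, h, h']
        | tmul w c =>
          rw [hB, LinearMap.lTensor_tmul, diagAct_apply]
          generalize Coalgebra.comul (R := k) c = s
          induction s using TensorProduct.induction_on with
          | zero => simp
          | add t t' h h' =>
            simp only [TensorProduct.tmul_add, map_add, LinearMap.add_apply, h, h']
          | tmul a b =>
            simp [hJ]
            rfl
      rw [TensorProduct.assoc_tmul, LinearMap.lTensor_tmul, ydBraid_tmul, e1, hco, e2]
  -- This is the H-linearity of the braiding, applied under the factor w₀.
  have key2 : ∀ (x : V ⊗[k] V) (t : V ⊗[k] H),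
      LinearMap.lTensor V (ydBraid ρ δ) (B x t) = B (ydBraid ρ δ x) t := by
    intro x t
    induction t using TensorProduct.induction_on with
    | zero => simp
    | add t t' h h' => simp only [map_add, h, h']
    | tmul w c => rw [hB, hB, LinearMap.lTensor_tmul, hyd.ydBraid_diagAct]
  apply TensorProduct.ext'
  intro u y
  induction y using TensorProduct.induction_on with
  | zero => simp
  | add t t' h h' => simp only [TensorProduct.tmul_add, map_add, h, h']
  | tmul v w =>
    simp only [Module.End.mul_apply]
    rw [← TensorProduct.assoc_tmul, leftOp_assoc, key, key, key2]

end YetterDrinfeldBraiding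

end DrinfeldDouble

/-! ### Coassociativity of the comultiplication of D(H). -/

namespace DrinfeldDouble

section Coassoc

variable {k H : Type*} [Field k] [Ring H] [HopfAlgebra k H] [BijectiveAntipode k H]

theorem induction_pure {P : DrinfeldDouble k H → Prop} (h0 : P 0)
    (hp : ∀ p h, P (ofDual k H p * ofHopf k H h)) (hadd : ∀ X Y, P X → P Y → P (X + Y))
    (X : DrinfeldDouble k H) : P X := by
  have : ∀ t : ConvDual k H ⊗[k] H, P (toTensor.symm t) := by
    intro t
    induction t using TensorProduct.induction_on with
    | zero => rw [map_zero]; exact h0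
    | add t t' h h' => rw [map_add]; exact hadd _ _ h h'
    | tmul p h => exact ofDual_mul_ofHopf p h ▸ hp p h
  simpa using this (toTensor X)

theorem algHom_ext {A : Type*} [Ring A] [Algebra k A] {f g : DrinfeldDouble k H →ₐ[k] A}
    (hH : ∀ h, f (ofHopf k H h) = g (ofHopf k H h))
    (hD : ∀ p, f (ofDual k H p) = g (ofDual k H p)) : f = g := by
  ext X
  induction X using induction_pure with
  | h0 => simp
  | hp p h => rw [map_mul, map_mul, hH, hD]
  | hadd X Y hX hY => rw [map_add, map_add, hX, hY]

variable [Module.Finite k H]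

theorem comul_ofHopf (h : H) : comul k H (ofHopf k H h) =
    Algebra.TensorProduct.map (ofHopf k H) (ofHopf k H) (Coalgebra.comul h) := by
  change comulLin k H (1 ⊗ₜ h) = _
  rw [comulLin_tmul, map_one, one_mul]
  rfl

theorem comul_ofDual (p : ConvDual k H) : comul k H (ofDual k H p) =
    Algebra.TensorProduct.map (ofDual k H) (ofDual k H)
      (TensorProduct.comm k _ _ (dualComul k H p)) := by
  change comulLin k H (p ⊗ₜ 1) = _
  rw [comulLin_tmul, map_one, mul_one]
  rfl

/-- The pairing `(p ⊗ (q ⊗ r))(x ⊗ (y ⊗ z)) = p(x) q(y) r(z)`. -/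
noncomputable def pairing₃ : ConvDual k H ⊗[k] (ConvDual k H ⊗[k] ConvDual k H) →ₗ[k]
    (H ⊗[k] (H ⊗[k] H) →ₗ[k] k) :=
  TensorProduct.dualDistrib k H (H ⊗[k] H) ∘ₗ
    TensorProduct.map (ConvDual.toLin k H).toLinearMap pairing

@[simp] theorem pairing₃_tmul (p : ConvDual k H) (s : ConvDual k H ⊗[k] ConvDual k H) (x : H)
    (y : H ⊗[k] H) : pairing₃ (p ⊗ₜ[k] s) (x ⊗ₜ y) = p x * pairing s y := rfl

/-- For finite-dimensional spaces the canonical map from a tensor product of duals to the dual of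
the tensor product is bijective. Identities in the threefold tensor power of the dual can therefore
be tested on pure tensors x ⊗ y ⊗ z. -/
theorem pairing₃_injective : Function.Injective (pairing₃ (k := k) (H := H)) := by
  have h1 : Function.Injective (TensorProduct.dualDistrib k H (H ⊗[k] H)) :=
    (TensorProduct.dualDistribEquiv k H (H ⊗[k] H)).injective
  have h2 : Function.Injective
      (TensorProduct.map (ConvDual.toLin k H).toLinearMap (pairing (k := k) (H := H))) :=
    TensorProduct.map_injective_of_flat_flat _ _ (ConvDual.toLin k H).injective pairing_injective
  exact h1.comp h2

/-- Paired with x ⊗ y ⊗ z, one side gives p((xy)z) and the other p(x(yz)). -/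
theorem dualComul_coassoc (p : ConvDual k H) :
    TensorProduct.assoc k _ _ _ (LinearMap.rTensor _ (dualComul k H) (dualComul k H p)) =
      LinearMap.lTensor _ (dualComul k H) (dualComul k H p) := by
  apply pairing₃_injective
  apply TensorProduct.ext'
  intro x y
  induction y using TensorProduct.induction_on with
  | zero => simp
  | add t t' h h' => simp only [TensorProduct.tmul_add, map_add, h, h']
  | tmul y z =>
    have e1 : ∀ s : ConvDual k H ⊗[k] ConvDual k H, pairing₃ (TensorProduct.assoc k _ _ _
        (LinearMap.rTensor _ (dualComul k H) s)) (x ⊗ₜ (y ⊗ₜ z)) = pairing s ((x * y) ⊗ₜ z) := by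
      intro s
      induction s using TensorProduct.induction_on with
      | zero => simp
      | add t t' h h' => simp only [map_add, LinearMap.add_apply, h, h']
      | tmul p q =>
        rw [LinearMap.rTensor_tmul, pairing_tmul, ← pairing_dualComul]
        generalize dualComul k H p = u
        induction u using TensorProduct.induction_on with
        | zero => simp
        | add t t' h h' =>
          simp only [TensorProduct.add_tmul, map_add, LinearMap.add_apply, h, h', add_mul]
        | tmul a b => simp [mul_assoc]
    have e2 : ∀ s : ConvDual k H ⊗[k] ConvDual k H, pairing₃
        (LinearMap.lTensor _ (dualComul k H) s) (x ⊗ₜ (y ⊗ₜ z)) = pairing s (x ⊗ₜ (y * z)) := by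
      intro s
      induction s using TensorProduct.induction_on with
      | zero => simp
      | add t t' h h' => simp only [map_add, LinearMap.add_apply, h, h']
      | tmul p q => simp
    rw [e1, e2, pairing_dualComul, pairing_dualComul, mul_assoc]

/-- Both sides are algebra homomorphisms in X, so it suffices to compare them on H and on its dual,
which generate D(H). On the dual the comultiplication of D(H) is the opposite one; this reverses the
three factors and interchanges the two sides of `dualComul_coassoc`. -/
theorem comul_coassoc (X : DrinfeldDouble k H) :
    Algebra.TensorProduct.assoc k k k _ _ _
        (Algebra.TensorProduct.map (comul k H) (AlgHom.id k _) (comul k H X)) =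
      Algebra.TensorProduct.map (AlgHom.id k _) (comul k H) (comul k H X) := by
  have : ((Algebra.TensorProduct.assoc k k k (DrinfeldDouble k H) (DrinfeldDouble k H)
        (DrinfeldDouble k H)).toAlgHom.comp
      (Algebra.TensorProduct.map (comul k H) (AlgHom.id k _))).comp (comul k H) =
      (Algebra.TensorProduct.map (AlgHom.id k _) (comul k H)).comp (comul k H) := by
    apply algHom_ext
    · intro h
      simp only [AlgHom.comp_apply, comul_ofHopf]
      have hco := Coalgebra.coassoc_apply (R := k) h
      let F : H ⊗[k] (H ⊗[k] H) →ₗ[k] _ := TensorProduct.map (ofHopf k H).toLinearMap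
        (TensorProduct.map (ofHopf k H).toLinearMap (ofHopf k H).toLinearMap)
      have e1 : ∀ s : H ⊗[k] H, (Algebra.TensorProduct.assoc k k k (DrinfeldDouble k H)
          (DrinfeldDouble k H) (DrinfeldDouble k H))
          (Algebra.TensorProduct.map (comul k H) (AlgHom.id k _)
            (Algebra.TensorProduct.map (ofHopf k H) (ofHopf k H) s)) =
          F (TensorProduct.assoc k H H H (LinearMap.rTensor H Coalgebra.comul s)) := by
        intro s
        induction s using TensorProduct.induction_on with
        | zero => simp
        | add t t' h h' => simp only [map_add, h, h']
        | tmul a b =>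
          simp only [Algebra.TensorProduct.map_tmul, AlgHom.coe_id, id_eq, comul_ofHopf,
            LinearMap.rTensor_tmul]
          generalize Coalgebra.comul (R := k) a = u
          induction u using TensorProduct.induction_on with
          | zero => simp
          | add t t' h h' => simp only [TensorProduct.add_tmul, map_add, h, h']
          | tmul a b => simp [F]
      have e2 : ∀ s : H ⊗[k] H, (Algebra.TensorProduct.map (AlgHom.id k _) (comul k H)
            (Algebra.TensorProduct.map (ofHopf k H) (ofHopf k H) s)) =
          F (LinearMap.lTensor H Coalgebra.comul s) := by
        intro s
        induction s using TensorProduct.induction_on with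
        | zero => simp
        | add t t' h h' => simp only [map_add, h, h']
        | tmul a b =>
          simp only [Algebra.TensorProduct.map_tmul, AlgHom.coe_id, id_eq, comul_ofHopf,
            LinearMap.lTensor_tmul]
          rfl
      rw [e2, ← hco, ← e1]
      rfl
    · intro p
      simp only [AlgHom.comp_apply, comul_ofDual]
      -- `F (p ⊗ (q ⊗ r)) = r ⊗ (q ⊗ p)`
      let F : ConvDual k H ⊗[k] (ConvDual k H ⊗[k] ConvDual k H) →ₗ[k] _ :=
        (TensorProduct.assoc k (DrinfeldDouble k H) (DrinfeldDouble k H)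
          (DrinfeldDouble k H)).toLinearMap ∘ₗ
        (TensorProduct.comm k (DrinfeldDouble k H)
          (DrinfeldDouble k H ⊗[k] DrinfeldDouble k H)).toLinearMap ∘ₗ
        TensorProduct.map (ofDual k H).toLinearMap
          (TensorProduct.map (ofDual k H).toLinearMap (ofDual k H).toLinearMap ∘ₗ
            (TensorProduct.comm k (ConvDual k H) (ConvDual k H)).toLinearMap)
      have hF : ∀ p q r : ConvDual k H, F (p ⊗ₜ (q ⊗ₜ r)) =
          ofDual k H r ⊗ₜ (ofDual k H q ⊗ₜ ofDual k H p) := by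
        intros; simp [F]
      have e1 : ∀ s : ConvDual k H ⊗[k] ConvDual k H,
          (Algebra.TensorProduct.assoc k k k (DrinfeldDouble k H)
          (DrinfeldDouble k H) (DrinfeldDouble k H))
          (Algebra.TensorProduct.map (comul k H) (AlgHom.id k _)
            (Algebra.TensorProduct.map (ofDual k H) (ofDual k H)
              (TensorProduct.comm k _ _ s))) =
          F (LinearMap.lTensor _ (dualComul k H) s) := by
        intro s
        induction s using TensorProduct.induction_on with
        | zero => simp
        | add t t' h h' => simp only [map_add, h, h']
        | tmul a b =>
          simp only [TensorProduct.comm_tmul, Algebra.TensorProduct.map_tmul, AlgHom.coe_id, id_eq,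
            comul_ofDual, LinearMap.lTensor_tmul]
          generalize dualComul k H b = u
          induction u using TensorProduct.induction_on with
          | zero => simp
          | add t t' h h' =>
            simp only [TensorProduct.add_tmul, TensorProduct.tmul_add, map_add, h, h']
          | tmul a b => simp [hF]
      have e2 : ∀ s : ConvDual k H ⊗[k] ConvDual k H,
          (Algebra.TensorProduct.map (AlgHom.id k _) (comul k H)
            (Algebra.TensorProduct.map (ofDual k H) (ofDual k H)
              (TensorProduct.comm k _ _ s))) =
          F (TensorProduct.assoc k _ _ _ (LinearMap.rTensor _ (dualComul k H) s)) := by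
        intro s
        induction s using TensorProduct.induction_on with
        | zero => simp
        | add t t' h h' => simp only [map_add, h, h']
        | tmul a b =>
          simp only [TensorProduct.comm_tmul, Algebra.TensorProduct.map_tmul, AlgHom.coe_id, id_eq,
            comul_ofDual, LinearMap.rTensor_tmul]
          generalize dualComul k H a = u
          induction u using TensorProduct.induction_on with
          | zero => simp
          | add t t' h h' =>
            simp only [TensorProduct.add_tmul, TensorProduct.tmul_add, map_add, h, h']
          | tmul a b => simp [hF]
      rw [e2, dualComul_coassoc, ← e1]
      rfl
  exact AlgHom.congr_fun this X

end Coassoc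

/-! ### Modules over D(H): tensor products, the braiding and its naturality. -/

section Representations

variable {k H : Type*} [Field k] [Ring H] [HopfAlgebra k H] [BijectiveAntipode k H]
  {U V W V' W' : Type*} [AddCommGroup U] [Module k U] [AddCommGroup V] [Module k V]
  [AddCommGroup W] [Module k W] [AddCommGroup V'] [Module k V'] [AddCommGroup W'] [Module k W']

/-- `f` commutes with the actions `ρ` and `σ` of `D(H)`. -/
def Intertwines (ρ : DrinfeldDouble k H →ₐ[k] Module.End k V)
    (σ : DrinfeldDouble k H →ₐ[k] Module.End k W) (f : V →ₗ[k] W) : Prop :=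
  ∀ X v, f (ρ X v) = σ X (f v)

theorem Intertwines.id (ρ : DrinfeldDouble k H →ₐ[k] Module.End k V) :
    Intertwines ρ ρ LinearMap.id := fun _ _ => rfl

theorem Intertwines.comp {ρ : DrinfeldDouble k H →ₐ[k] Module.End k V}
    {σ : DrinfeldDouble k H →ₐ[k] Module.End k W} {τ : DrinfeldDouble k H →ₐ[k] Module.End k U}
    {f : V →ₗ[k] W} {g : W →ₗ[k] U} (hg : Intertwines σ τ g) (hf : Intertwines ρ σ f) :
    Intertwines ρ τ (g ∘ₗ f) := by
  intro X v
  rw [LinearMap.comp_apply, hf, hg, LinearMap.comp_apply]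

theorem Intertwines.symm {ρ : DrinfeldDouble k H →ₐ[k] Module.End k V}
    {σ : DrinfeldDouble k H →ₐ[k] Module.End k W} {f : V ≃ₗ[k] W}
    (hf : Intertwines ρ σ f.toLinearMap) : Intertwines σ ρ f.symm.toLinearMap := by
  intro X v
  apply f.injective
  have := hf X (f.symm v)
  simp only [LinearEquiv.coe_coe, LinearEquiv.apply_symm_apply] at this ⊢
  exact this.symm

variable [Module.Finite k H]

/-- The action of `D(H)` on a tensor product through its comultiplication. -/
noncomputable def tensorAct (ρ : DrinfeldDouble k H →ₐ[k] Module.End k V)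
    (σ : DrinfeldDouble k H →ₐ[k] Module.End k W) :
    DrinfeldDouble k H →ₐ[k] Module.End k (V ⊗[k] W) :=
  (Module.endTensorEndAlgHom.comp (Algebra.TensorProduct.map ρ σ)).comp (comul k H)

theorem tensorAct_apply (ρ : DrinfeldDouble k H →ₐ[k] Module.End k V)
    (σ : DrinfeldDouble k H →ₐ[k] Module.End k W) (X : DrinfeldDouble k H) :
    tensorAct ρ σ X = Module.endTensorEndAlgHom (R := k) (S := k) (A := k)
      (Algebra.TensorProduct.map ρ σ (comul k H X)) := rfl

theorem Intertwines.map {ρ : DrinfeldDouble k H →ₐ[k] Module.End k V}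
    {σ : DrinfeldDouble k H →ₐ[k] Module.End k W} {ρ' : DrinfeldDouble k H →ₐ[k] Module.End k V'}
    {σ' : DrinfeldDouble k H →ₐ[k] Module.End k W'} {f : V →ₗ[k] W} {g : V' →ₗ[k] W'}
    (hf : Intertwines ρ σ f) (hg : Intertwines ρ' σ' g) :
    Intertwines (tensorAct ρ ρ') (tensorAct σ σ') (TensorProduct.map f g) := by
  intro X v
  rw [tensorAct_apply, tensorAct_apply]
  generalize comul k H X = s
  induction s using TensorProduct.induction_on with
  | zero => simp
  | add t t' h h' => simp only [map_add, LinearMap.add_apply, h, h']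
  | tmul X Y =>
    induction v using TensorProduct.induction_on with
    | zero => simp
    | add t t' h h' => simp only [map_add, h, h']
    | tmul v w =>
      change f (ρ X v) ⊗ₜ[k] g (ρ' Y w) = σ X (f v) ⊗ₜ σ' Y (g w)
      rw [hf, hg]

/-- This is the coassociativity of D(H). It makes it possible to move an operator on V ⊗ V to the
front of a tensor power that is nested to the right. -/
theorem intertwines_assoc (ρ : DrinfeldDouble k H →ₐ[k] Module.End k U)
    (σ : DrinfeldDouble k H →ₐ[k] Module.End k V) (τ : DrinfeldDouble k H →ₐ[k] Module.End k W) :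
    Intertwines (tensorAct (tensorAct ρ σ) τ) (tensorAct ρ (tensorAct σ τ))
      (TensorProduct.assoc k U V W).toLinearMap := by
  intro X v
  have hco := comul_coassoc X
  let F : DrinfeldDouble k H ⊗[k] (DrinfeldDouble k H ⊗[k] DrinfeldDouble k H) →ₗ[k]
      Module.End k (U ⊗[k] (V ⊗[k] W)) :=
    (Module.endTensorEndAlgHom (R := k) (S := k) (A := k)).toLinearMap ∘ₗ
      TensorProduct.map ρ.toLinearMap ((Module.endTensorEndAlgHom (R := k) (S := k)
        (A := k)).toLinearMap ∘ₗ TensorProduct.map σ.toLinearMap τ.toLinearMap)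
  have e1 : ∀ s, TensorProduct.assoc k U V W (Module.endTensorEndAlgHom (R := k) (S := k) (A := k)
        (Algebra.TensorProduct.map (tensorAct ρ σ) τ s) v) =
      F (Algebra.TensorProduct.assoc k k k _ _ _
        (Algebra.TensorProduct.map (comul k H) (AlgHom.id k _) s))
        (TensorProduct.assoc k U V W v) := by
    intro s
    induction s using TensorProduct.induction_on with
    | zero => simp
    | add t t' h h' => simp only [map_add, LinearMap.add_apply, h, h']
    | tmul X Y =>
      rw [Algebra.TensorProduct.map_tmul, Algebra.TensorProduct.map_tmul, tensorAct_apply]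
      generalize comul k H X = t
      induction t using TensorProduct.induction_on with
      | zero => simp
      | add t t' h h' =>
        simp only [map_add, TensorProduct.add_tmul, LinearMap.add_apply, h, h']
      | tmul X X' =>
        induction v using TensorProduct.induction_on with
        | zero => simp
        | add t t' h h' => simp only [map_add, h, h']
        | tmul v w =>
          induction v using TensorProduct.induction_on with
          | zero => simp
          | add t t' h h' => simp only [map_add, TensorProduct.add_tmul, h, h']
          | tmul u v => rfl
  have e2 : ∀ s, Module.endTensorEndAlgHom (R := k) (S := k) (A := k)
        (Algebra.TensorProduct.map ρ (tensorAct σ τ) s) =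
      F (Algebra.TensorProduct.map (AlgHom.id k _) (comul k H) s) := by
    intro s
    induction s using TensorProduct.induction_on with
    | zero => simp
    | add t t' h h' => simp only [map_add, h, h']
    | tmul X Y => rfl
  rw [tensorAct_apply, tensorAct_apply, e2, ← hco]
  exact e1 _

/-- The braiding `τ ∘ (ρ ⊗ ρ)(R)` on `V ⊗ V`. -/
noncomputable def braidOf (ρ : DrinfeldDouble k H →ₐ[k] Module.End k V) :
    V ⊗[k] V →ₗ[k] V ⊗[k] V :=
  (TensorProduct.comm k V V).toLinearMap ∘ₗ
    Module.endTensorEndAlgHom (R := k) (S := k) (A := k)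
      (TensorProduct.map ρ.toLinearMap ρ.toLinearMap (universalR k H))

/-- The universal R-matrix acts through elements of D(H), and f ⊗ f commutes with these as well as
with the flip. -/
theorem braidOf_map {ρ : DrinfeldDouble k H →ₐ[k] Module.End k V}
    {σ : DrinfeldDouble k H →ₐ[k] Module.End k W} {f : V →ₗ[k] W} (hf : Intertwines ρ σ f)
    (x : V ⊗[k] V) : braidOf σ (TensorProduct.map f f x) = TensorProduct.map f f (braidOf ρ x) := by
  simp only [braidOf, LinearMap.comp_apply, LinearEquiv.coe_coe]
  generalize universalR k H = s
  induction s using TensorProduct.induction_on with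
  | zero => simp
  | add t t' h h' => simp only [map_add, LinearMap.add_apply, h, h']
  | tmul X Y =>
    induction x using TensorProduct.induction_on with
    | zero => simp
    | add t t' h h' => simp only [map_add, h, h']
    | tmul v w =>
      change σ Y (f w) ⊗ₜ[k] σ X (f v) = f (ρ Y w) ⊗ₜ[k] f (ρ X v)
      rw [hf, hf]

/-- The hypothesis concerns the single vector w: the tensor t only has to record how the dual of H
acts on this w. The braiding of a submodule can thus be computed vector by vector, without
constructing a coaction on it. -/
theorem braidOf_tmul (ρ : DrinfeldDouble k H →ₐ[k] Module.End k V) (v : V) {w : V}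
    {t : V ⊗[k] H} (ht : ∀ p, ρ (ofDual k H p) w = TensorProduct.rid k V
      (LinearMap.lTensor V (ConvDual.toLin k H p) t)) :
    braidOf ρ (v ⊗ₜ w) = swapAct (ρ.comp (ofHopf k H)) (v ⊗ₜ t) := by
  have e : braidOf ρ (v ⊗ₜ w) = ∑ i, ρ (ofDual k H ((ConvDual.toLin k H).symm
      ((Module.Basis.ofVectorSpace k H).coord i))) w ⊗ₜ[k]
        ρ (ofHopf k H (Module.Basis.ofVectorSpace k H i)) v := by
    rw [braidOf, universalR, coevaluation_apply_one]
    simp only [map_sum, LinearMap.comp_apply, LinearMap.sum_apply]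
    rfl
  rw [e]
  simp only [ht]
  clear e ht
  induction t using TensorProduct.induction_on with
  | zero => simp
  | add t t' h h' =>
    simp only [map_add, TensorProduct.add_tmul, TensorProduct.tmul_add, Finset.sum_add_distrib,
      h, h']
  | tmul w h =>
    rw [swapAct_tmul]
    -- The dual-basis identity h = Σ h^i(h) h_i absorbs the sum defining the R-matrix.
    conv_rhs => rw [← (Module.Basis.ofVectorSpace k H).sum_repr h]
    simp [TensorProduct.smul_tmul, TensorProduct.tmul_sum]

section YetterDrinfeld

variable {ρ : H →ₐ[k] Module.End k V} {δ : V →ₗ[k] V ⊗[k] H} (hyd : IsYetterDrinfeld ρ δ)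

omit [Module.Finite k H] in
theorem act_ofHopf (h : H) : act ρ δ hyd (ofHopf k H h) = ρ h := by
  change act ρ δ hyd (pure 1 h) = _
  rw [act_pure, hyd.dualAct_one, one_mul]

omit [Module.Finite k H] in
theorem act_ofDual (p : ConvDual k H) : act ρ δ hyd (ofDual k H p) = dualAct δ p := by
  change act ρ δ hyd (pure p 1) = _
  rw [act_pure, map_one, mul_one]

/-- Here the coaction δ w itself serves as the tensor recording the action of the dual on w. -/
theorem braidOf_act : braidOf (act ρ δ hyd) = ydBraid ρ δ := by
  apply TensorProduct.ext'
  intro v w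
  rw [braidOf_tmul (act ρ δ hyd) v (t := δ w) fun p => LinearMap.congr_fun (act_ofDual hyd p) w,
    ydBraid_tmul]
  congr 2
  ext1 h
  exact act_ofHopf hyd h

theorem tensorAct_act_ofHopf (h : H) :
    tensorAct (act ρ δ hyd) (act ρ δ hyd) (ofHopf k H h) = diagAct ρ h := by
  rw [tensorAct_apply, comul_ofHopf, diagAct_apply]
  generalize Coalgebra.comul (R := k) h = s
  induction s using TensorProduct.induction_on with
  | zero => simp
  | add t t' h h' => simp only [map_add, h, h']
  | tmul a b => simp only [Algebra.TensorProduct.map_tmul, act_ofHopf]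

/-- Because Δ(p) = Σ p₂ ⊗ p₁ in D(H), the form p acts on v ⊗ w by p₁(w₁)p₂(v₁) = p(w₁v₁). This is
why the codiagonal coaction carries the product w₁v₁ in this order. -/
theorem tensorAct_act_ofDual (p : ConvDual k H) :
    tensorAct (act ρ δ hyd) (act ρ δ hyd) (ofDual k H p) = dualAct (diagCoact δ) p := by
  rw [tensorAct_apply, comul_ofDual]
  apply TensorProduct.ext'
  intro v w
  have e1 : ∀ s : ConvDual k H ⊗[k] ConvDual k H,
      Module.endTensorEndAlgHom (R := k) (S := k) (A := k) (Algebra.TensorProduct.map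
        (act ρ δ hyd) (act ρ δ hyd) (Algebra.TensorProduct.map (ofDual k H) (ofDual k H)
          (TensorProduct.comm k _ _ s))) (v ⊗ₜ w) =
      TensorProduct.rid k (V ⊗[k] V) (TensorProduct.map LinearMap.id
        (pairing s ∘ₗ (TensorProduct.comm k H H).toLinearMap)
        (TensorProduct.tensorTensorTensorComm k V H V H (δ v ⊗ₜ δ w))) := by
    intro s
    induction s using TensorProduct.induction_on with
    | zero => simp
    | add t t' h h' =>
      simp only [map_add, LinearMap.add_apply, h, h', LinearMap.add_comp, TensorProduct.map_add_right]
    | tmul p q =>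
      simp only [TensorProduct.comm_tmul, Algebra.TensorProduct.map_tmul]
      change act ρ δ hyd (ofDual k H q) v ⊗ₜ[k] act ρ δ hyd (ofDual k H p) w = _
      rw [act_ofDual, act_ofDual, dualAct_apply, dualAct_apply]
      generalize δ v = x
      generalize δ w = y
      induction x using TensorProduct.induction_on with
      | zero => simp
      | add t t' h h' => simp only [map_add, TensorProduct.add_tmul, h, h']
      | tmul v a =>
        induction y using TensorProduct.induction_on with
        | zero => simp
        | add t t' h h' => simp only [map_add, TensorProduct.tmul_add, h, h']
        | tmul w b => simp [TensorProduct.smul_tmul, smul_smul]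
  rw [e1, dualAct_apply, diagCoact_tmul]
  generalize δ v = x
  generalize δ w = y
  induction x using TensorProduct.induction_on with
  | zero => simp
  | add t t' h h' => simp only [map_add, TensorProduct.add_tmul, LinearMap.add_apply, h, h']
  | tmul v a =>
    induction y using TensorProduct.induction_on with
    | zero => simp
    | add t t' h h' => simp only [map_add, TensorProduct.tmul_add, h, h']
    | tmul w b => simp

/-- D(H) is spanned by products of an element of the dual with an element of H. Linearity over the
first kind is H-colinearity of the braiding, over the second kind H-linearity. -/
theorem intertwines_braidOf_act :
    Intertwines (tensorAct (act ρ δ hyd) (act ρ δ hyd)) (tensorAct (act ρ δ hyd) (act ρ δ hyd))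
      (braidOf (act ρ δ hyd)) := by
  intro X v
  rw [braidOf_act]
  induction X using induction_pure generalizing v with
  | h0 => simp
  | hadd X Y hX hY => simp only [map_add, LinearMap.add_apply, hX, hY]
  | hp p h =>
    rw [map_mul, Module.End.mul_apply, Module.End.mul_apply, tensorAct_act_ofHopf,
      tensorAct_act_ofDual, ← hyd.ydBraid_diagAct]
    generalize diagAct ρ h v = x
    -- The dual acts by evaluating the H-component of the coaction, so a colinear map commutes with
    -- every p.
    rw [dualAct_apply, dualAct_apply, hyd.diagCoact_ydBraid x]
    generalize diagCoact δ x = t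
    induction t using TensorProduct.induction_on with
    | zero => simp
    | add t t' h h' => simp only [map_add, h, h']
    | tmul v a => simp

end YetterDrinfeld

section Embedding

variable {ρ : DrinfeldDouble k H →ₐ[k] Module.End k V}
    {σ : DrinfeldDouble k H →ₐ[k] Module.End k W} {f : V →ₗ[k] W}

/-- By naturality f ⊗ f carries both sides to the corresponding expressions on W ⊗ W, and f ⊗ f is
injective since vector spaces are flat. -/
theorem intertwines_braidOf_of_injective (hf : Intertwines ρ σ f) (hinj : Function.Injective f)
    (hσ : Intertwines (tensorAct σ σ) (tensorAct σ σ) (braidOf σ)) :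
    Intertwines (tensorAct ρ ρ) (tensorAct ρ ρ) (braidOf ρ) := by
  intro X v
  apply TensorProduct.map_injective_of_flat_flat f f hinj hinj
  rw [← braidOf_map hf, hf.map hf, hσ, hf.map hf, braidOf_map hf]

/-- The threefold tensor power of f is injective and carries the braidings on V in positions one and
two to those on W, so the braid equation is inherited. -/
theorem braid_of_injective (hf : Intertwines ρ σ f) (hinj : Function.Injective f)
    (hσ : leftOp k W W (braidOf σ) * LinearMap.lTensor W (braidOf σ) * leftOp k W W (braidOf σ) =
      LinearMap.lTensor W (braidOf σ) * leftOp k W W (braidOf σ) *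
        LinearMap.lTensor W (braidOf σ)) :
    leftOp k V V (braidOf ρ) * LinearMap.lTensor V (braidOf ρ) * leftOp k V V (braidOf ρ) =
      LinearMap.lTensor V (braidOf ρ) * leftOp k V V (braidOf ρ) *
        LinearMap.lTensor V (braidOf ρ) := by
  have hinj3 : Function.Injective (TensorProduct.map f (TensorProduct.map f f)) :=
    TensorProduct.map_injective_of_flat_flat _ _ hinj
      (TensorProduct.map_injective_of_flat_flat f f hinj hinj)
  have h1 : ∀ x, TensorProduct.map f (TensorProduct.map f f) (leftOp k V V (braidOf ρ) x) =
      leftOp k W W (braidOf σ) (TensorProduct.map f (TensorProduct.map f f) x) := by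
    intro x
    obtain ⟨x, rfl⟩ := (TensorProduct.assoc k V V V).surjective x
    induction x using TensorProduct.induction_on with
    | zero => simp
    | add t t' h h' => simp only [map_add, h, h']
    | tmul x v =>
      have e : ∀ (y : V ⊗[k] V) (v : V), TensorProduct.map f (TensorProduct.map f f)
          (TensorProduct.assoc k V V V (y ⊗ₜ v)) =
          TensorProduct.assoc k W W W (TensorProduct.map f f y ⊗ₜ f v) := by
        intro y v
        induction y using TensorProduct.induction_on with
        | zero => simp
        | add t t' h h' => simp only [map_add, TensorProduct.add_tmul, h, h']
        | tmul a b => simp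
      rw [leftOp_assoc, e, e, leftOp_assoc, braidOf_map hf]
  have h2 : ∀ x, TensorProduct.map f (TensorProduct.map f f) (LinearMap.lTensor V (braidOf ρ) x) =
      LinearMap.lTensor W (braidOf σ) (TensorProduct.map f (TensorProduct.map f f) x) := by
    intro x
    induction x using TensorProduct.induction_on with
    | zero => simp
    | add t t' h h' => simp only [map_add, h, h']
    | tmul v x => simp [braidOf_map hf]
  apply LinearMap.ext
  intro x
  apply hinj3
  simp only [Module.End.mul_apply, h1, h2]
  exact LinearMap.congr_fun hσ _

end Embedding

end Representations

/-! ### D(H)-linearity of the operators on tensor powers. -/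

namespace Mod

universe u

variable {k H : Type u} [Field k] [Ring H] [HopfAlgebra k H] [BijectiveAntipode k H]

theorem mem_endAlg_iff {V : Mod k H} {f : Module.End k V.carrier} :
    f ∈ V.endAlg ↔ Intertwines V.ρ V.ρ f := by
  rw [endAlg, Subalgebra.mem_centralizer_iff]
  constructor
  · intro h X v
    exact (LinearMap.congr_fun (h _ ⟨X, rfl⟩) v).symm
  · rintro h _ ⟨X, rfl⟩
    ext v
    exact (h X v).symm

variable [Module.Finite k H]

/-- The operator in the first position is R_V ⊗ id conjugated by the associator, which is
D(H)-linear; every other position is reached by tensoring with the identity of V on the left. -/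
theorem intertwines_braidAt (V : Mod k H)
    (hV : Intertwines (tensorAct V.ρ V.ρ) (tensorAct V.ρ V.ρ) (braidOf V.ρ)) (r i : ℕ) :
    Intertwines (V.tpow r).ρ (V.tpow r).ρ (V.braidAt r i) := by
  induction r generalizing i with
  | zero => exact Intertwines.id _
  | succ r ih =>
    match r, i with
    -- In length at most one, and therefore at every position out of range, `braidAt` is the
    -- identity. This is why the statement needs no bound on i.
    | 0, _ => exact Intertwines.id _
    | r + 1, 0 =>
      exact (intertwines_assoc V.ρ V.ρ (V.tpow r).ρ).comp
        ((hV.map (Intertwines.id (V.tpow r).ρ)).comp (intertwines_assoc V.ρ V.ρ (V.tpow r).ρ).symm)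
    | r + 1, i + 1 => exact (Intertwines.id V.ρ).map (ih i)

end Mod

end DrinfeldDouble

/-! ### The Birman–Murakami–Wenzl relations in terms of Q = T² − ωT − 1. -/

namespace BMW

section Relations

variable {k A A' : Type*} [Field k] [Ring A] [Algebra k A] [Ring A'] [Algebra k A']

/-- The quadratic expression `T² - ω T - 1`. -/
def quad (ω : k) (T : A) : A := T * T - ω • T - 1

/-- The relation `T (T² - ω T - 1) = u (T² - ω T - 1)`. -/
def IsCubic (ω u : k) (T : A) : Prop := T * quad ω T = u • quad ω T

/-- The relations between neighbouring generators of the Birman–Murakami–Wenzl algebra, in terms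
of the quadratic expressions `T² - ω T - 1`. -/
structure IsAdjacent (ω u : k) (T T' : A) : Prop where
  braid : T * T' * T = T' * T * T'
  left : quad ω T * T' * quad ω T = -ω • quad ω T
  right : quad ω T' * T * quad ω T' = -ω • quad ω T'
  quad_left : quad ω T * quad ω T' * quad ω T = (ω * u) ^ 2 • quad ω T
  quad_right : quad ω T' * quad ω T * quad ω T' = (ω * u) ^ 2 • quad ω T'

theorem map_quad (f : A →ₐ[k] A') (ω : k) (T : A) : f (quad ω T) = quad ω (f T) := by
  simp [quad]

theorem IsCubic.map {ω u : k} {T : A} (h : IsCubic ω u T) (f : A →ₐ[k] A') :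
    IsCubic ω u (f T) := by
  rw [IsCubic, ← map_quad, ← map_mul, h, map_smul]

theorem IsAdjacent.map {ω u : k} {T T' : A} (h : IsAdjacent ω u T T') (f : A →ₐ[k] A') :
    IsAdjacent ω u (f T) (f T') where
  braid := by simp only [← map_mul, h.braid]
  left := by simp only [← map_mul, ← map_smul, ← map_quad, h.left]
  right := by simp only [← map_mul, ← map_smul, ← map_quad, h.right]
  quad_left := by simp only [← map_mul, ← map_smul, ← map_quad, h.quad_left]
  quad_right := by simp only [← map_mul, ← map_smul, ← map_quad, h.quad_right]

/-- Relations are reflected by injective homomorphisms. This is used for the inclusion of the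
D(H)-linear endomorphisms into all endomorphisms, where the computations take place. -/
theorem IsCubic.of_map {ω u : k} {T : A} {f : A →ₐ[k] A'} (hf : Function.Injective f)
    (h : IsCubic ω u (f T)) : IsCubic ω u T := by
  apply hf
  rw [map_mul, map_smul, map_quad, h]

theorem IsAdjacent.of_map {ω u : k} {T T' : A} {f : A →ₐ[k] A'} (hf : Function.Injective f)
    (h : IsAdjacent ω u (f T) (f T')) : IsAdjacent ω u T T' where
  braid := hf (by simp only [map_mul, h.braid])
  left := hf (by simp only [map_mul, map_smul, map_quad, h.left])
  right := hf (by simp only [map_mul, map_smul, map_quad, h.right])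
  quad_left := hf (by simp only [map_mul, map_smul, map_quad, h.quad_left])
  quad_right := hf (by simp only [map_mul, map_smul, map_quad, h.quad_right])

theorem quad_mul_self {ω : k} (T : A) : quad ω T * T = T * quad ω T := by
  simp [quad, mul_sub, sub_mul, mul_assoc]

/-- The inverse of an element satisfying `IsCubic`. -/
def cubicInv (ω u : k) (T : A) : A := T - ω • 1 - u⁻¹ • quad ω T

variable {ω u : k} {T T' : A}

/-- The definition of Q gives T(T − ω) = 1 + Q, and the cubic relation gives Q = T(u⁻¹Q);
subtracting yields the inverse. -/
theorem IsCubic.mul_inv (h : IsCubic ω u T) (hu : u ≠ 0) : T * cubicInv ω u T = 1 := by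
  rw [cubicInv, mul_sub, mul_sub, mul_smul_comm, mul_smul_comm, h, smul_smul, inv_mul_cancel₀ hu,
    one_smul, mul_one, quad]
  abel

theorem IsCubic.inv_mul (h : IsCubic ω u T) (hu : u ≠ 0) : cubicInv ω u T * T = 1 := by
  rw [cubicInv, sub_mul, sub_mul, smul_mul_assoc, smul_mul_assoc, quad_mul_self, h, smul_smul,
    inv_mul_cancel₀ hu, one_smul, one_mul, quad]
  abel

/-- On the image of Q the element T acts as the scalar u, so Q acts there as u² − ωu − 1. -/
theorem IsCubic.quad_mul_quad (h : IsCubic ω u T) :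
    quad ω T * quad ω T = (u ^ 2 - ω * u - 1) • quad ω T := by
  have h' : T * quad ω T = u • quad ω T := h
  -- The second factor is generalised to an arbitrary Q with TQ = uQ, so that unfolding `quad`
  -- affects only the first factor.
  have e : ∀ Q : A, T * Q = u • Q → quad ω T * Q = (u ^ 2 - ω * u - 1) • Q := by
    intro Q hQ
    rw [quad, sub_mul, sub_mul, mul_assoc, hQ, mul_smul_comm, hQ, smul_mul_assoc, hQ, one_mul]
    module
  exact e _ h'

/-- Since T − T⁻¹ = ω + u⁻¹Q, the element E equals −(ωu)⁻¹Q. All relations involving E become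
relations for Q. -/
theorem one_sub_smul_sub_cubicInv (hω : ω ≠ 0) :
    1 - ω⁻¹ • (T - cubicInv ω u T) = (-(ω⁻¹ * u⁻¹)) • quad ω T := by
  rw [cubicInv]
  match_scalars <;> field_simp
  · ring
  · ring

theorem quad_eq (s : k) (hs : s ≠ 0) : quad (s - s⁻¹) T =
    (T - algebraMap k A s) * (T + algebraMap k A s⁻¹) := by
  simp only [quad, Algebra.algebraMap_eq_smul_one, sub_mul, mul_add, smul_mul_assoc,
    mul_smul_comm, mul_one, one_mul]
  match_scalars <;> field_simp
  ring

/-- Substitute T'⁻¹ = T' − ω − u⁻¹Q'. The three terms contribute −ω, −ω(u² − ωu − 1) and −u⁻¹(ωu)²,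
with sum −ωu². -/
theorem IsAdjacent.left_inv (h : IsAdjacent ω u T T') (hT : IsCubic ω u T) (hω : ω ≠ 0) :
    quad ω T * cubicInv ω u T' * quad ω T = (-(ω * u ^ 2)) • quad ω T := by
  rw [cubicInv, mul_sub, mul_sub, sub_mul, sub_mul, h.left, mul_smul_comm, mul_smul_comm, mul_one,
    smul_mul_assoc, smul_mul_assoc, hT.quad_mul_quad, h.quad_left]
  match_scalars
  field_simp
  ring

theorem IsAdjacent.right_inv (h : IsAdjacent ω u T T') (hT : IsCubic ω u T') (hω : ω ≠ 0) :
    quad ω T' * cubicInv ω u T * quad ω T' = (-(ω * u ^ 2)) • quad ω T' := by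
  rw [cubicInv, mul_sub, mul_sub, sub_mul, sub_mul, h.right, mul_smul_comm, mul_smul_comm, mul_one,
    smul_mul_assoc, smul_mul_assoc, hT.quad_mul_quad, h.quad_right]
  match_scalars
  field_simp
  ring

/-- With u = t⁻¹ and E_i = −(ωu)⁻¹Q_i, every defining relation becomes one of the polynomial
relations assumed here or one of their consequences above. The inverse generators are sent to
`cubicInv`. -/
theorem exists_algHom {r : ℕ} {s t : k} (hs : s ≠ 0) (ht : t ≠ 0) (hω : s - s⁻¹ ≠ 0)
    (R : Fin (r - 1) → A) (hcubic : ∀ i, IsCubic (s - s⁻¹) t⁻¹ (R i))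
    (hadj : ∀ i j, i.val + 1 = j.val → IsAdjacent (s - s⁻¹) t⁻¹ (R i) (R j))
    (hcomm : ∀ i j, i.val + 1 < j.val → R i * R j = R j * R i) :
    ∃ Φ : BMW k r s t →ₐ[k] A, ∀ i, Φ (BMW.T i) = R i ∧ ∃ Rinv : A, R i * Rinv = 1 ∧ Rinv * R i = 1 ∧
      Φ (BMW.E i) = 1 - (s - s⁻¹)⁻¹ • (R i - Rinv) := by
  have hu : t⁻¹ ≠ 0 := inv_ne_zero ht
  let Rinv : Fin (r - 1) → A := fun i => cubicInv (s - s⁻¹) t⁻¹ (R i)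
  let F : FreeAlgebra k (Gen r) →ₐ[k] A := FreeAlgebra.lift k fun g => match g with
    | .T i => R i
    | .Tinv i => Rinv i
  have hT : ∀ i, F (fT k i) = R i := fun i => FreeAlgebra.lift_ι_apply _ _
  have hTinv : ∀ i, F (fTinv k i) = Rinv i := fun i => FreeAlgebra.lift_ι_apply _ _
  have hE' : ∀ i, F (fE k s i) = 1 - (s - s⁻¹)⁻¹ • (R i - Rinv i) := by
    intro i
    rw [fE, map_sub, map_one, map_smul, map_sub, hT, hTinv]
  have hE : ∀ i, F (fE k s i) = (-((s - s⁻¹)⁻¹ * t⁻¹⁻¹)) • quad (s - s⁻¹) (R i) := fun i =>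
    (hE' i).trans (one_sub_smul_sub_cubicInv hω)
  have hF : ∀ ⦃a b : FreeAlgebra k (Gen r)⦄, Rel k r s t a b → F a = F b := by
    intro a b hab
    induction hab with
    | T_Tinv i => rw [map_mul, hT, hTinv, map_one]; exact (hcubic i).mul_inv hu
    | Tinv_T i => rw [map_mul, hT, hTinv, map_one]; exact (hcubic i).inv_mul hu
    | cubic i =>
      -- The first two factors multiply to Q, so the cubic expression is QT − t⁻¹Q, which vanishes.
      rw [map_mul, map_mul, map_sub, map_add, map_sub, hT, AlgHom.commutes, AlgHom.commutes,
        AlgHom.commutes, ← quad_eq s hs, mul_sub, quad_mul_self, hcubic i,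
        Algebra.algebraMap_eq_smul_one, mul_smul_comm, mul_one, sub_self, map_zero]
    | braid i j h => simp only [map_mul, hT]; exact (hadj i j h).braid
    | comm i j h =>
      simp only [map_mul, hT]
      rcases h with h | h
      · exact hcomm i j h
      · exact (hcomm j i h).symm
    | E_T_E i j h =>
      -- Dividing E_iT_jE_i = tE_i by the factors of E leaves QT_jQ = −tωuQ, and tu = 1.
      have e : quad (s - s⁻¹) (R i) * R j * quad (s - s⁻¹) (R i) =
          (-(s - s⁻¹)) • quad (s - s⁻¹) (R i) := by
        rcases h with h | h
        · exact (hadj i j h).left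
        · exact (hadj j i h).right
      rw [map_mul, map_mul, map_smul, hE, hT, smul_mul_assoc, smul_mul_assoc, mul_smul_comm, e]
      match_scalars
      field_simp
    | E_Tinv_E i j h =>
      -- The same cancellation with t⁻¹ = u in place of t gives the factor −ωu².
      have e : quad (s - s⁻¹) (R i) * Rinv j * quad (s - s⁻¹) (R i) =
          (-((s - s⁻¹) * t⁻¹ ^ 2)) • quad (s - s⁻¹) (R i) := by
        rcases h with h | h
        · exact (hadj i j h).left_inv (hcubic i) hω
        · exact (hadj j i h).right_inv (hcubic i) hω
      rw [map_mul, map_mul, map_smul, hE, hTinv, smul_mul_assoc, smul_mul_assoc, mul_smul_comm, e]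
      match_scalars
      field_simp
    | E_T i =>
      rw [map_mul, map_smul, hE, hT, smul_mul_assoc, quad_mul_self, hcubic i, smul_comm]
    | T_E i => rw [map_mul, map_smul, hE, hT, mul_smul_comm, hcubic i, smul_comm]
  refine ⟨RingQuot.liftAlgHom k ⟨F, hF⟩, fun i => ⟨?_, Rinv i, (hcubic i).mul_inv hu,
    (hcubic i).inv_mul hu, ?_⟩⟩
  · exact (RingQuot.liftAlgHom_mkAlgHom_apply k _ _ _).trans (hT i)
  · exact (RingQuot.liftAlgHom_mkAlgHom_apply k _ _ _).trans (hE' i)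

end Relations

end BMW

/-! ### Transport of the relations from two and three factors to all tensor powers. -/

namespace DrinfeldDouble

section Operators

variable {k V W : Type*} [Field k] [AddCommGroup V] [Module k V] [AddCommGroup W] [Module k W]

/-- The operator `f ⊗ id` on `V ⊗ (V ⊗ (V ⊗ W))`, for `f` on `V ⊗ (V ⊗ V)`. -/
noncomputable def leftOp₃ (k V W : Type*) [Field k] [AddCommGroup V] [Module k V]
    [AddCommGroup W] [Module k W] :
    Module.End k (V ⊗[k] (V ⊗[k] V)) →ₐ[k] Module.End k (V ⊗[k] (V ⊗[k] (V ⊗[k] W))) :=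
  (((TensorProduct.assoc k V (V ⊗[k] V) W).trans
    (LinearEquiv.lTensor V (TensorProduct.assoc k V V W))).conjAlgEquiv k).toAlgHom.comp
    (Module.End.rTensorAlgHom k (V ⊗[k] (V ⊗[k] V)) W)

theorem leftOp₃_tmul (f : Module.End k (V ⊗[k] (V ⊗[k] V))) (u v w : V) (z : W) :
    leftOp₃ k V W f (u ⊗ₜ (v ⊗ₜ (w ⊗ₜ z))) =
      LinearMap.lTensor V (TensorProduct.assoc k V V W).toLinearMap
        (TensorProduct.assoc k V (V ⊗[k] V) W (f (u ⊗ₜ (v ⊗ₜ w)) ⊗ₜ z)) := rfl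

theorem end_ext₄ {f g : Module.End k (V ⊗[k] (V ⊗[k] (V ⊗[k] W)))}
    (h : ∀ u v w z, f (u ⊗ₜ (v ⊗ₜ (w ⊗ₜ z))) = g (u ⊗ₜ (v ⊗ₜ (w ⊗ₜ z)))) : f = g := by
  ext u v w z
  exact h u v w z

/-- Together with `leftOp₃_lTensor` this identifies the two neighbouring operators at the front of a
long tensor power with the images of those on V ⊗ V ⊗ V under one algebra homomorphism, so that
every relation between them is transported at once. -/
theorem leftOp₃_leftOp (f : Module.End k (V ⊗[k] V)) :
    leftOp₃ k V W (leftOp k V V f) = leftOp k V (V ⊗[k] W) f := by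
  apply end_ext₄
  intro u v w z
  rw [leftOp₃_tmul, leftOp_tmul, leftOp_tmul]
  generalize f (u ⊗ₜ v) = x
  induction x using TensorProduct.induction_on with
  | zero => simp
  | add x y hx hy => simp only [TensorProduct.add_tmul, map_add, hx, hy]
  | tmul a b => simp

theorem leftOp₃_lTensor (f : Module.End k (V ⊗[k] V)) :
    leftOp₃ k V W (LinearMap.lTensor V f) = LinearMap.lTensor V (leftOp k V W f) := by
  apply end_ext₄
  intro u v w z
  rw [leftOp₃_tmul, LinearMap.lTensor_tmul, LinearMap.lTensor_tmul, leftOp_tmul]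
  generalize f (v ⊗ₜ w) = x
  induction x using TensorProduct.induction_on with
  | zero => simp
  | add x y hx hy => simp only [TensorProduct.add_tmul, TensorProduct.tmul_add, map_add, hx, hy]
  | tmul a b => simp

/-- The two operators act on disjoint tensor factors. -/
theorem leftOp_mul_lTensor_lTensor (f : Module.End k (V ⊗[k] V)) (g : Module.End k W) :
    leftOp k V W f * LinearMap.lTensor V (LinearMap.lTensor V g) =
      LinearMap.lTensor V (LinearMap.lTensor V g) * leftOp k V W f := by
  apply TensorProduct.ext'
  intro u y
  induction y using TensorProduct.induction_on with
  | zero => simp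
  | add x y hx hy => simp only [TensorProduct.tmul_add, map_add, hx, hy]
  | tmul v w =>
    rw [Module.End.mul_apply, Module.End.mul_apply, LinearMap.lTensor_tmul,
      LinearMap.lTensor_tmul, leftOp_tmul, leftOp_tmul]
    generalize f (u ⊗ₜ v) = x
    induction x using TensorProduct.induction_on with
    | zero => simp
    | add x y hx hy => simp only [TensorProduct.add_tmul, map_add, hx, hy]
    | tmul a b => simp

end Operators

namespace Mod

universe u

variable {k H : Type u} [Field k] [Ring H] [HopfAlgebra k H] [BijectiveAntipode k H]
  [Module.Finite k H] (V : Mod k H) {ω u : k}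

/-- `braidAt` in any position in range is the image of the braiding under an algebra homomorphism.
The bound excludes the default value 1, for which Q = −ω and the relation would force ω = 0 or u =
1. -/
theorem isCubic_braidAt (h : BMW.IsCubic ω u (A := Module.End k (V.carrier ⊗[k] V.carrier))
    (braidOf V.ρ)) (r i : ℕ) (hi : i + 2 ≤ r) : BMW.IsCubic ω u (V.braidAt r i) := by
  induction r generalizing i with
  | zero => omega
  | succ r ih =>
    match r, i with
    | 0, _ => omega
    | r + 1, 0 => exact h.map (leftOp k V.carrier (V.tpow r).carrier)
    | r + 1, i + 1 =>
      exact (ih i (by omega)).map (Module.End.lTensorAlgHom k (V.tpow (r + 1)).carrier V.carrier)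

/-- Only three tensor factors are involved; the factors before and after them are carried along by
algebra homomorphisms. The tail may be just the trivial module in which the tensor power ends. -/
theorem isAdjacent_braidAt (h : BMW.IsAdjacent ω u (leftOp k V.carrier V.carrier (braidOf V.ρ))
    (LinearMap.lTensor V.carrier (braidOf V.ρ))) (r i : ℕ) (hi : i + 3 ≤ r) :
    BMW.IsAdjacent ω u (V.braidAt r i) (V.braidAt r (i + 1)) := by
  induction r generalizing i with
  | zero => omega
  | succ r ih =>
    match r, i with
    | 0, _ => omega
    | 1, _ => omega
    | r + 2, 0 =>
      -- The power has length r + 3 here: three factors V, followed by `V.tpow r` as the tail.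
      have e := h.map (leftOp₃ k V.carrier (V.tpow r).carrier)
      rw [leftOp₃_leftOp, leftOp₃_lTensor] at e
      exact e
    | r + 2, i + 1 =>
      exact (ih i (by omega)).map (Module.End.lTensorAlgHom k (V.tpow (r + 2)).carrier V.carrier)

theorem braidAt_comm (r i j : ℕ) (hij : i + 1 < j) (hj : j + 2 ≤ r) :
    V.braidAt r i * V.braidAt r j = V.braidAt r j * V.braidAt r i := by
  induction r generalizing i j with
  | zero => omega
  | succ r ih =>
    match r, i, j with
    | 0, _, _ => omega
    | 1, _, _ => omega
    -- As i = 0, the inequality i + 1 < j lets j be written with a shift by two, and that operator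
    -- leaves the first two factors alone.
    | r + 2, 0, j + 2 =>
      exact leftOp_mul_lTensor_lTensor (V := V.carrier) (braidOf V.ρ) (V.braidAt (r + 1) j)
    | r + 2, i + 1, j + 1 =>
      have e := congrArg (Module.End.lTensorAlgHom k (V.tpow (r + 2)).carrier V.carrier)
        (ih i j (by omega) (by omega))
      rw [map_mul, map_mul] at e
      exact e

end Mod

end DrinfeldDouble

/-! ### The braiding on sixteen tensors, and its quadratic expression of rank at most one. -/

namespace DrinfeldDouble

section FourDimensional

variable {k V W : Type*} [Field k] [AddCommGroup V] [Module k V] [AddCommGroup W] [Module k W]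

/-- The values on basis vectors of the braiding of the self-dual module, where `a ^ 2 = q`. -/
structure IsBraidTable (a : k) (m : Fin 4 → V) (T : Module.End k (V ⊗[k] V)) : Prop where
  t00 : T (m 0 ⊗ₜ m 0) = a⁻¹ • m 0 ⊗ₜ m 0
  t01 : T (m 0 ⊗ₜ m 1) = (a⁻¹ - a) • m 0 ⊗ₜ m 1 + a⁻¹ • m 1 ⊗ₜ m 0
  t02 : T (m 0 ⊗ₜ m 2) = (a⁻¹ - a) • m 0 ⊗ₜ m 2 + a • m 2 ⊗ₜ m 0
  t03 : T (m 0 ⊗ₜ m 3) = (a⁻¹ - 2 * a + a ^ 3) • m 0 ⊗ₜ m 3 + (a⁻¹ - a) • m 1 ⊗ₜ m 2 +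
    (a⁻¹ - a) • m 2 ⊗ₜ m 1 + a • m 3 ⊗ₜ m 0
  t10 : T (m 1 ⊗ₜ m 0) = a • m 0 ⊗ₜ m 1
  t11 : T (m 1 ⊗ₜ m 1) = a⁻¹ • m 1 ⊗ₜ m 1
  t12 : T (m 1 ⊗ₜ m 2) = (a - a ^ 3) • m 0 ⊗ₜ m 3 + a • m 2 ⊗ₜ m 1
  t13 : T (m 1 ⊗ₜ m 3) = (a⁻¹ - a) • m 1 ⊗ₜ m 3 + a⁻¹ • m 3 ⊗ₜ m 1
  t20 : T (m 2 ⊗ₜ m 0) = a⁻¹ • m 0 ⊗ₜ m 2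
  t21 : T (m 2 ⊗ₜ m 1) = (a - a ^ 3) • m 0 ⊗ₜ m 3 + a • m 1 ⊗ₜ m 2
  t22 : T (m 2 ⊗ₜ m 2) = a⁻¹ • m 2 ⊗ₜ m 2
  t23 : T (m 2 ⊗ₜ m 3) = (a⁻¹ - a) • m 2 ⊗ₜ m 3 + a • m 3 ⊗ₜ m 2
  t30 : T (m 3 ⊗ₜ m 0) = a • m 0 ⊗ₜ m 3
  t31 : T (m 3 ⊗ₜ m 1) = a • m 1 ⊗ₜ m 3
  t32 : T (m 3 ⊗ₜ m 2) = a⁻¹ • m 2 ⊗ₜ m 3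
  t33 : T (m 3 ⊗ₜ m 3) = a⁻¹ • m 3 ⊗ₜ m 3

/-- Equality of linear maps needs only generating families, so the table of values can be exploited
without a basis of V. -/
theorem tensor_ext_of_span {N : Type*} [AddCommGroup N] [Module k N] {ι κ : Type*} {m : ι → V}
    {n : κ → W} (hm : Submodule.span k (Set.range m) = ⊤) (hn : Submodule.span k (Set.range n) = ⊤)
    {f g : V ⊗[k] W →ₗ[k] N} (h : ∀ i j, f (m i ⊗ₜ n j) = g (m i ⊗ₜ n j)) : f = g := by
  apply TensorProduct.ext
  refine LinearMap.ext_on hm ?_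
  rintro _ ⟨i, rfl⟩
  refine LinearMap.ext_on hn ?_
  rintro _ ⟨j, rfl⟩
  exact h i j

/-- The quotient map by the span vanishes on all m_i ⊗ n_j, hence is zero. -/
theorem span_tensor {ι κ : Type*} {m : ι → V} {n : κ → W}
    (hm : Submodule.span k (Set.range m) = ⊤) (hn : Submodule.span k (Set.range n) = ⊤) :
    Submodule.span k (Set.range fun p : ι × κ => m p.1 ⊗ₜ[k] n p.2) = ⊤ := by
  have h : (Submodule.span k (Set.range fun p : ι × κ => m p.1 ⊗ₜ[k] n p.2)).mkQ = 0 := by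
    apply tensor_ext_of_span hm hn
    intro i j
    rw [LinearMap.zero_apply, Submodule.mkQ_apply, Submodule.Quotient.mk_eq_zero]
    exact Submodule.subset_span ⟨(i, j), rfl⟩
  rw [← Submodule.ker_mkQ (Submodule.span k _), h, LinearMap.ker_zero]

/-- The invariant vector spanning the image of `T² - ω T - 1`. -/
def invariantVec (a : k) (m : Fin 4 → V) : V ⊗[k] V :=
  -a ^ 2 • m 0 ⊗ₜ m 3 + m 1 ⊗ₜ m 2 + m 2 ⊗ₜ m 1 - m 3 ⊗ₜ m 0

/-- The matrix of the invariant bilinear form defining `T² - ω T - 1`. -/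
def invariantForm (a : k) : Matrix (Fin 4) (Fin 4) k :=
  !![0, 0, 0, a ^ 2 * (1 - a ^ 2);
     0, 0, -a ^ 2 * (1 - a ^ 2), 0;
     0, -a ^ 2 * (1 - a ^ 2), 0, 0;
     1 - a ^ 2, 0, 0, 0]

namespace IsBraidTable

variable {a : k} {m : Fin 4 → V} {T : Module.End k (V ⊗[k] V)}

/-- Off a single line T obeys the Hecke relation (T − a⁻¹)(T + a) = 0: Q is a bilinear form times
one fixed vector. The form and the vector involve only the pairs (i, 3 − i), the ones with trivial
total weight under `K 0` and `K 1`. -/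
theorem quad_apply (h : IsBraidTable a m T) (ha : a ≠ 0) (i j : Fin 4) :
    BMW.quad (a⁻¹ - a) T (m i ⊗ₜ m j) = invariantForm a i j • invariantVec a m := by
  have e : BMW.quad (a⁻¹ - a) T (m i ⊗ₜ m j) =
      T (T (m i ⊗ₜ m j)) - (a⁻¹ - a) • T (m i ⊗ₜ m j) - m i ⊗ₜ m j := rfl
  rw [e]
  fin_cases i <;> fin_cases j <;>
    simp only [Fin.reduceFinMk, Fin.zero_eta, Fin.mk_one, h.t00, h.t01, h.t02, h.t03, h.t10, h.t11,
      h.t12, h.t13, h.t20, h.t21, h.t22, h.t23, h.t30, h.t31, h.t32, h.t33, map_add, map_smul,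
      invariantForm, invariantVec, Matrix.of_apply, Matrix.cons_val] <;>
    match_scalars <;> field_simp <;> ring

/-- The eigenvalue a³ is t⁻¹; as v spans the possible values of Q, this is the whole content of the
cubic relation. -/
theorem apply_invariantVec (h : IsBraidTable a m T) (ha : a ≠ 0) :
    T (invariantVec a m) = a ^ 3 • invariantVec a m := by
  simp only [h.t03, h.t12, h.t21, h.t30, map_add, map_sub, map_smul, invariantVec]
  match_scalars <;> field_simp <;> ring

theorem isCubic (h : IsBraidTable a m T) (ha : a ≠ 0)
    (hm : Submodule.span k (Set.range m) = ⊤) : BMW.IsCubic (a⁻¹ - a) (a ^ 3) T := by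
  apply tensor_ext_of_span hm hm
  intro i j
  rw [Module.End.mul_apply, LinearMap.smul_apply, h.quad_apply ha, map_smul,
    h.apply_invariantVec ha, smul_comm]

/-- Write Q₁ and Q₂ for Q on the first two and on the last two factors. Their images lie in v ⊗ V
and V ⊗ v, so a relation Q₁XQ₁ = cQ₁ or Q₂XQ₂ = cQ₂ has to be checked only on the vectors v ⊗ m_l or
m_l ⊗ v. For X = Q₂ or Q₁ this is the zigzag identity between the form b and the vector v, up to the
scalar (ωu)² = a⁴(1 − a²)². The braid equation is taken as an input. -/
theorem isAdjacent (h : IsBraidTable a m T) (ha : a ≠ 0)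
    (hm : Submodule.span k (Set.range m) = ⊤)
    (hbraid : leftOp k V V T * LinearMap.lTensor V T * leftOp k V V T =
      LinearMap.lTensor V T * leftOp k V V T * LinearMap.lTensor V T) :
    BMW.IsAdjacent (a⁻¹ - a) (a ^ 3) (leftOp k V V T) (LinearMap.lTensor V T) := by
  let C : V →ₗ[k] V ⊗[k] (V ⊗[k] V) :=
    (TensorProduct.assoc k V V V).toLinearMap ∘ₗ TensorProduct.mk k (V ⊗[k] V) V (invariantVec a m)
  let D : V →ₗ[k] V ⊗[k] (V ⊗[k] V) := (TensorProduct.mk k V (V ⊗[k] V)).flip (invariantVec a m)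
  have hC : ∀ z, C z = -a ^ 2 • m 0 ⊗ₜ (m 3 ⊗ₜ z) + m 1 ⊗ₜ (m 2 ⊗ₜ z) + m 2 ⊗ₜ (m 1 ⊗ₜ z) -
      m 3 ⊗ₜ (m 0 ⊗ₜ z) := by
    intro z
    simp [C, invariantVec, TensorProduct.smul_tmul']
  have hD : ∀ z, D z = -a ^ 2 • z ⊗ₜ (m 0 ⊗ₜ m 3) + z ⊗ₜ (m 1 ⊗ₜ m 2) + z ⊗ₜ (m 2 ⊗ₜ m 1) -
      z ⊗ₜ (m 3 ⊗ₜ m 0) := by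
    intro z
    simp [D, invariantVec]
  have hQl : BMW.quad (a⁻¹ - a) (leftOp k V V T) = leftOp k V V (BMW.quad (a⁻¹ - a) T) :=
    (BMW.map_quad (leftOp k V V) _ _).symm
  have hQr : BMW.quad (a⁻¹ - a) (LinearMap.lTensor V T) =
      LinearMap.lTensor V (BMW.quad (a⁻¹ - a) T) :=
    (BMW.map_quad (Module.End.lTensorAlgHom k (V ⊗[k] V) V) _ _).symm
  set Q1 := leftOp k V V (BMW.quad (a⁻¹ - a) T) with hQ1
  set Q2 := LinearMap.lTensor V (BMW.quad (a⁻¹ - a) T) with hQ2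
  have q1 : ∀ i j z, Q1 (m i ⊗ₜ (m j ⊗ₜ z)) = invariantForm a i j • C z := by
    intro i j z
    rw [hQ1, leftOp_tmul, h.quad_apply ha, ← TensorProduct.smul_tmul', map_smul]
    rfl
  have q2 : ∀ z i j, Q2 (z ⊗ₜ (m i ⊗ₜ m j)) = invariantForm a i j • D z := by
    intro z i j
    rw [hQ2, LinearMap.lTensor_tmul, h.quad_apply ha, TensorProduct.tmul_smul]
    rfl
  have hspan := span_tensor hm hm
  -- Q₁ sends m_i ⊗ m_j ⊗ m_l to b(i,j)·v ⊗ m_l, so the scalar b(i,j) factors out of both sides.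
  have key1 : ∀ X : Module.End k (V ⊗[k] (V ⊗[k] V)), ∀ c : k,
      (∀ l, Q1 (X (C (m l))) = c • C (m l)) → Q1 * X * Q1 = c • Q1 := by
    intro X c hX
    apply tensor_ext_of_span hm hspan
    rintro i ⟨j, l⟩
    simp only [Module.End.mul_apply, LinearMap.smul_apply, q1, map_smul, hX]
    rw [smul_comm]
  have key2 : ∀ X : Module.End k (V ⊗[k] (V ⊗[k] V)), ∀ c : k,
      (∀ l, Q2 (X (D (m l))) = c • D (m l)) → Q2 * X * Q2 = c • Q2 := by
    intro X c hX
    apply tensor_ext_of_span hm hspan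
    rintro i ⟨j, l⟩
    simp only [Module.End.mul_apply, LinearMap.smul_apply, q2, map_smul, hX]
    rw [smul_comm]
  refine ⟨hbraid, ?_, ?_, ?_, ?_⟩
  · rw [hQl]
    apply key1
    intro l
    -- Only the left-hand `C` is expanded. Applying Q₁ at the end produces values of `C` again, and
    -- the two sides are compared as multiples of these.
    conv_lhs => rw [hC]
    fin_cases l <;>
      simp only [Fin.reduceFinMk, Fin.zero_eta, Fin.mk_one, h.t00, h.t01, h.t02, h.t03, h.t10,
        h.t11, h.t12, h.t13, h.t20, h.t21, h.t22, h.t23, h.t30, h.t31, h.t32, h.t33, map_add,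
        map_sub, map_smul, LinearMap.lTensor_tmul, TensorProduct.tmul_add, TensorProduct.tmul_smul,
        q1, invariantForm, Matrix.of_apply, Matrix.cons_val] <;>
      match_scalars <;> field_simp <;> ring
  · rw [hQr]
    apply key2
    intro l
    conv_lhs => rw [hD]
    fin_cases l <;>
      simp only [Fin.reduceFinMk, Fin.zero_eta, Fin.mk_one, h.t00, h.t01, h.t02, h.t03, h.t10,
        h.t11, h.t12, h.t13, h.t20, h.t21, h.t22, h.t23, h.t30, h.t31, h.t32, h.t33, map_add,
        map_sub, map_smul, leftOp_tmul, TensorProduct.add_tmul, ← TensorProduct.smul_tmul',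
        TensorProduct.assoc_tmul, q2, invariantForm, Matrix.of_apply, Matrix.cons_val] <;>
      match_scalars <;> field_simp <;> ring
  · rw [hQl, hQr]
    apply key1
    intro l
    conv_lhs => rw [hC]
    fin_cases l <;>
      simp only [Fin.reduceFinMk, Fin.zero_eta, Fin.mk_one, map_add, map_sub, map_smul, q1, q2, hD,
        invariantForm, Matrix.of_apply, Matrix.cons_val] <;>
      match_scalars <;> field_simp <;> ring
  · rw [hQl, hQr]
    apply key2
    intro l
    conv_lhs => rw [hD]
    fin_cases l <;>
      simp only [Fin.reduceFinMk, Fin.zero_eta, Fin.mk_one, map_add, map_sub, map_smul, q1, q2, hC,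
        invariantForm, Matrix.of_apply, Matrix.cons_val] <;>
      match_scalars <;> field_simp <;> ring

end IsBraidTable

end FourDimensional

end DrinfeldDouble

/-! ### Inverse antipode and the action •_χ on generators of a Taft algebra. -/

namespace TaftAlgebra

section General

variable {k : Type*} [Field k] {n ℓ : ℕ} [NeZero ℓ] {q : k} [hq : Fact (IsPrimitiveRoot q ℓ)]

theorem antipode_Kinv (i : Fin n) :
    HopfAlgebra.antipode k (Kinv i : TaftAlgebra k n ℓ q) = K i := by
  simp [antipode_eq]

theorem antipode_x (i : Fin n) :
    HopfAlgebra.antipode k (x i : TaftAlgebra k n ℓ q) = -(Kinv i * x i) := by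
  simp [antipode_eq]

theorem antipodeInv_K (i : Fin n) : antipodeInv k (TaftAlgebra k n ℓ q) (K i) = Kinv i := by
  rw [antipodeInv_eq_iff, antipode_Kinv]

theorem antipodeInv_x (i : Fin n) :
    antipodeInv k (TaftAlgebra k n ℓ q) (x i) = -(x i * Kinv i) := by
  rw [antipodeInv_eq_iff, map_neg, HopfAlgebra.antipode_mul_antidistrib, antipode_x,
    antipode_Kinv, mul_neg, neg_neg, ← mul_assoc, K_mul_Kinv, one_mul]

theorem char_K (α : Fin n → ℕ) (i : Fin n) :
    char α (K i : TaftAlgebra k n ℓ q) = q ^ α i := lift_K _ i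

theorem char_x (α : Fin n → ℕ) (i : Fin n) :
    char α (x i : TaftAlgebra k n ℓ q) = 0 := lift_x _ i

theorem radfordAct_K (χ : TaftAlgebra k n ℓ q →ₐ[k] k) (i : Fin n) (v : TaftAlgebra k n ℓ q) :
    DrinfeldDouble.radfordAct χ (K i) v = χ (K i) • (K i * (v * Kinv i)) := by
  have e : DrinfeldDouble.comul₃ k _ (K i : TaftAlgebra k n ℓ q) = K i ⊗ₜ (K i ⊗ₜ K i) := by
    simp [DrinfeldDouble.comul₃]
  rw [DrinfeldDouble.radfordAct_apply, e, DrinfeldDouble.radfordAux_tmul, antipodeInv_K]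

/-- The twofold coproduct of x is x ⊗ 1 ⊗ 1 + K ⊗ x ⊗ 1 + K ⊗ K ⊗ x. The middle term dies because
χ(x) = 0, and the rest is a twisted commutator with x, multiplied by K⁻¹. -/
theorem radfordAct_x (χ : TaftAlgebra k n ℓ q →ₐ[k] k) (hχ : ∀ i, χ (x i) = 0) (i : Fin n)
    (v : TaftAlgebra k n ℓ q) : DrinfeldDouble.radfordAct χ (x i) v =
      χ (K i) • (x i * (v * Kinv i)) - v * (x i * Kinv i) := by
  have e : DrinfeldDouble.comul₃ k _ (x i : TaftAlgebra k n ℓ q) =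
      x i ⊗ₜ (1 ⊗ₜ 1) + K i ⊗ₜ (x i ⊗ₜ 1 + K i ⊗ₜ x i) := by
    simp [DrinfeldDouble.comul₃, Algebra.TensorProduct.one_def]
  rw [DrinfeldDouble.radfordAct_apply, e]
  simp only [map_add, TensorProduct.tmul_add, LinearMap.add_apply, DrinfeldDouble.radfordAux_tmul,
    antipodeInv_K, antipodeInv_x, hχ, map_one, zero_smul, one_smul, one_mul, zero_add, mul_neg]
  abel

omit [NeZero ℓ] hq in
theorem K_pow_mul_x (i j : Fin n) (m : ℕ) : (K i ^ m * x j : TaftAlgebra k n ℓ q) =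
    (Taft.theta q i j * if i = j then q else 1) ^ m • (x j * K i ^ m) := by
  induction m with
  | zero => simp
  | succ m ih =>
    rw [pow_succ, mul_assoc, K_mul_x, mul_smul_comm, ← mul_assoc, ih, smul_mul_assoc, smul_smul,
      ← pow_succ', mul_assoc, ← pow_succ]

theorem Kinv_mul_x (i j : Fin n) : (Kinv i * x j : TaftAlgebra k n ℓ q) =
    (Taft.theta q i j * if i = j then q else 1)⁻¹ • (x j * Kinv i) := by
  have hc : (Taft.theta q i j * if i = j then q else 1) ≠ 0 :=
    mul_ne_zero (theta_ne_zero (q_ne_zero hq.out) i j)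
      (by split_ifs <;> simp [q_ne_zero hq.out])
  rw [x_mul_Kinv, smul_smul, inv_mul_cancel₀ hc, one_smul]

end General

end TaftAlgebra

/-! ### Rank two: four explicit vectors, their coproducts and the resulting table of the braiding.
-/

namespace TaftAlgebra

section RankTwo

variable {k : Type*} [Field k] {ℓ : ℕ} [NeZero ℓ] {q : k} [hq : Fact (IsPrimitiveRoot q ℓ)]

omit [NeZero ℓ] hq in
theorem K0_x0 : (K 0 * x 0 : TaftAlgebra k 2 ℓ q) = q • (x 0 * K 0) := by simp [K_mul_x, Taft.theta]

omit [NeZero ℓ] hq in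
theorem K0_x1 : (K 0 * x 1 : TaftAlgebra k 2 ℓ q) = q⁻¹ • (x 1 * K 0) := by simp [K_mul_x, Taft.theta]

omit [NeZero ℓ] hq in
theorem K1_x0 : (K 1 * x 0 : TaftAlgebra k 2 ℓ q) = q • (x 0 * K 1) := by simp [K_mul_x, Taft.theta]

omit [NeZero ℓ] hq in
theorem K1_x1 : (K 1 * x 1 : TaftAlgebra k 2 ℓ q) = q • (x 1 * K 1) := by simp [K_mul_x, Taft.theta]

theorem Kinv0_x0 : (Kinv 0 * x 0 : TaftAlgebra k 2 ℓ q) = q⁻¹ • (x 0 * Kinv 0) := by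
  simp [Kinv_mul_x, Taft.theta]

theorem Kinv0_x1 : (Kinv 0 * x 1 : TaftAlgebra k 2 ℓ q) = q • (x 1 * Kinv 0) := by
  simp [Kinv_mul_x, Taft.theta]

theorem Kinv1_x0 : (Kinv 1 * x 0 : TaftAlgebra k 2 ℓ q) = q⁻¹ • (x 0 * Kinv 1) := by
  simp [Kinv_mul_x, Taft.theta]

theorem Kinv1_x1 : (Kinv 1 * x 1 : TaftAlgebra k 2 ℓ q) = q⁻¹ • (x 1 * Kinv 1) := by
  simp [Kinv_mul_x, Taft.theta]

omit [NeZero ℓ] hq in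
theorem x1_x0 : (x 1 * x 0 : TaftAlgebra k 2 ℓ q) = q • (x 0 * x 1) := by
  rw [x_mul_x]; simp [Taft.theta]

variable (k ℓ q) in
/-- The group-like element `K₁ ^ i₀ K₂ ^ i₀`. -/
noncomputable def halfK : TaftAlgebra k 2 ℓ q := Kmon ![(ℓ + 1) / 2, (ℓ + 1) / 2]

omit [NeZero ℓ] hq in
theorem halfK_eq : halfK k ℓ q = K 0 ^ ((ℓ + 1) / 2) * K 1 ^ ((ℓ + 1) / 2) := by
  simp [halfK, Kmon, List.ofFn_succ]

variable (k ℓ q) in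
/-- The character with `K₁ ↦ 1` and `K₂ ↦ q ^ (ℓ - 1)`. -/
noncomputable def halfChar : TaftAlgebra k 2 ℓ q →ₐ[k] k := char ![0, ℓ - 1]

theorem halfChar_x (i : Fin 2) : halfChar k ℓ q (x i) = 0 := char_x _ i

theorem halfChar_K0 : halfChar k ℓ q (K 0) = 1 := by
  rw [halfChar, char_K]; simp

theorem halfChar_K1 : halfChar k ℓ q (K 1) = q⁻¹ := by
  rw [halfChar, char_K]
  refine eq_inv_of_mul_eq_one_left ?_
  change q ^ (ℓ - 1) * q = 1
  rw [pow_sub_one_mul (NeZero.ne ℓ), hq.out.pow_eq_one]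

/-- Twice i₀ is ℓ + 1 because ℓ is odd. -/
theorem half_pow_sq (hodd : Odd ℓ) : (q ^ ((ℓ + 1) / 2)) ^ 2 = q := by
  rw [← pow_mul, Nat.div_mul_cancel (by obtain ⟨m, rfl⟩ := hodd; exact ⟨m + 1, by ring⟩), pow_succ,
    hq.out.pow_eq_one, one_mul]

/-- Both `K 0` and `K 1` contribute a factor q^{i₀}, and 2i₀ = ℓ + 1. -/
theorem halfK_x0 (hodd : Odd ℓ) : halfK k ℓ q * x 0 = q • (x 0 * halfK k ℓ q) := by
  rw [halfK_eq, mul_assoc, K_pow_mul_x, mul_smul_comm, ← mul_assoc, K_pow_mul_x, smul_mul_assoc,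
    smul_smul, mul_assoc]
  congr 1
  have h := half_pow_sq (q := q) hodd
  simp only [Taft.theta]
  simpa [sq] using h

/-- The factors q^{-i₀} from `K 0` and q^{i₀} from `K 1` cancel. -/
theorem halfK_x1 : halfK k ℓ q * x 1 = x 1 * halfK k ℓ q := by
  rw [halfK_eq, mul_assoc, K_pow_mul_x, mul_smul_comm, ← mul_assoc, K_pow_mul_x, smul_mul_assoc,
    smul_smul, mul_assoc]
  have h : q ^ ((ℓ + 1) / 2) ≠ 0 := pow_ne_zero _ (q_ne_zero hq.out)
  simp [Taft.theta, h]

omit [NeZero ℓ] hq in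
theorem K_halfK (i : Fin 2) : K i * halfK k ℓ q = halfK k ℓ q * K i := by
  rw [halfK_eq]
  have h : ∀ j : Fin 2, Commute (K i : TaftAlgebra k 2 ℓ q) (K j) := fun j => K_comm i j
  exact ((h 0).pow_right _).mul_right ((h 1).pow_right _)

theorem comul_halfK : Coalgebra.comul (R := k) (halfK k ℓ q) = halfK k ℓ q ⊗ₜ halfK k ℓ q :=
  (isGroupLikeElem_Kmon _).comul_eq_tmul_self

omit [NeZero ℓ] hq in
-- The form of a commutation rule that applies inside a monomial associated to the right; with such
-- rules every monomial is brought into a normal order.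
theorem mul_left_of_eq_smul {a b c d : TaftAlgebra k 2 ℓ q} {r : k} (h : a * b = r • (c * d))
    (z : TaftAlgebra k 2 ℓ q) :
    a * (b * z) = r • (c * (d * z)) := by
  rw [← mul_assoc, h, smul_mul_assoc, mul_assoc]

omit [NeZero ℓ] hq in
theorem mul_left_of_eq {a b c d : TaftAlgebra k 2 ℓ q} (h : a * b = c * d)
    (z : TaftAlgebra k 2 ℓ q) :
    a * (b * z) = c * (d * z) := by
  rw [← mul_assoc, h, mul_assoc]

omit [NeZero ℓ] hq in
theorem mul_left_of_eq_one {a b : TaftAlgebra k 2 ℓ q} (h : a * b = 1)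
    (z : TaftAlgebra k 2 ℓ q) : a * (b * z) = z := by
  rw [← mul_assoc, h, one_mul]

omit [NeZero ℓ] hq in
theorem K_mul_Kinv_comm (i j : Fin 2) : (K i * Kinv j : TaftAlgebra k 2 ℓ q) = Kinv j * K i :=
  (Kinv_mul_K_comm j i).symm

variable (k ℓ q) in
/-- The basis of the self-dual module. -/
noncomputable def basisVec : Fin 4 → TaftAlgebra k 2 ℓ q :=
  ![halfK k ℓ q, (1 - q) • (x 0 * (halfK k ℓ q * Kinv 0)),
    (q⁻¹ - 1) • (x 1 * (halfK k ℓ q * Kinv 1)),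
    ((1 - q) * (q⁻¹ - 1)) • (x 0 * (x 1 * (halfK k ℓ q * (Kinv 0 * Kinv 1))))]

/-- The scalars in `basisVec` are those that appear on applying `x 0` and `x 1` to g = `halfK`, so
that the arrows 0 → 1 and 2 → 3 have coefficient one. The second application of `x 0` gives zero:
moving `x 0` past g costs q, past `Kinv 0` costs q⁻¹, and χ(`K 0`) = 1. -/
theorem act_x0 (hodd : Odd ℓ) (j : Fin 4) :
    DrinfeldDouble.radfordAct (halfChar k ℓ q) (x 0) (basisVec k ℓ q j) =
      ![basisVec k ℓ q 1, 0, basisVec k ℓ q 3, 0] j := by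
  have hq0 := q_ne_zero hq.out
  rw [radfordAct_x _ halfChar_x, halfChar_K0]
  fin_cases j
  all_goals
    -- All x are moved to the left of g and of the inverse K's, which leaves scalar multiples of one
    -- normally ordered monomial on the two sides.
    simp only [basisVec, Fin.reduceFinMk, Fin.zero_eta, Fin.mk_one, Matrix.cons_val, mul_assoc,
      mul_smul_comm, smul_mul_assoc, smul_smul, mul_left_of_eq_smul (halfK_x0 hodd),
      mul_left_of_eq_smul Kinv0_x0, mul_left_of_eq_smul Kinv1_x0,
      mul_left_of_eq_smul x1_x0, Kinv_comm 1 0]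
    match_scalars
    all_goals
      field_simp
      try ring

/-- The second application of `x 1` vanishes because χ(`K 1`) = q⁻¹ equals the factor from moving `x
1` past `Kinv 1`, while g commutes with `x 1`. The coefficient q comes from `x 1 * x 0 = q • (x 0 *
x 1)`. -/
theorem act_x1 (j : Fin 4) :
    DrinfeldDouble.radfordAct (halfChar k ℓ q) (x 1) (basisVec k ℓ q j) =
      ![basisVec k ℓ q 2, q • basisVec k ℓ q 3, 0, 0] j := by
  have hq0 := q_ne_zero hq.out
  rw [radfordAct_x _ halfChar_x, halfChar_K1]
  fin_cases j
  all_goals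
    simp only [basisVec, Fin.reduceFinMk, Fin.zero_eta, Fin.mk_one, Matrix.cons_val, mul_assoc,
      mul_smul_comm, smul_mul_assoc, smul_smul, mul_left_of_eq halfK_x1,
      mul_left_of_eq_smul Kinv0_x1, mul_left_of_eq_smul Kinv1_x1,
      mul_left_of_eq_smul x1_x0]
    match_scalars
    all_goals
      field_simp
      try ring

theorem act_K0 (j : Fin 4) :
    DrinfeldDouble.radfordAct (halfChar k ℓ q) (K 0) (basisVec k ℓ q j) =
      ![1, q, q⁻¹, 1] j • basisVec k ℓ q j := by
  have hq0 := q_ne_zero hq.out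
  rw [radfordAct_K, halfChar_K0]
  fin_cases j
  all_goals
    simp only [basisVec, Fin.reduceFinMk, Fin.zero_eta, Fin.mk_one, Matrix.cons_val, mul_assoc,
      mul_smul_comm, smul_mul_assoc, smul_smul, mul_left_of_eq (K_halfK 0), K_mul_Kinv,
      mul_left_of_eq (K_mul_Kinv_comm 0 _), mul_left_of_eq_smul K0_x0, mul_left_of_eq_smul K0_x1,
      mul_one]
  all_goals
    match_scalars
    field_simp

theorem act_K1 (j : Fin 4) :
    DrinfeldDouble.radfordAct (halfChar k ℓ q) (K 1) (basisVec k ℓ q j) =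
      ![q⁻¹, 1, 1, q] j • basisVec k ℓ q j := by
  have hq0 := q_ne_zero hq.out
  rw [radfordAct_K, halfChar_K1]
  fin_cases j
  all_goals
    simp only [basisVec, Fin.reduceFinMk, Fin.zero_eta, Fin.mk_one, Matrix.cons_val, mul_assoc,
      mul_smul_comm, smul_mul_assoc, smul_smul, mul_left_of_eq (K_halfK 1), K_mul_Kinv,
      mul_left_of_eq (K_mul_Kinv_comm 1 _), mul_left_of_eq_smul K1_x0, mul_left_of_eq_smul K1_x1,
      mul_one]
  all_goals
    match_scalars
    field_simp

/-- Multiply the coproducts of the generators; the left tensor factors are again multiples of the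
four vectors. The extra q⁻¹ in the last row comes from moving `K 0` past `x 1`. These right tensor
factors are what acts in the braiding. -/
theorem comul_basisVec (j : Fin 4) : Coalgebra.comul (R := k) (basisVec k ℓ q j) =
    ![basisVec k ℓ q 0 ⊗ₜ halfK k ℓ q,
      basisVec k ℓ q 1 ⊗ₜ (halfK k ℓ q * Kinv 0) +
        (1 - q) • basisVec k ℓ q 0 ⊗ₜ (x 0 * (halfK k ℓ q * Kinv 0)),
      basisVec k ℓ q 2 ⊗ₜ (halfK k ℓ q * Kinv 1) +
        (q⁻¹ - 1) • basisVec k ℓ q 0 ⊗ₜ (x 1 * (halfK k ℓ q * Kinv 1)),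
      basisVec k ℓ q 3 ⊗ₜ (halfK k ℓ q * (Kinv 0 * Kinv 1)) +
        (q⁻¹ - 1) • basisVec k ℓ q 1 ⊗ₜ (x 1 * (halfK k ℓ q * (Kinv 0 * Kinv 1))) +
        ((1 - q) * q⁻¹) • basisVec k ℓ q 2 ⊗ₜ (x 0 * (halfK k ℓ q * (Kinv 0 * Kinv 1))) +
        ((1 - q) * (q⁻¹ - 1)) • basisVec k ℓ q 0 ⊗ₜ
          (x 0 * (x 1 * (halfK k ℓ q * (Kinv 0 * Kinv 1))))] j := by
  have hq0 := q_ne_zero hq.out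
  fin_cases j
  all_goals
    simp only [basisVec, Fin.reduceFinMk, Fin.zero_eta, Fin.mk_one, Matrix.cons_val, map_smul,
      Bialgebra.comul_mul, comul_halfK, comul_x, comul_Kinv, add_mul, mul_add,
      Algebra.TensorProduct.tmul_mul_tmul, one_mul, mul_left_of_eq (K_halfK _), K_mul_Kinv,
      mul_left_of_eq (K_mul_Kinv_comm 1 0), mul_left_of_eq_one (K_mul_Kinv 0),
      mul_left_of_eq_smul K0_x1, mul_one,
      ← TensorProduct.smul_tmul', smul_add, smul_smul]
  all_goals
    match_scalars
    all_goals
      field_simp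

omit [NeZero ℓ] hq in
theorem isEigen_K_pow {V : Type*} [AddCommGroup V] [Module k V]
    (ρ : TaftAlgebra k 2 ℓ q →ₐ[k] Module.End k V) {i : Fin 2} {v : V} {c : k}
    (h : ρ (K i) v = c • v) (m : ℕ) : ρ (K i ^ m) v = c ^ m • v := by
  induction m with
  | zero => simp
  | succ m ih => rw [pow_succ, map_mul, Module.End.mul_apply, h, map_smul, ih, smul_smul, pow_succ']

omit [NeZero ℓ] hq in
theorem isEigen_Kinv {V : Type*} [AddCommGroup V] [Module k V]
    (ρ : TaftAlgebra k 2 ℓ q →ₐ[k] Module.End k V) {i : Fin 2} {v : V} {c : k} (hc : c ≠ 0)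
    (h : ρ (K i) v = c • v) : ρ (Kinv i) v = c⁻¹ • v := by
  have e : ρ (Kinv i) (ρ (K i) v) = v := by
    rw [← Module.End.mul_apply, ← map_mul, Kinv_mul_K, map_one, Module.End.one_apply]
  rw [h, map_smul] at e
  rw [eq_inv_smul_iff₀ hc, e]

/-- Vectors on which the generators act as on the basis of the self-dual module. -/
structure IsActionTable {V : Type*} [AddCommGroup V] [Module k V]
    (ρ : TaftAlgebra k 2 ℓ q →ₐ[k] Module.End k V) (m : Fin 4 → V) : Prop where
  x0 (j : Fin 4) : ρ (x 0) (m j) = ![m 1, 0, m 3, 0] j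
  x1 (j : Fin 4) : ρ (x 1) (m j) = ![m 2, q • m 3, 0, 0] j
  K0 (j : Fin 4) : ρ (K 0) (m j) = ![1, q, q⁻¹, 1] j • m j
  K1 (j : Fin 4) : ρ (K 1) (m j) = ![q⁻¹, 1, 1, q] j • m j

namespace IsActionTable

variable {V : Type*} [AddCommGroup V] [Module k V]
    {ρ : TaftAlgebra k 2 ℓ q →ₐ[k] Module.End k V} {m : Fin 4 → V}

theorem Kinv0 (h : IsActionTable ρ m) (j : Fin 4) :
    ρ (Kinv 0) (m j) = ![1, q⁻¹, q, 1] j • m j := by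
  have hq0 := q_ne_zero hq.out
  rw [isEigen_Kinv ρ ?_ (h.K0 j)]
  · fin_cases j <;> simp
  · fin_cases j <;> simp [hq0]

theorem Kinv1 (h : IsActionTable ρ m) (j : Fin 4) :
    ρ (Kinv 1) (m j) = ![q, 1, 1, q⁻¹] j • m j := by
  have hq0 := q_ne_zero hq.out
  rw [isEigen_Kinv ρ ?_ (h.K1 j)]
  · fin_cases j <;> simp
  · fin_cases j <;> simp [hq0]

omit [NeZero ℓ] hq in
-- The eigenvalue is the i₀-th power of the product of the eigenvalues of `K 0` and `K 1`, which is
-- q or q⁻¹ on each vector.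
theorem halfK (h : IsActionTable ρ m) {a : k} (ha : q ^ ((ℓ + 1) / 2) = a) (j : Fin 4) :
    ρ (halfK k ℓ q) (m j) = ![a⁻¹, a, a⁻¹, a] j • m j := by
  rw [halfK_eq, map_mul, Module.End.mul_apply, isEigen_K_pow ρ (h.K1 j), map_smul,
    isEigen_K_pow ρ (h.K0 j), smul_smul]
  fin_cases j <;> simp [ha]

/-- The hypotheses are c(v ⊗ w) = Σ w₀ ⊗ w₁·v with the coproducts of `comul_basisVec` inserted.
Evaluating the right-hand factors by the action table and replacing q by a² gives the sixteen
entries. -/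
theorem isBraidTable (h : IsActionTable ρ m) (hodd : Odd ℓ) {a : k}
    (ha : q ^ ((ℓ + 1) / 2) = a) {T : Module.End k (V ⊗[k] V)}
    (h0 : ∀ v, T (v ⊗ₜ m 0) = m 0 ⊗ₜ ρ (TaftAlgebra.halfK k ℓ q) v)
    (h1 : ∀ v, T (v ⊗ₜ m 1) = m 1 ⊗ₜ ρ (TaftAlgebra.halfK k ℓ q * Kinv 0) v +
        (1 - q) • m 0 ⊗ₜ ρ (x 0 * (TaftAlgebra.halfK k ℓ q * Kinv 0)) v)
    (h2 : ∀ v, T (v ⊗ₜ m 2) = m 2 ⊗ₜ ρ (TaftAlgebra.halfK k ℓ q * Kinv 1) v +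
        (q⁻¹ - 1) • m 0 ⊗ₜ ρ (x 1 * (TaftAlgebra.halfK k ℓ q * Kinv 1)) v)
    (h3 : ∀ v, T (v ⊗ₜ m 3) = m 3 ⊗ₜ ρ (TaftAlgebra.halfK k ℓ q * (Kinv 0 * Kinv 1)) v +
        (q⁻¹ - 1) • m 1 ⊗ₜ ρ (x 1 * (TaftAlgebra.halfK k ℓ q * (Kinv 0 * Kinv 1))) v +
        ((1 - q) * q⁻¹) • m 2 ⊗ₜ ρ (x 0 * (TaftAlgebra.halfK k ℓ q * (Kinv 0 * Kinv 1))) v +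
        ((1 - q) * (q⁻¹ - 1)) • m 0 ⊗ₜ
          ρ (x 0 * (x 1 * (TaftAlgebra.halfK k ℓ q * (Kinv 0 * Kinv 1)))) v) :
    DrinfeldDouble.IsBraidTable a m T := by
  have ha0 : a ≠ 0 := ha ▸ pow_ne_zero _ (q_ne_zero hq.out)
  have hqa : q = a ^ 2 := by rw [← ha, half_pow_sq hodd]
  constructor
  all_goals
    simp only [h0, h1, h2, h3, map_mul, Module.End.mul_apply, h.x0, h.x1, h.Kinv0, h.Kinv1,
      h.halfK ha, map_smul, Matrix.cons_val, smul_zero, TensorProduct.tmul_zero,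
      TensorProduct.tmul_smul, smul_smul, add_zero, map_zero]
  all_goals
    try simp only [hqa]
  all_goals
    match_scalars
  all_goals
    try field_simp
  all_goals
    try ring

end IsActionTable

end RankTwo

end TaftAlgebra

/-! ### The self-dual module: spanning vectors and the relations for its braiding. -/

namespace TaftAlgebra

section SelfDual

variable {k : Type*} [Field k] {ℓ : ℕ} [NeZero ℓ] {q : k} [hq : Fact (IsPrimitiveRoot q ℓ)]

variable (k ℓ q) in
/-- The subspace underlying the self-dual module. -/
noncomputable abbrev selfDualSubmodule : Submodule k (TaftAlgebra k 2 ℓ q) :=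
  DrinfeldDouble.radfordSubmodule (halfChar k ℓ q) (halfK k ℓ q)

/-- The four vectors are the results of applying 1, `x 0`, `x 1` and `x 0 * x 1` to g. -/
theorem basisVec_mem (hodd : Odd ℓ) (j : Fin 4) :
    basisVec k ℓ q j ∈ selfDualSubmodule k ℓ q := by
  have h0 : basisVec k ℓ q 0 ∈ selfDualSubmodule k ℓ q := by
    have h := DrinfeldDouble.radfordAct_mem (halfChar k ℓ q) (halfK k ℓ q) 1
    rwa [map_one] at h
  have h1 : basisVec k ℓ q 1 ∈ selfDualSubmodule k ℓ q :=
    (show _ = basisVec k ℓ q 1 from act_x0 hodd 0) ▸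
      DrinfeldDouble.radfordAct_mem (halfChar k ℓ q) (halfK k ℓ q) (x 0)
  have h2 : basisVec k ℓ q 2 ∈ selfDualSubmodule k ℓ q :=
    (show _ = basisVec k ℓ q 2 from act_x1 0) ▸
      DrinfeldDouble.radfordAct_mem (halfChar k ℓ q) (halfK k ℓ q) (x 1)
  have h3 : basisVec k ℓ q 3 ∈ selfDualSubmodule k ℓ q := by
    have h := DrinfeldDouble.radfordAct_mem (halfChar k ℓ q) (halfK k ℓ q) (x 0 * x 1)
    rw [map_mul, Module.End.mul_apply] at h
    have e : DrinfeldDouble.radfordAct (halfChar k ℓ q) (x 1) (halfK k ℓ q) = basisVec k ℓ q 2 :=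
      act_x1 0
    rw [e, act_x0 hodd] at h
    exact h
  fin_cases j
  exacts [h0, h1, h2, h3]

theorem isActionTable_basisVec (hodd : Odd ℓ) :
    IsActionTable (DrinfeldDouble.radfordAct (halfChar k ℓ q)) (basisVec k ℓ q) :=
  ⟨act_x0 hodd, act_x1, act_K0, act_K1⟩

/-- The generators map each of the four vectors into their span, so the whole algebra preserves it.
Applied to g this bounds the submodule H • g from above. -/
theorem IsActionTable.apply_mem_span {V : Type*} [AddCommGroup V] [Module k V]
    {ρ : TaftAlgebra k 2 ℓ q →ₐ[k] Module.End k V} {m : Fin 4 → V} (h : IsActionTable ρ m)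
    (a : TaftAlgebra k 2 ℓ q) {v : V} (hv : v ∈ Submodule.span k (Set.range m)) :
    ρ a v ∈ Submodule.span k (Set.range m) := by
  have hm : ∀ j, m j ∈ Submodule.span k (Set.range m) := fun j => Submodule.subset_span ⟨j, rfl⟩
  have key : ∀ f : Module.End k V, (∀ j, f (m j) ∈ Submodule.span k (Set.range m)) →
      ∀ v ∈ Submodule.span k (Set.range m), f v ∈ Submodule.span k (Set.range m) := by
    intro f hf v hv
    have : Submodule.span k (Set.range m) ≤ (Submodule.span k (Set.range m)).comap f := by
      rw [Submodule.span_le]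
      rintro _ ⟨j, rfl⟩
      exact hf j
    exact this hv
  induction a using gen_induction generalizing v with
  | hK i =>
    refine key _ (fun j => ?_) v hv
    fin_cases i
    · exact h.K0 j ▸ Submodule.smul_mem _ _ (hm j)
    · exact h.K1 j ▸ Submodule.smul_mem _ _ (hm j)
  | hKinv i =>
    refine key _ (fun j => ?_) v hv
    fin_cases i
    · exact h.Kinv0 j ▸ Submodule.smul_mem _ _ (hm j)
    · exact h.Kinv1 j ▸ Submodule.smul_mem _ _ (hm j)
  | hx i =>
    refine key _ (fun j => ?_) v hv
    fin_cases i
    · refine (h.x0 j).symm ▸ ?_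
      fin_cases j
      exacts [hm 1, zero_mem _, hm 3, zero_mem _]
    · refine (h.x1 j).symm ▸ ?_
      fin_cases j
      exacts [hm 2, Submodule.smul_mem _ _ (hm 3), zero_mem _, zero_mem _]
  | hc c =>
    rw [AlgHom.commutes, Module.algebraMap_end_apply]
    exact Submodule.smul_mem _ _ hv
  | hadd a b ha hb =>
    rw [map_add, LinearMap.add_apply]
    exact add_mem (ha hv) (hb hv)
  | hmul a b ha hb =>
    rw [map_mul, Module.End.mul_apply]
    exact ha (hb hv)

theorem selfDualSubmodule_le_span (hodd : Odd ℓ) :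
    selfDualSubmodule k ℓ q ≤ Submodule.span k (Set.range (basisVec k ℓ q)) := by
  rintro _ ⟨a, rfl⟩
  exact (isActionTable_basisVec hodd).apply_mem_span a (Submodule.subset_span ⟨0, rfl⟩)

variable {V : Type*} [AddCommGroup V] [Module k V]
    {ρ : DrinfeldDouble k (TaftAlgebra k 2 ℓ q) →ₐ[k] Module.End k V}
    {f : V →ₗ[k] TaftAlgebra k 2 ℓ q} {m : Fin 4 → V}
    (hρ : DrinfeldDouble.Intertwines ρ (DrinfeldDouble.act _ Coalgebra.comul
      (DrinfeldDouble.isYetterDrinfeld_radfordAct (halfChar k ℓ q))) f)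
    (hf : Function.Injective f) (hm : ∀ j, f (m j) = basisVec k ℓ q j)

include hf hm in
-- The injective map f sends the span of m onto the span of `basisVec`, which contains the range of
-- f.
theorem span_eq_top_of_range_le (hodd : Odd ℓ)
    (hrange : LinearMap.range f ≤ selfDualSubmodule k ℓ q) :
    Submodule.span k (Set.range m) = ⊤ := by
  have e : f ∘ m = basisVec k ℓ q := funext hm
  rw [eq_top_iff, ← Submodule.map_le_map_iff_of_injective hf, Submodule.map_top,
    Submodule.map_span, ← Set.range_comp, e]
  exact hrange.trans (selfDualSubmodule_le_span hodd)

include hρ hf hm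

/-- The module is known here only through an injective D(H)-linear map f into H and preimages of the
four vectors; identities in V are checked after applying f. -/
theorem isActionTable_of_injective (hodd : Odd ℓ) :
    IsActionTable (ρ.comp (DrinfeldDouble.ofHopf k _)) m := by
  have e : ∀ (a : TaftAlgebra k 2 ℓ q) (j : Fin 4),
      f (ρ.comp (DrinfeldDouble.ofHopf k _) a (m j)) =
        DrinfeldDouble.radfordAct (halfChar k ℓ q) a (basisVec k ℓ q j) := by
    intro a j
    refine (hρ (DrinfeldDouble.ofHopf k _ a) (m j)).trans ?_
    rw [DrinfeldDouble.act_ofHopf, hm]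
  constructor <;> intro j <;> apply hf <;> rw [e]
  · rw [act_x0 hodd]
    fin_cases j
    exacts [(hm 1).symm, (map_zero f).symm, (hm 3).symm, (map_zero f).symm]
  · rw [act_x1]
    fin_cases j
    exacts [(hm 2).symm, ((map_smul f q (m 3)).trans (congrArg (q • ·) (hm 3))).symm,
      (map_zero f).symm, (map_zero f).symm]
  · rw [act_K0, map_smul, hm]
  · rw [act_K1, map_smul, hm]

omit hm in
-- In H the dual acts through Δ, so any t lying over Δ(f w) describes its action on w, by
-- injectivity of f.
theorem braidOf_tmul_of_injective (v : V) {w : V} {t : V ⊗[k] TaftAlgebra k 2 ℓ q}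
    (ht : LinearMap.rTensor _ f t = Coalgebra.comul (R := k) (f w)) :
    DrinfeldDouble.braidOf ρ (v ⊗ₜ w) =
      DrinfeldDouble.swapAct (ρ.comp (DrinfeldDouble.ofHopf k _)) (v ⊗ₜ t) := by
  refine DrinfeldDouble.braidOf_tmul ρ v fun p => hf ?_
  rw [hρ, DrinfeldDouble.act_ofDual, DrinfeldDouble.dualAct_apply, ← ht]
  clear ht
  induction t using TensorProduct.induction_on with
  | zero => simp only [map_zero]
  | add t t' h h' => simp only [map_add, h, h']
  | tmul a b =>
    simp only [LinearMap.rTensor_tmul, LinearMap.lTensor_tmul, TensorProduct.rid_tmul, map_smul]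

theorem isBraidTable_of_injective (hodd : Odd ℓ) :
    DrinfeldDouble.IsBraidTable (q ^ ((ℓ + 1) / 2)) m (DrinfeldDouble.braidOf ρ) := by
  refine (isActionTable_of_injective hρ hf hm hodd).isBraidTable hodd rfl
    (fun v => ?_) (fun v => ?_) (fun v => ?_) (fun v => ?_)
  · rw [braidOf_tmul_of_injective hρ hf v (t := m 0 ⊗ₜ halfK k ℓ q),
      DrinfeldDouble.swapAct_tmul]
    rw [LinearMap.rTensor_tmul, hm]
    exact (comul_basisVec (ℓ := ℓ) (q := q) 0).symm
  · rw [braidOf_tmul_of_injective hρ hf v (t := m 1 ⊗ₜ (halfK k ℓ q * Kinv 0) +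
        (1 - q) • m 0 ⊗ₜ (x 0 * (halfK k ℓ q * Kinv 0)))]
    · simp only [TensorProduct.tmul_add, TensorProduct.tmul_smul, map_add, map_smul,
        DrinfeldDouble.swapAct_tmul]
    · simp only [map_add, map_smul, LinearMap.rTensor_tmul, hm]
      exact (comul_basisVec (ℓ := ℓ) (q := q) 1).symm
  · rw [braidOf_tmul_of_injective hρ hf v (t := m 2 ⊗ₜ (halfK k ℓ q * Kinv 1) +
        (q⁻¹ - 1) • m 0 ⊗ₜ (x 1 * (halfK k ℓ q * Kinv 1)))]
    · simp only [TensorProduct.tmul_add, TensorProduct.tmul_smul, map_add, map_smul,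
        DrinfeldDouble.swapAct_tmul]
    · simp only [map_add, map_smul, LinearMap.rTensor_tmul, hm]
      exact (comul_basisVec (ℓ := ℓ) (q := q) 2).symm
  · rw [braidOf_tmul_of_injective hρ hf v (t := m 3 ⊗ₜ (halfK k ℓ q * (Kinv 0 * Kinv 1)) +
        (q⁻¹ - 1) • m 1 ⊗ₜ (x 1 * (halfK k ℓ q * (Kinv 0 * Kinv 1))) +
        ((1 - q) * q⁻¹) • m 2 ⊗ₜ (x 0 * (halfK k ℓ q * (Kinv 0 * Kinv 1))) +
        ((1 - q) * (q⁻¹ - 1)) • m 0 ⊗ₜ (x 0 * (x 1 * (halfK k ℓ q * (Kinv 0 * Kinv 1)))))]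
    · simp only [TensorProduct.tmul_add, TensorProduct.tmul_smul, map_add, map_smul,
        DrinfeldDouble.swapAct_tmul]
    · simp only [map_add, map_smul, LinearMap.rTensor_tmul, hm]
      exact (comul_basisVec (ℓ := ℓ) (q := q) 3).symm

theorem isCubic_of_injective (hodd : Odd ℓ)
    (hrange : LinearMap.range f ≤ selfDualSubmodule k ℓ q) :
    BMW.IsCubic ((q ^ ((ℓ + 1) / 2))⁻¹ - q ^ ((ℓ + 1) / 2)) ((q ^ ((ℓ + 1) / 2)) ^ 3)
      (A := Module.End k (V ⊗[k] V)) (DrinfeldDouble.braidOf ρ) :=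
  (isBraidTable_of_injective hρ hf hm hodd).isCubic (pow_ne_zero _ (q_ne_zero hq.out))
    (span_eq_top_of_range_le hf hm hodd hrange)

theorem isAdjacent_of_injective (hodd : Odd ℓ)
    (hrange : LinearMap.range f ≤ selfDualSubmodule k ℓ q) :
    BMW.IsAdjacent ((q ^ ((ℓ + 1) / 2))⁻¹ - q ^ ((ℓ + 1) / 2)) ((q ^ ((ℓ + 1) / 2)) ^ 3)
      (DrinfeldDouble.leftOp k V V (DrinfeldDouble.braidOf ρ))
      (LinearMap.lTensor V (DrinfeldDouble.braidOf ρ)) := by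
  refine (isBraidTable_of_injective hρ hf hm hodd).isAdjacent (pow_ne_zero _ (q_ne_zero hq.out))
    (span_eq_top_of_range_le hf hm hodd hrange) (DrinfeldDouble.braid_of_injective hρ hf ?_)
  -- The braid equation is not computed from the table: it holds on H, as on every Yetter–Drinfel'd
  -- module, and is inherited along f.
  rw [DrinfeldDouble.braidOf_act]
  exact (DrinfeldDouble.isYetterDrinfeld_radfordAct _).ydBraid_braid

end SelfDual

universe u

variable {k : Type u} [Field k] {ℓ : ℕ} [NeZero ℓ] {q : k} [hq : Fact (IsPrimitiveRoot q ℓ)]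

variable (k ℓ q) in
/-- The embedding of the self-dual module into the Taft algebra. -/
noncomputable def selfDualEmb : (selfDualModule k ℓ q).carrier →ₗ[k] TaftAlgebra k 2 ℓ q :=
  (selfDualSubmodule k ℓ q).subtype

theorem selfDualEmb_injective : Function.Injective (selfDualEmb k ℓ q) :=
  (selfDualSubmodule k ℓ q).subtype_injective

theorem range_selfDualEmb_le :
    LinearMap.range (selfDualEmb k ℓ q) ≤ selfDualSubmodule k ℓ q :=
  (selfDualSubmodule k ℓ q).range_subtype.le

theorem intertwines_selfDualEmb :
    DrinfeldDouble.Intertwines (selfDualModule k ℓ q).ρ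
      (DrinfeldDouble.act _ Coalgebra.comul
        (DrinfeldDouble.isYetterDrinfeld_radfordAct (halfChar k ℓ q))) (selfDualEmb k ℓ q) :=
  fun _ _ => rfl

theorem exists_selfDualEmb_eq_basisVec (hodd : Odd ℓ) :
    ∃ m : Fin 4 → (selfDualModule k ℓ q).carrier, ∀ j, selfDualEmb k ℓ q (m j) = basisVec k ℓ q j :=
  ⟨fun j => (⟨_, basisVec_mem hodd j⟩ : selfDualSubmodule k ℓ q), fun _ => rfl⟩

theorem intertwines_braidOf_selfDualModule :
    DrinfeldDouble.Intertwines
      (DrinfeldDouble.tensorAct (selfDualModule k ℓ q).ρ (selfDualModule k ℓ q).ρ)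
      (DrinfeldDouble.tensorAct (selfDualModule k ℓ q).ρ (selfDualModule k ℓ q).ρ)
      (DrinfeldDouble.braidOf (selfDualModule k ℓ q).ρ) :=
  DrinfeldDouble.intertwines_braidOf_of_injective intertwines_selfDualEmb selfDualEmb_injective
    (DrinfeldDouble.intertwines_braidOf_act _)

end TaftAlgebra

/-! ### The homomorphism from the Birman–Murakami–Wenzl algebra. -/

open TaftAlgebra DrinfeldDouble in
theorem theorem5p8 {k : Type*} [Field k] [IsAlgClosed k] [CharZero k]
    (ℓ : ℕ) [NeZero ℓ] (hodd : Odd ℓ) (hℓ : 1 < ℓ) (q : k) [Fact (IsPrimitiveRoot q ℓ)]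
    (r : ℕ) (hr : 2 ≤ r) (s t : k) (hs : s = (q ^ ((ℓ + 1) / 2))⁻¹)
    (ht : t = ((q ^ ((ℓ + 1) / 2)) ^ 3)⁻¹) :
    ∃ Φ : BMW k r s t →ₐ[k] ((TaftAlgebra.selfDualModule k ℓ q).tpow r).endAlg,
      ∀ i : Fin (r - 1),
        (Φ (BMW.T i) : Module.End k ((TaftAlgebra.selfDualModule k ℓ q).tpow r).carrier) =
            (TaftAlgebra.selfDualModule k ℓ q).braidAt r i ∧
        ∃ Rinv : Module.End k ((TaftAlgebra.selfDualModule k ℓ q).tpow r).carrier,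
          (TaftAlgebra.selfDualModule k ℓ q).braidAt r i * Rinv = 1 ∧
          Rinv * (TaftAlgebra.selfDualModule k ℓ q).braidAt r i = 1 ∧
          (Φ (BMW.E i) : Module.End k ((TaftAlgebra.selfDualModule k ℓ q).tpow r).carrier) =
            1 - (s - s⁻¹)⁻¹ •
              ((TaftAlgebra.selfDualModule k ℓ q).braidAt r i - Rinv) := by
  let M := selfDualModule k ℓ q
  have hq : IsPrimitiveRoot q ℓ := Fact.out
  have hq0 : q ≠ 0 := q_ne_zero hq
  obtain ⟨m, hm⟩ := exists_selfDualEmb_eq_basisVec (k := k) (q := q) hodd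
  have hC := isCubic_of_injective intertwines_selfDualEmb selfDualEmb_injective hm hodd
    range_selfDualEmb_le
  have hA := isAdjacent_of_injective intertwines_selfDualEmb selfDualEmb_injective hm hodd
    range_selfDualEmb_le
  have ha : q ^ ((ℓ + 1) / 2) ≠ 0 := pow_ne_zero _ hq0
  have hsq : (q ^ ((ℓ + 1) / 2)) ^ 2 = q := half_pow_sq hodd
  -- From here on only a ≠ 0 and a² = q matter for the square root a of q.
  generalize q ^ ((ℓ + 1) / 2) = a at *
  subst hs ht
  -- If a⁻¹ = a, then q = a² = 1, which is impossible for a primitive root of order ℓ > 1.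
  have hω : a⁻¹ - (a⁻¹)⁻¹ ≠ 0 := by
    rw [inv_inv, sub_ne_zero]
    intro h
    refine hq.ne_one hℓ ?_
    rw [← hsq, sq]
    nth_rewrite 1 [← h]
    exact inv_mul_cancel₀ ha
  have e1 : a⁻¹ - (a⁻¹)⁻¹ = a⁻¹ - a := by rw [inv_inv]
  have e2 : ((a ^ 3)⁻¹)⁻¹ = a ^ 3 := inv_inv _
  -- The target of Φ is the subalgebra of D(H)-linear maps; its relations are verified in the full
  -- endomorphism algebra and reflected along this inclusion.
  have hinj : Function.Injective (M.tpow r).endAlg.val := Subtype.val_injective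
  obtain ⟨Φ, hΦ⟩ := BMW.exists_algHom (k := k) (A := (M.tpow r).endAlg) (r := r) (s := a⁻¹)
    (t := (a ^ 3)⁻¹) (inv_ne_zero ha) (inv_ne_zero (pow_ne_zero _ ha)) hω
    (fun i => ⟨M.braidAt r i, Mod.mem_endAlg_iff.2 (Mod.intertwines_braidAt M intertwines_braidOf_selfDualModule r i)⟩)
    (fun i => by
      rw [e1, e2]
      exact BMW.IsCubic.of_map hinj (Mod.isCubic_braidAt M hC r i (by omega)))
    (fun i j hij => by
      rw [e1, e2]
      refine BMW.IsAdjacent.of_map hinj ?_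
      change BMW.IsAdjacent _ _ (M.braidAt r i) (M.braidAt r j)
      rw [← hij]
      exact Mod.isAdjacent_braidAt M hA r i (by omega))
    (fun i j hij => Subtype.ext (Mod.braidAt_comm M r i j hij (by omega)))
  refine ⟨Φ, fun i => ⟨congrArg Subtype.val (hΦ i).1, ?_⟩⟩
  obtain ⟨Rinv, h1, h2, h3⟩ := (hΦ i).2
  exact ⟨Rinv.val, congrArg Subtype.val h1, congrArg Subtype.val h2, congrArg Subtype.val h3⟩
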